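/- Let $k\in\mathbb Z$ and let $f,g,h$ be linearly independent (holomorphic) modular forms of weight $k$ on $\mathrm{SL}(2,\mathbb Z)$. Let $W$ be their Wronskian, the determinant with rows $(f,f',f'')$, $(g,g',g'')$, $(h,h',h'')$, and let $$y_1=f/\sqrt[3]{W},\qquad y_2=g/\sqrt[3]{W},\qquad y_3=h/\sqrt[3]{W}$$ (with the same local branch of $\sqrt[3]{W}$). Put $\rho=(-1+\sqrt3\,\mathrm i)/2$ and $W(y_i,y_j)=y_i'y_j-y_j'y_i$. (a) There are meromorphic functions $Q_2,Q_3$ on $\mathbb H$ such that $y_1,y_2,y_3$ satisfy $y'''+Q_2y'+Q_3y=0$ on $\mathbb H$. There is a finite (possibly empty) list $z_1,\dots,z_n\in\mathbb H$ such that $\mathrm i,\rho,z_1,\dots,z_n$ are pairwise $\mathrm{SL}(2,\mathbb Z)$-inequivalent and the singular points of the equation (the poles of $Q_2$ or $Q_3$) are exactly the points equivalent to one of them. Away from the singular points, holomorphic local branches of $(y_1,y_2,y_3)$ exist. There are integers $m^{(1)}_z,m^{(2)}_z\ge0$ for $z\in\{\mathrm i,\rho,z_1,\dots,z_n\}$ and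 $m^{(1)}_\infty,m^{(2)}_\infty\ge1$ such that the equation is Fuchsian at these points and at the cusp $\infty$, with local exponents $$\kappa^{(1)}_z=-\tfrac{2m^{(1)}_z+m^{(2)}_z}{3},\quad \kappa^{(2)}_z=\kappa^{(1)}_z+m^{(1)}_z+1,\quad \kappa^{(3)}_z=\kappa^{(2)}_z+m^{(2)}_z+1,$$ $$\kappa^{(1)}_\infty=-\tfrac{2m^{(1)}_\infty+m^{(2)}_\infty}{3},\quad \kappa^{(2)}_\infty=\kappa^{(1)}_\infty+m^{(1)}_\infty,\quad \kappa^{(3)}_\infty=\kappa^{(2)}_\infty+m^{(2)}_\infty$$ (at $\infty$ with respect to $q=e^{2\pi \mathrm i z}$). (b) For $\lambda,\mu>0$ define, at the non-singular points of $\mathbb H$, $$e^{-U_{1;\lambda,\mu}}=\tfrac14\left(\lambda^2\mu^{-1}|y_1|^2+\mu^2\lambda^{-1}|y_2|^2+\lambda^{-1}\mu^{-1}|y_3|^2\right),$$ $$e^{-U_{2;\lambda,\mu}}=\tfrac14\left(\lambda\mu|W(y_1,y_2)|^2+\lambda^{-2}\mu|W(y_2,y_3)|^2+\lambda\mu^{-2}|W(y_3,y_1)|^2\right),$$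 $$u_{1;\lambda,\mu}=2U_{1;\lambda,\mu}-U_{2;\lambda,\mu},\qquad u_{2;\lambda,\mu}=2U_{2;\lambda,\mu}-U_{1;\lambda,\mu}.$$ Let $w(z)=E_4(z)^3/(E_4(z)^3-E_6(z)^2)$ and $p_j=w(z_j)$; recall $w(\mathrm i)=1$ and $w(\rho)=0$. Then for all $\lambda,\mu>0$ there are real functions $v_{1;\lambda,\mu},v_{2;\lambda,\mu}$ on $\mathbb C=\mathbb R^2$, smooth on $\mathbb C\setminus\{0,1,p_1,\dots,p_n\}$, with $$v_{k;\lambda,\mu}(w(z))=u_{k;\lambda,\mu}(z)-2\ln|w'(z)|\qquad(k=1,2)$$ at every non-singular $z\in\mathbb H$. The functions $v_{k;\lambda,\mu}$ and $e^{v_{k;\lambda,\mu}}$ are locally integrable on $\mathbb R^2$, and $(v_1,v_2)=(v_{1;\lambda,\mu},v_{2;\lambda,\mu})$ solves the $\mathrm{SU}(3)$ Toda system $$\Delta v_1+2e^{v_1}-e^{v_2}=4\pi\tfrac{m_{\mathrm i}^{(1)}-1}{2}\delta_1+4\pi\tfrac{m_\rho^{(1)}-2}{3}\delta_0+4\pi\sum_{j=1}^n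 m_{z_j}^{(1)}\delta_{p_j},$$ $$\Delta v_2+2e^{v_2}-e^{v_1}=4\pi\tfrac{m_{\mathrm i}^{(2)}-1}{2}\delta_1+4\pi\tfrac{m_\rho^{(2)}-2}{3}\delta_0+4\pi\sum_{j=1}^n m_{z_j}^{(2)}\delta_{p_j}$$ in the sense of distributions on $\mathbb R^2$, with $v_k(w)=-2\left(m_\infty^{(k)}+1\right)\ln|w|+O(1)$ as $|w|\to\infty$, $k=1,2$. (c) This is a genuine two-parameter family: if $(v_{1;\lambda,\mu},v_{2;\lambda,\mu})$ and $(v_{1;\lambda',\mu'},v_{2;\lambda',\mu'})$ agree on $\mathbb C\setminus\{0,1,p_1,\dots,p_n\}$ for some $\lambda,\mu,\lambda',\mu'>0$, then $\lambda=\lambda'$ and $\mu=\mu'$. -/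

import Mathlib

open Filter Topology MeasureTheory Asymptotics UpperHalfPlane
open scoped Matrix MatrixGroups ContDiff Laplacian

noncomputable section

namespace TodaModular

/-- A function on the upper half plane, regarded as a function on `ℂ`
(only its values at points with positive imaginary part matter). -/
def ext (f : ℍ → ℂ) : ℂ → ℂ := fun z => f (ofComplex z)

/-- The triple `(f, g, h)`, as functions of a complex variable. -/
def triple {k : ℤ} (f g h : ModularForm 𝒮ℒ k) : Fin 3 → ℂ → ℂ :=
  ![ext f, ext g, ext h]

/-- The Wronskian determinant with rows `(F j, (F j)', (F j)'')`. -/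
def wronskian (F : Fin 3 → ℂ → ℂ) (z : ℂ) : ℂ :=
  Matrix.det (Matrix.of fun j i : Fin 3 => iteratedDeriv (i : ℕ) (F j) z)

/-- `y = (y 0, y 1, y 2)` is a holomorphic branch near `z₀` of the multivalued triple
`F j / ∛W`, where `W` is the Wronskian of `F`; one and the same branch `c` of `∛W` is used for
the three functions. When `W z₀ ≠ 0` such branches exist and differ by a common cube root of
unity; when `W z₀ = 0` a branch exists only if the quotients are single-valued and holomorphic
at `z₀`. -/
structure IsBranch (F : Fin 3 → ℂ → ℂ) (z₀ : ℂ) (y : Fin 3 → ℂ → ℂ) : Prop where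
  analyticAt : ∀ j, AnalyticAt ℂ (y j) z₀
  quotient : ∃ c : ℂ → ℂ, AnalyticAt ℂ c z₀ ∧
    ∀ᶠ z in 𝓝 z₀, c z ^ 3 = wronskian F z ∧ ∀ j, c z * y j z = F j z

/-- `y''' + Q₂ y' + Q₃ y = 0`, with `Q₂` and `Q₃` meromorphic on the upper half plane, is the
differential equation satisfied by the three functions `F j / ∛W`. -/
structure IsEquationOf (F : Fin 3 → ℂ → ℂ) (Q₂ Q₃ : ℂ → ℂ) : Prop where
  meromorphic_two : ∀ z₀ : ℍ, MeromorphicAt Q₂ z₀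
  meromorphic_three : ∀ z₀ : ℍ, MeromorphicAt Q₃ z₀
  solves : ∀ (z₀ : ℍ) (y : Fin 3 → ℂ → ℂ), IsBranch F z₀ y → ∀ j,
    iteratedDeriv 3 (y j) z₀ + Q₂ z₀ * deriv (y j) z₀ + Q₃ z₀ * y j z₀ = 0

/-- `z₀` is a singular point of `y''' + Q₂ y' + Q₃ y = 0`: a pole of `Q₂` or of `Q₃`. -/
def IsSingularPoint (Q₂ Q₃ : ℂ → ℂ) (z₀ : ℂ) : Prop :=
  meromorphicOrderAt Q₂ z₀ < 0 ∨ meromorphicOrderAt Q₃ z₀ < 0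

/-- The equation is Fuchsian at `z₀`, and its local exponents there are `κ 0, κ 1, κ 2`:
`Q_j = A_j (z - z₀)^{-j} + O((z - z₀)^{-j+1})`, and the `κ i` are the roots, with multiplicity,
of the indicial polynomial `X (X - 1) (X - 2) + A₂ X + A₃`. -/
def HasLocalExponents (Q₂ Q₃ : ℂ → ℂ) (z₀ : ℂ) (κ : Fin 3 → ℂ) : Prop :=
  ∃ A₂ A₃ : ℂ,
    Tendsto (fun z => (z - z₀) ^ 2 * Q₂ z) (𝓝[≠] z₀) (𝓝 A₂) ∧
    Tendsto (fun z => (z - z₀) ^ 3 * Q₃ z) (𝓝[≠] z₀) (𝓝 A₃) ∧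
    ∀ X : ℂ, X * (X - 1) * (X - 2) + A₂ * X + A₃ = ∏ i, (X - κ i)

/-- The equation is Fuchsian at the cusp `∞` (of width one), and its local exponents there are
`κ 0, κ 1, κ 2`: the roots, with multiplicity, of
`X ^ 3 + (2πi)⁻² Q₂(∞) X + (2πi)⁻³ Q₃(∞)`. -/
def HasLocalExponentsAtCusp (Q₂ Q₃ : ℂ → ℂ) (κ : Fin 3 → ℂ) : Prop :=
  ∃ B₂ B₃ : ℂ,
    Tendsto (fun z : ℍ => Q₂ z) atImInfty (𝓝 B₂) ∧
    Tendsto (fun z : ℍ => Q₃ z) atImInfty (𝓝 B₃) ∧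
    ∀ X : ℂ, X ^ 3 + B₂ / (2 * Real.pi * Complex.I) ^ 2 * X +
      B₃ / (2 * Real.pi * Complex.I) ^ 3 = ∏ i, (X - κ i)

/-- The exponents `κ¹ = -(2 m¹ + m²) / 3`, `κ² = κ¹ + m¹ + s`, `κ³ = κ² + m² + s`; the shift `s`
is `1` at points of the upper half plane and `0` at the cusp. -/
def exponents (s : ℕ) (m : Fin 2 → ℕ) : Fin 3 → ℂ :=
  ![-(2 * m 0 + m 1) / 3,
    -(2 * m 0 + m 1) / 3 + m 0 + s,
    -(2 * m 0 + m 1) / 3 + m 0 + s + m 1 + s]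

/-- The elliptic point `ρ = (-1 + √3 i) / 2`. -/
def rho : ℍ := ⟨⟨-1 / 2, Real.sqrt 3 / 2⟩, by positivity⟩

/-- The singular points of the equation in the upper half plane are exactly the points
`SL(2, ℤ)`-equivalent to `i`, to `ρ` or to one of `z 0, …, z (n - 1)`, and the points
`i, ρ, z 0, …, z (n - 1)` are pairwise inequivalent. -/
structure IsSingularSystem (Q₂ Q₃ : ℂ → ℂ) {n : ℕ} (z : Fin n → ℍ) : Prop where
  singular_iff : ∀ a : ℍ, IsSingularPoint Q₂ Q₃ a ↔
    ∃ γ : SL(2, ℤ), a = γ • I ∨ a = γ • rho ∨ ∃ j, a = γ • z j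
  ne_I : ∀ (γ : SL(2, ℤ)) (j : Fin n), γ • z j ≠ I
  ne_rho : ∀ (γ : SL(2, ℤ)) (j : Fin n), γ • z j ≠ rho
  inequivalent : ∀ (γ : SL(2, ℤ)) (j l : Fin n), γ • z j = z l → j = l

/-- The Wronskian `W(a, b) = a' b - b' a` of two functions. -/
def wronskian₂ (a b : ℂ → ℂ) (z : ℂ) : ℂ := deriv a z * b z - deriv b z * a z

/-- `U₁` with `e^{-U₁} = (λ² μ⁻¹ |y₁|² + μ² λ⁻¹ |y₂|² + λ⁻¹ μ⁻¹ |y₃|²) / 4`. -/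
def U₁ (lam mu : ℝ) (y : Fin 3 → ℂ → ℂ) (z : ℂ) : ℝ :=
  -Real.log (1 / 4 * (lam ^ 2 * mu⁻¹ * ‖y 0 z‖ ^ 2 + mu ^ 2 * lam⁻¹ * ‖y 1 z‖ ^ 2 +
    lam⁻¹ * mu⁻¹ * ‖y 2 z‖ ^ 2))

/-- `U₂` with
`e^{-U₂} = (λ μ |W(y₁, y₂)|² + λ⁻² μ |W(y₂, y₃)|² + λ μ⁻² |W(y₃, y₁)|²) / 4`. -/
def U₂ (lam mu : ℝ) (y : Fin 3 → ℂ → ℂ) (z : ℂ) : ℝ :=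
  -Real.log (1 / 4 * (lam * mu * ‖wronskian₂ (y 0) (y 1) z‖ ^ 2 +
    (lam ^ 2)⁻¹ * mu * ‖wronskian₂ (y 1) (y 2) z‖ ^ 2 +
    lam * (mu ^ 2)⁻¹ * ‖wronskian₂ (y 2) (y 0) z‖ ^ 2))

/-- `(u₁, u₂) = (2 U₁ - U₂, 2 U₂ - U₁)`. It does not depend on the branch `y` of the solutions. -/
def u (lam mu : ℝ) (y : Fin 3 → ℂ → ℂ) : Fin 2 → ℂ → ℝ :=
  ![fun z => 2 * U₁ lam mu y z - U₂ lam mu y z, fun z => 2 * U₂ lam mu y z - U₁ lam mu y z]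

/-- The modular function `w = E₄³ / (E₄³ - E₆²)`. -/
def wfun (z : ℍ) : ℂ :=
  ModularForm.E₄ z ^ 3 / (ModularForm.E₄ z ^ 3 - ModularForm.E₆ z ^ 2)

/-- The set of sources `{0, 1, p 0, …, p (n - 1)}`. -/
def sources {n : ℕ} (p : Fin n → ℂ) : Set ℂ := {0, 1} ∪ Set.range p

/-- `(v 0, v 1)` solves the `SU(3)` Toda system on `ℝ² = ℂ`, for `{k, k'} = {0, 1}`,
`Δ v_k + 2 e^{v_k} - e^{v_{k'}} = 4π (a_k δ₁ + b_k δ₀ + ∑ j, c_{j,k} δ_{p_j})`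
in the sense of distributions, is smooth away from the sources, and has the behaviour
`v_k(w) = -β_k log |w| + O(1)` at infinity. -/
structure IsTodaSolution {n : ℕ} (p : Fin n → ℂ) (a b : Fin 2 → ℝ) (c : Fin n → Fin 2 → ℝ)
    (β : Fin 2 → ℝ) (v : Fin 2 → ℂ → ℝ) : Prop where
  smooth : ∀ k, ContDiffOn ℝ ∞ (v k) (sources p)ᶜ
  locallyIntegrable : ∀ k, LocallyIntegrable (v k) volume
  locallyIntegrable_exp : ∀ k, LocallyIntegrable (fun w => Real.exp (v k w)) volume
  equation : ∀ (k : Fin 2) (φ : ℂ → ℝ), ContDiff ℝ ∞ φ → HasCompactSupport φ →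
    ∫ w, (v k w * Δ φ w + (2 * Real.exp (v k w) - Real.exp (v k.rev w)) * φ w) =
      4 * Real.pi * (a k * φ 1 + b k * φ 0 + ∑ j, c j k * φ (p j))
  atInfinity : ∀ k, (fun w => v k w + β k * Real.log ‖w‖) =O[Bornology.cobounded ℂ]
    (fun _ => (1 : ℝ))

end TodaModular

end

noncomputable section

namespace TodaModular

/-! For holomorphic functions G_j, Lagrange's identity shows that Δ log ∑ w_j |G_j|² is four times
the weighted sum of squares of the pairwise Wronskians, divided by (∑ w_j |G_j|²)². The pairwise
Wronskians of the pairwise Wronskians are, up to sign, the G_j times the full Wronskian. Division by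
∛W makes the Wronskian of y equal to 1, so this process closes after two steps, and (u₁, u₂) solves
the Toda system wherever a branch exists (`laplacian_u`).

A change of variable ζ acts by y ↦ (y ∘ ζ) / ζ'. It preserves the condition that the Wronskian is 1
and adds 2 log |ζ'| to both u₁ and u₂ (`u_transport`). Modular substitutions act on branches in this
way, the automorphy factor being absorbed into the cube root (`IsBranch.transport_mobius`). Hence u
- 2 log |w'| is invariant. Since w is a bijection from the orbits onto ℂ (`wfun_surjective`,
`wfun_eq_wfun_iff`), it descends to a function v on the plane (`toda`, `toda_wfun`).

All local data come from the orders n₀ < n₁ < n₂ of an adapted basis of the span of f, g, h, at a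
point or in q at the cusp. Leading terms of jets (`JetExpansion`) give the order of W, the local
exponents n_j - ord(W)/3 and the logarithmic coefficient of u. In the upper half plane the numbers m
are the gaps of the orders minus one; both vanish exactly when a branch exists, that is, when the
point is not singular. At i and ρ the stabilisers force the gaps to be at least 2 and 3. So the
ramification points of w are always singular, and the coefficients of the sources there are
nonnegative.

If w has ramification index e at z₀, then v behaves like (2m - 2(e - 1))/e · log |w - w(z₀)|. As log
|x| is 2π times the fundamental solution of the Laplacian, this yields the Dirac masses
(`pairing_eq_sum_of_log_singularities`). At the cusp, w ~ const/q and w' ~ const·w give the growth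
-2(m + 1) log |w|.

For the last claim, 2u₁ + u₂ = 3U₁, so v determines e^{-U₁}. The functions |y_j|² are linearly
independent over ℝ (`eq_zero_of_sum_mul_norm_sq`), so the weights, and with them λ³ and μ³, are
determined. -/

/-! ### Laplacians of logarithms of sums of squares, and the local Toda equation. -/

/-- The Laplacian of a real function whose differential is `v ↦ 2 Re (σ x * v)`. -/
theorem laplacian_of_hasFDerivAt_re {f : ℂ → ℝ} {σ : ℂ → ℂ} {σ' : ℂ →L[ℝ] ℂ} {z : ℂ}
    (hf : ∀ᶠ x in 𝓝 z, HasFDerivAt f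
      ((2 : ℝ) • (Complex.reCLM ∘L (ContinuousLinearMap.mul ℝ ℂ (σ x)))) x)
    (hσ : HasFDerivAt σ σ' z) :
    Δ f z = 2 * (σ' 1).re + 2 * (σ' Complex.I * Complex.I).re := by
  have h1 : fderiv ℝ f =ᶠ[𝓝 z] fun x =>
      (2 : ℝ) • (Complex.reCLM ∘L (ContinuousLinearMap.mul ℝ ℂ (σ x))) :=
    hf.mono fun x hx => hx.fderiv
  have h2 : HasFDerivAt (fun x => (2 : ℝ) • (Complex.reCLM ∘L (ContinuousLinearMap.mul ℝ ℂ (σ x))))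
      ((2 : ℝ) • ((ContinuousLinearMap.compL ℝ ℂ ℂ ℝ Complex.reCLM) ∘L
        (ContinuousLinearMap.mul ℝ ℂ) ∘L σ')) z := by
    have := (((ContinuousLinearMap.compL ℝ ℂ ℂ ℝ Complex.reCLM) ∘L
      (ContinuousLinearMap.mul ℝ ℂ)).hasFDerivAt).comp z hσ
    exact this.const_smul (2 : ℝ)
  rw [InnerProductSpace.laplacian_eq_iteratedFDeriv_complexPlane]
  simp only [iteratedFDeriv_two_apply]
  rw [h1.fderiv_eq, h2.fderiv]
  simp

/-- The weighted sum of squares `∑ w j |G j|²`. -/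
def sqSum (w : Fin 3 → ℝ) (G : Fin 3 → ℂ → ℂ) (z : ℂ) : ℝ := ∑ j, w j * ‖G j z‖ ^ 2

/-- The vector `(W(G₀, G₁), W(G₁, G₂), W(G₂, G₀))`. -/
def minors (G : Fin 3 → ℂ → ℂ) : Fin 3 → ℂ → ℂ :=
  ![wronskian₂ (G 0) (G 1), wronskian₂ (G 1) (G 2), wronskian₂ (G 2) (G 0)]

theorem contDiffAt_sqSum {w : Fin 3 → ℝ} {G : Fin 3 → ℂ → ℂ} {z : ℂ}
    (hG : ∀ j, AnalyticAt ℂ (G j) z) : ContDiffAt ℝ ∞ (sqSum w G) z := by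
  unfold sqSum
  refine ContDiffAt.sum fun j _ => contDiffAt_const.mul (ContDiffAt.norm_sq ℝ ?_)
  exact (hG j).contDiffAt.restrict_scalars ℝ

theorem sqSum_pos {w : Fin 3 → ℝ} (hw : ∀ j, 0 < w j) {G : Fin 3 → ℂ → ℂ} {z : ℂ}
    (h : ∃ j, G j z ≠ 0) : 0 < sqSum w G z := by
  obtain ⟨j, hj⟩ := h
  refine Finset.sum_pos' (fun i _ => by have := hw i; positivity) ⟨j, Finset.mem_univ _, ?_⟩
  have := hw j
  positivity

/-- Holomorphy gives ∂_z |G|² = conj(G) G'. The differential is written as v ↦ 2 Re(σ v), the shape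
that, after division by the sum, `laplacian_of_hasFDerivAt_re` takes as input. -/
theorem hasFDerivAt_sqSum {w : Fin 3 → ℝ} {G : Fin 3 → ℂ → ℂ} {z : ℂ}
    (hG : ∀ j, AnalyticAt ℂ (G j) z) :
    HasFDerivAt (sqSum w G) ((2 : ℝ) • (Complex.reCLM ∘L (ContinuousLinearMap.mul ℝ ℂ
      (∑ j, (w j : ℂ) * (starRingEnd ℂ (G j z) * deriv (G j) z))))) z := by
  have h1 : ∀ j, HasFDerivAt (fun z => w j * ‖G j z‖ ^ 2) _ z := fun j =>
    ((((hG j).differentiableAt.hasDerivAt.hasFDerivAt).restrictScalars ℝ).norm_sq).const_mul (w j)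
  refine (HasFDerivAt.fun_sum (u := Finset.univ) fun j _ => h1 j).congr_fderiv ?_
  ext v
  all_goals
    simp [Fin.sum_univ_three, Complex.inner]
    ring

/-- The Laplacian of `log ∑ w j |G j|²` for holomorphic `G j`. -/
theorem laplacian_log_sqSum {w : Fin 3 → ℝ} {G : Fin 3 → ℂ → ℂ} {z : ℂ}
    (hG : ∀ j, AnalyticAt ℂ (G j) z) (hP : sqSum w G z ≠ 0) :
    Δ (fun x => Real.log (sqSum w G x)) z =
      4 * sqSum ![w 0 * w 1, w 1 * w 2, w 2 * w 0] (minors G) z / sqSum w G z ^ 2 := by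
  have hGe : ∀ᶠ x in 𝓝 z, ∀ j, AnalyticAt ℂ (G j) x :=
    eventually_all.2 fun j => (hG j).eventually_analyticAt
  have hPe : ∀ᶠ x in 𝓝 z, sqSum w G x ≠ 0 :=
    (contDiffAt_sqSum hG).continuousAt.eventually_ne hP
  set S : ℂ → ℂ := fun z => ∑ j, (w j : ℂ) * (starRingEnd ℂ (G j z) * deriv (G j) z) with hS
  have hSd : HasFDerivAt S (∑ j, (w j : ℂ) • ((starRingEnd ℂ (G j z)) •
      (ContinuousLinearMap.mul ℝ ℂ (deriv (deriv (G j)) z)) + (deriv (G j) z) •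
        ((Complex.conjCLE : ℂ →L[ℝ] ℂ) ∘L (ContinuousLinearMap.mul ℝ ℂ (deriv (G j) z))))) z := by
    refine HasFDerivAt.fun_sum fun j _ => HasFDerivAt.const_mul ?_ _
    have e1 : HasFDerivAt (G j) (ContinuousLinearMap.mul ℝ ℂ (deriv (G j) z)) z := by
      refine (((hG j).differentiableAt.hasDerivAt.hasFDerivAt).restrictScalars ℝ).congr_fderiv ?_
      ext
      simp [mul_comm]
    have e2 : HasFDerivAt (deriv (G j)) (ContinuousLinearMap.mul ℝ ℂ (deriv (deriv (G j)) z)) z := by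
      refine (((hG j).deriv.differentiableAt.hasDerivAt.hasFDerivAt).restrictScalars
        ℝ).congr_fderiv ?_
      ext
      simp [mul_comm]
    have e3 := ((Complex.conjCLE : ℂ →L[ℝ] ℂ).hasFDerivAt).comp z e1
    exact e3.mul e2
  have hP0 := hasFDerivAt_sqSum (w := w) hG
  have hinv := (hasDerivAt_inv hP).comp_hasFDerivAt z hP0
  have hσ := hinv.fun_smul hSd
  have key := laplacian_of_hasFDerivAt_re (f := fun x => Real.log (sqSum w G x)) (z := z)
    (by
      filter_upwards [hGe, hPe] with x hx hPx
      refine ((hasFDerivAt_sqSum (w := w) hx).log hPx).congr_fderiv ?_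
      ext v
      all_goals
        simp [hS, Fin.sum_univ_three]
        try ring) hσ
  rw [key]
  have hSz : S z = ∑ j, (w j : ℂ) * (starRingEnd ℂ (G j z) * deriv (G j) z) := rfl
  rw [hSz]
  simp only [Function.comp]
  have hPz : sqSum w G z = ∑ j, w j * ‖G j z‖ ^ 2 := rfl
  generalize sqSum w G z = p at hP hPz ⊢
  rw [eq_div_iff (pow_ne_zero 2 hP)]
  simp only [sqSum, minors, Fin.sum_univ_three, ← Complex.normSq_eq_norm_sq, Complex.normSq_apply,
    Matrix.cons_val_zero, Matrix.cons_val_one, Matrix.cons_val, wronskian₂] at hPz ⊢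
  have hr2 : (p ^ 2)⁻¹ = p⁻¹ * p⁻¹ := by rw [pow_two, mul_inv]
  have hr1 : p * p⁻¹ = 1 := mul_inv_cancel₀ hP
  rw [hr2]
  generalize p⁻¹ = r at hr1 ⊢
  clear hr2 key hσ hinv hP0 hSd hPe hGe hSz hG
  -- The second derivatives enter the differential of σ complex-linearly, so they cancel between the
  -- directions 1 and i.
  generalize deriv (deriv (G 0)) z = a0
  generalize deriv (deriv (G 1)) z = a1
  generalize deriv (deriv (G 2)) z = a2
  generalize deriv (G 0) z = b0
  generalize deriv (G 1) z = b1
  generalize deriv (G 2) z = b2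
  generalize G 0 z = g0 at hPz ⊢
  generalize G 1 z = g1 at hPz ⊢
  generalize G 2 z = g2 at hPz ⊢
  obtain ⟨g00, g01⟩ := g0
  obtain ⟨g10, g11⟩ := g1
  obtain ⟨g20, g21⟩ := g2
  obtain ⟨b00, b01⟩ := b0
  obtain ⟨b10, b11⟩ := b1
  obtain ⟨b20, b21⟩ := b2
  simp
  have hr3 : p ^ 2 * r = p := by rw [pow_two, mul_assoc, hr1, mul_one]
  have hr4 : p ^ 2 * (r * r) = 1 := by linear_combination (p * r + 1) * hr1
  -- Lagrange's identity: (∑ w|G|²)(∑ w|G'|²) - |∑ w conj(G) G'|² = ∑ w_i w_j |W(G_i, G_j)|², the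
  -- last sum over pairs.
  linear_combination 4 * (w 0 * (b00 ^ 2 + b01 ^ 2) + w 1 * (b10 ^ 2 + b11 ^ 2) +
    w 2 * (b20 ^ 2 + b21 ^ 2)) * (hPz + hr3) - 4 *
      ((w 0 * (g00 * b00 + g01 * b01) + w 1 * (g10 * b10 + g11 * b11) +
        w 2 * (g20 * b20 + g21 * b21)) ^ 2 + (w 0 * (g00 * b01 - g01 * b00) +
        w 1 * (g10 * b11 - g11 * b10) + w 2 * (g20 * b21 - g21 * b20)) ^ 2) * hr4

theorem U₁_eq (lam mu : ℝ) (y : Fin 3 → ℂ → ℂ) (z : ℂ) :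
    U₁ lam mu y z = -Real.log (sqSum ![1 / 4 * lam ^ 2 * mu⁻¹, 1 / 4 * mu ^ 2 * lam⁻¹,
      1 / 4 * lam⁻¹ * mu⁻¹] y z) := by
  simp only [U₁, sqSum, Fin.sum_univ_three]
  simp only [Matrix.cons_val_zero, Matrix.cons_val_one, Matrix.cons_val]
  ring_nf

theorem U₂_eq (lam mu : ℝ) (y : Fin 3 → ℂ → ℂ) (z : ℂ) :
    U₂ lam mu y z = -Real.log (sqSum ![1 / 4 * lam * mu, 1 / 4 * (lam ^ 2)⁻¹ * mu,
      1 / 4 * lam * (mu ^ 2)⁻¹] (minors y) z) := by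
  simp only [U₂, sqSum, minors, Fin.sum_univ_three]
  simp only [Matrix.cons_val_zero, Matrix.cons_val_one, Matrix.cons_val]
  ring_nf

theorem wronskian_eq (F : Fin 3 → ℂ → ℂ) (z : ℂ) :
    wronskian F z =
      F 0 z * (deriv (F 1) z * deriv (deriv (F 2)) z - deriv (deriv (F 1)) z * deriv (F 2) z) -
      F 1 z * (deriv (F 0) z * deriv (deriv (F 2)) z - deriv (deriv (F 0)) z * deriv (F 2) z) +
      F 2 z * (deriv (F 0) z * deriv (deriv (F 1)) z - deriv (deriv (F 0)) z * deriv (F 1) z) := by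
  rw [wronskian, Matrix.det_fin_three]
  simp [iteratedDeriv_succ]
  ring

theorem analyticAt_wronskian₂ {a b : ℂ → ℂ} {z : ℂ} (ha : AnalyticAt ℂ a z)
    (hb : AnalyticAt ℂ b z) : AnalyticAt ℂ (wronskian₂ a b) z :=
  (ha.deriv.mul hb).sub (hb.deriv.mul ha)

theorem analyticAt_minors {G : Fin 3 → ℂ → ℂ} {z : ℂ} (hG : ∀ j, AnalyticAt ℂ (G j) z) (j : Fin 3) :
    AnalyticAt ℂ (minors G j) z := by
  fin_cases j <;> exact analyticAt_wronskian₂ (hG _) (hG _)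

theorem analyticAt_wronskian {G : Fin 3 → ℂ → ℂ} {z : ℂ} (hG : ∀ j, AnalyticAt ℂ (G j) z) :
    AnalyticAt ℂ (wronskian G) z := by
  have : wronskian G = _ := funext (wronskian_eq G)
  rw [this]
  have h0 := hG 0
  have h1 := hG 1
  have h2 := hG 2
  have h0' := h0.deriv
  have h1' := h1.deriv
  have h2' := h2.deriv
  have h0'' := h0'.deriv
  have h1'' := h1'.deriv
  have h2'' := h2'.deriv
  fun_prop

theorem deriv_wronskian₂ {a b : ℂ → ℂ} {z : ℂ} (ha : AnalyticAt ℂ a z) (hb : AnalyticAt ℂ b z) :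
    deriv (wronskian₂ a b) z = deriv (deriv a) z * b z - deriv (deriv b) z * a z := by
  have : HasDerivAt (wronskian₂ a b) (deriv (deriv a) z * b z + deriv a z * deriv b z -
      (deriv (deriv b) z * a z + deriv b z * deriv a z)) z :=
    (ha.deriv.differentiableAt.hasDerivAt.mul hb.differentiableAt.hasDerivAt).sub
      (hb.deriv.differentiableAt.hasDerivAt.mul ha.differentiableAt.hasDerivAt)
  rw [this.deriv]
  ring

/-- The Wronskian of two pairwise Wronskians is minus the function they share, times the full
Wronskian. This is what closes the system after two steps. -/
theorem sqSum_minors_minors {w : Fin 3 → ℝ} {G : Fin 3 → ℂ → ℂ} {z : ℂ}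
    (hG : ∀ j, AnalyticAt ℂ (G j) z) :
    sqSum w (minors (minors G)) z =
      (w 2 * ‖G 0 z‖ ^ 2 + w 0 * ‖G 1 z‖ ^ 2 + w 1 * ‖G 2 z‖ ^ 2) * ‖wronskian G z‖ ^ 2 := by
  have e0 : minors (minors G) 0 z = -(G 1 z * wronskian G z) := by
    simp only [minors, Matrix.cons_val_zero, Matrix.cons_val_one]
    rw [wronskian₂, deriv_wronskian₂ (hG _) (hG _), deriv_wronskian₂ (hG _) (hG _), wronskian₂,
      wronskian₂, wronskian_eq]
    ring
  have e1 : minors (minors G) 1 z = -(G 2 z * wronskian G z) := by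
    simp only [minors, Matrix.cons_val_zero, Matrix.cons_val_one, Matrix.cons_val]
    rw [wronskian₂, deriv_wronskian₂ (hG _) (hG _), deriv_wronskian₂ (hG _) (hG _), wronskian₂,
      wronskian₂, wronskian_eq]
    ring
  have e2 : minors (minors G) 2 z = -(G 0 z * wronskian G z) := by
    simp only [minors, Matrix.cons_val_zero, Matrix.cons_val]
    rw [wronskian₂, deriv_wronskian₂ (hG _) (hG _), deriv_wronskian₂ (hG _) (hG _), wronskian₂,
      wronskian₂, wronskian_eq]
    ring
  rw [sqSum, Fin.sum_univ_three, e0, e1, e2]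
  simp only [norm_neg, norm_mul]
  ring

theorem exists_ne_of_wronskian_ne {G : Fin 3 → ℂ → ℂ} {z : ℂ} (h : wronskian G z ≠ 0) :
    (∃ j, G j z ≠ 0) ∧ ∃ j, minors G j z ≠ 0 := by
  constructor
  · by_contra! h0
    exact h (by rw [wronskian_eq, h0 0, h0 1, h0 2]; ring)
  · by_contra! h0
    have a := h0 0
    have b := h0 1
    have c := h0 2
    simp only [minors, Matrix.cons_val_zero, Matrix.cons_val_one, Matrix.cons_val,
      wronskian₂] at a b c
    refine h ?_
    rw [wronskian_eq]
    -- Up to sign, the pairwise Wronskians are the cofactors of the column of second derivatives.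
    linear_combination (-deriv (deriv (G 2)) z) * a - deriv (deriv (G 0)) z * b -
      deriv (deriv (G 1)) z * c

/-- The weights of `e^{-U₁}`. -/
def weights₁ (lam mu : ℝ) : Fin 3 → ℝ :=
  ![1 / 4 * lam ^ 2 * mu⁻¹, 1 / 4 * mu ^ 2 * lam⁻¹, 1 / 4 * lam⁻¹ * mu⁻¹]

/-- The weights of `e^{-U₂}`. -/
def weights₂ (lam mu : ℝ) : Fin 3 → ℝ :=
  ![1 / 4 * lam * mu, 1 / 4 * (lam ^ 2)⁻¹ * mu, 1 / 4 * lam * (mu ^ 2)⁻¹]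

theorem weights₁_pos {lam mu : ℝ} (hl : 0 < lam) (hm : 0 < mu) (j : Fin 3) :
    0 < weights₁ lam mu j := by
  fin_cases j <;> simp [weights₁] <;> positivity

theorem weights₂_pos {lam mu : ℝ} (hl : 0 < lam) (hm : 0 < mu) (j : Fin 3) :
    0 < weights₂ lam mu j := by
  fin_cases j <;> simp [weights₂] <;> positivity

theorem u_zero_eq (lam mu : ℝ) (y : Fin 3 → ℂ → ℂ) (z : ℂ) :
    u lam mu y 0 z = Real.log (sqSum (weights₂ lam mu) (minors y) z) -
      2 * Real.log (sqSum (weights₁ lam mu) y z) := by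
  simp only [u, Matrix.cons_val_zero, U₁_eq, U₂_eq, weights₁, weights₂]
  ring

theorem u_one_eq (lam mu : ℝ) (y : Fin 3 → ℂ → ℂ) (z : ℂ) :
    u lam mu y 1 z = Real.log (sqSum (weights₁ lam mu) y z) -
      2 * Real.log (sqSum (weights₂ lam mu) (minors y) z) := by
  change 2 * U₂ lam mu y z - U₁ lam mu y z = _
  rw [U₁_eq, U₂_eq, weights₁, weights₂]
  ring

theorem contDiffAt_log_sqSum {w : Fin 3 → ℝ} (hw : ∀ j, 0 < w j) {G : Fin 3 → ℂ → ℂ} {z : ℂ}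
    (hG : ∀ j, AnalyticAt ℂ (G j) z) (h : ∃ j, G j z ≠ 0) :
    ContDiffAt ℝ ∞ (fun x => Real.log (sqSum w G x)) z :=
  (contDiffAt_sqSum hG).log (sqSum_pos hw h).ne'

theorem contDiffAt_u {lam mu : ℝ} (hl : 0 < lam) (hm : 0 < mu) {G : Fin 3 → ℂ → ℂ} {z : ℂ}
    (hG : ∀ j, AnalyticAt ℂ (G j) z) (h : ∃ j, G j z ≠ 0) (h' : ∃ j, minors G j z ≠ 0)
    (l : Fin 2) : ContDiffAt ℝ ∞ (u lam mu G l) z := by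
  have h1 := contDiffAt_log_sqSum (weights₁_pos hl hm) hG h
  have h2 := contDiffAt_log_sqSum (weights₂_pos hl hm) (analyticAt_minors hG) h'
  fin_cases l
  · have e : u lam mu G 0 = _ := funext (u_zero_eq lam mu G)
    change ContDiffAt ℝ ∞ (u lam mu G 0) z
    rw [e]
    exact h2.sub (contDiffAt_const.mul h1)
  · have e : u lam mu G 1 = _ := funext (u_one_eq lam mu G)
    change ContDiffAt ℝ ∞ (u lam mu G 1) z
    rw [e]
    exact h1.sub (contDiffAt_const.mul h2)

/-- Holomorphic functions with Wronskian `1` give solutions of the Toda system. -/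
theorem laplacian_u {lam mu : ℝ} (hl : 0 < lam) (hm : 0 < mu) {G : Fin 3 → ℂ → ℂ} {z : ℂ}
    (hG : ∀ j, AnalyticAt ℂ (G j) z) (hW : wronskian G z = 1) (l : Fin 2) :
    Δ (u lam mu G l) z = -(2 * Real.exp (u lam mu G l z) - Real.exp (u lam mu G l.rev z)) := by
  obtain ⟨h, h'⟩ := exists_ne_of_wronskian_ne (hW.trans_ne one_ne_zero)
  have h1 := (contDiffAt_log_sqSum (weights₁_pos hl hm) hG h).of_le (m := 2)
    (WithTop.coe_le_coe.2 le_top)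
  have h2 := (contDiffAt_log_sqSum (weights₂_pos hl hm) (analyticAt_minors hG) h').of_le (m := 2)
    (WithTop.coe_le_coe.2 le_top)
  have p1 := sqSum_pos (weights₁_pos hl hm) h
  have p2 := sqSum_pos (weights₂_pos hl hm) h'
  have L1 := laplacian_log_sqSum hG p1.ne'
  have L2 := laplacian_log_sqSum (analyticAt_minors hG) p2.ne'
  rw [sqSum_minors_minors hG, hW] at L2
  have E0 : Real.exp (u lam mu G 0 z) = sqSum (weights₂ lam mu) (minors G) z /
      sqSum (weights₁ lam mu) G z ^ 2 := by
    rw [u_zero_eq, Real.exp_sub, Real.exp_log p2, two_mul, Real.exp_add, Real.exp_log p1, pow_two]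
  have E1 : Real.exp (u lam mu G 1 z) = sqSum (weights₁ lam mu) G z /
      sqSum (weights₂ lam mu) (minors G) z ^ 2 := by
    rw [u_one_eq, Real.exp_sub, Real.exp_log p1, two_mul, Real.exp_add, Real.exp_log p2, pow_two]
  -- The factor 1/4 and the powers of λ, μ are such that four times the pairwise products of the
  -- weights of e^{-U₁} are the weights of e^{-U₂}, and conversely.
  have A1 : Δ (fun x => Real.log (sqSum (weights₁ lam mu) G x)) z =
      Real.exp (u lam mu G 0 z) := by
    rw [L1, E0]
    congr 1
    simp only [sqSum, weights₁, weights₂, Fin.sum_univ_three]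
    simp only [Matrix.cons_val_zero, Matrix.cons_val_one, Matrix.cons_val]
    field_simp
  have A2 : Δ (fun x => Real.log (sqSum (weights₂ lam mu) (minors G) x)) z =
      Real.exp (u lam mu G 1 z) := by
    rw [L2, E1]
    congr 1
    simp only [sqSum, weights₁, weights₂, Fin.sum_univ_three]
    simp only [Matrix.cons_val_zero, Matrix.cons_val_one, Matrix.cons_val]
    field_simp
    simp
  have B : ∀ f g : ℂ → ℝ, ContDiffAt ℝ 2 f z → ContDiffAt ℝ 2 g z →
      Δ (fun x => f x - 2 * g x) z = Δ f z - 2 * Δ g z := by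
    intro f g hf hg
    have e : (fun x => f x - 2 * g x) = f - (2 : ℝ) • g := rfl
    have hg2 : ContDiffAt ℝ 2 ((2 : ℝ) • g) z := hg.const_smul (2 : ℝ)
    rw [e, hf.laplacian_sub hg2, InnerProductSpace.laplacian_smul _ hg]
    rfl
  fin_cases l
  · have e : u lam mu G 0 = _ := funext (u_zero_eq lam mu G)
    change Δ (u lam mu G 0) z = -(2 * Real.exp (u lam mu G 0 z) - Real.exp (u lam mu G 1 z))
    rw [← A1, ← A2, e, B _ _ h2 h1]
    ring
  · have e : u lam mu G 1 = _ := funext (u_one_eq lam mu G)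
    change Δ (u lam mu G 1) z = -(2 * Real.exp (u lam mu G 1 z) - Real.exp (u lam mu G 0 z))
    rw [← A1, ← A2, e, B _ _ h1 h2]
    ring


/-! ### Wronskians and `u` under scaling and change of variable. -/

theorem deriv_deriv_mul {a b : ℂ → ℂ} {z : ℂ} (ha : AnalyticAt ℂ a z) (hb : AnalyticAt ℂ b z) :
    deriv (deriv fun x => a x * b x) z =
      deriv (deriv a) z * b z + 2 * (deriv a z * deriv b z) + a z * deriv (deriv b) z := by
  have e : deriv (fun x => a x * b x) =ᶠ[𝓝 z] fun x => deriv a x * b x + a x * deriv b x := by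
    filter_upwards [ha.eventually_analyticAt, hb.eventually_analyticAt] with x hx hx'
    exact deriv_fun_mul hx.differentiableAt hx'.differentiableAt
  rw [e.deriv_eq, deriv_fun_add, deriv_fun_mul, deriv_fun_mul]
  · ring
  all_goals
    have h1 := ha.differentiableAt
    have h2 := hb.differentiableAt
    have h3 := ha.deriv.differentiableAt
    have h4 := hb.deriv.differentiableAt
    fun_prop

theorem deriv_deriv_comp {g ζ : ℂ → ℂ} {z : ℂ} (hg : AnalyticAt ℂ g (ζ z))
    (hζ : AnalyticAt ℂ ζ z) :
    deriv (deriv fun x => g (ζ x)) z =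
      deriv (deriv g) (ζ z) * deriv ζ z ^ 2 + deriv g (ζ z) * deriv (deriv ζ) z := by
  have e : deriv (fun x => g (ζ x)) =ᶠ[𝓝 z] fun x => deriv g (ζ x) * deriv ζ x := by
    filter_upwards [hζ.eventually_analyticAt,
      hζ.continuousAt.eventually hg.eventually_analyticAt] with x hx hx'
    exact deriv_comp x hx'.differentiableAt hx.differentiableAt
  have e2 : deriv (fun x => deriv g (ζ x)) z = deriv (deriv g) (ζ z) * deriv ζ z :=
    deriv_comp z hg.deriv.differentiableAt hζ.differentiableAt
  rw [e.deriv_eq, deriv_fun_mul, e2]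
  · ring
  · exact (hg.deriv.differentiableAt).comp z hζ.differentiableAt
  · exact hζ.deriv.differentiableAt

theorem deriv_comp_mul {g ζ : ℂ → ℂ} {z : ℂ} (hg : AnalyticAt ℂ g (ζ z)) (hζ : AnalyticAt ℂ ζ z) :
    deriv (fun x => g (ζ x)) z = deriv g (ζ z) * deriv ζ z :=
  deriv_comp z hg.differentiableAt hζ.differentiableAt

theorem wronskian_mul {a : ℂ → ℂ} {G : Fin 3 → ℂ → ℂ} {z : ℂ} (ha : AnalyticAt ℂ a z)
    (hG : ∀ j, AnalyticAt ℂ (G j) z) :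
    wronskian (fun j x => a x * G j x) z = a z ^ 3 * wronskian G z := by
  have d1 : ∀ j, deriv (fun x => a x * G j x) z = deriv a z * G j z + a z * deriv (G j) z :=
    fun j => deriv_fun_mul ha.differentiableAt (hG j).differentiableAt
  have d2 := fun j => deriv_deriv_mul ha (hG j)
  simp only [wronskian_eq, d1, d2]
  ring

theorem wronskian_comp {ζ : ℂ → ℂ} {G : Fin 3 → ℂ → ℂ} {z : ℂ} (hζ : AnalyticAt ℂ ζ z)
    (hG : ∀ j, AnalyticAt ℂ (G j) (ζ z)) :
    wronskian (fun j x => G j (ζ x)) z = deriv ζ z ^ 3 * wronskian G (ζ z) := by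
  have d1 := fun j => deriv_comp_mul (hG j) hζ
  have d2 := fun j => deriv_deriv_comp (hG j) hζ
  simp only [wronskian_eq, d1, d2]
  ring

theorem wronskian₂_mul {a b c : ℂ → ℂ} {z : ℂ} (ha : AnalyticAt ℂ a z)
    (hb : AnalyticAt ℂ b z) (hc : AnalyticAt ℂ c z) :
    wronskian₂ (fun x => a x * b x) (fun x => a x * c x) z = a z ^ 2 * wronskian₂ b c z := by
  simp only [wronskian₂]
  rw [deriv_fun_mul ha.differentiableAt hb.differentiableAt,
    deriv_fun_mul ha.differentiableAt hc.differentiableAt]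
  ring

theorem wronskian₂_comp {ζ b c : ℂ → ℂ} {z : ℂ} (hζ : AnalyticAt ℂ ζ z)
    (hb : AnalyticAt ℂ b (ζ z)) (hc : AnalyticAt ℂ c (ζ z)) :
    wronskian₂ (fun x => b (ζ x)) (fun x => c (ζ x)) z = deriv ζ z * wronskian₂ b c (ζ z) := by
  simp only [wronskian₂]
  rw [deriv_comp_mul hb hζ, deriv_comp_mul hc hζ]
  ring

theorem minors_mul {a : ℂ → ℂ} {G : Fin 3 → ℂ → ℂ} {z : ℂ} (ha : AnalyticAt ℂ a z)
    (hG : ∀ j, AnalyticAt ℂ (G j) z) (j : Fin 3) :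
    minors (fun j x => a x * G j x) j z = a z ^ 2 * minors G j z := by
  fin_cases j <;> exact wronskian₂_mul ha (hG _) (hG _)

theorem minors_comp {ζ : ℂ → ℂ} {G : Fin 3 → ℂ → ℂ} {z : ℂ} (hζ : AnalyticAt ℂ ζ z)
    (hG : ∀ j, AnalyticAt ℂ (G j) (ζ z)) (j : Fin 3) :
    minors (fun j x => G j (ζ x)) j z = deriv ζ z * minors G j (ζ z) := by
  fin_cases j <;> exact wronskian₂_comp hζ (hG _) (hG _)

theorem sqSum_eq_of_eq_mul {w : Fin 3 → ℝ} {G H : Fin 3 → ℂ → ℂ} {z z' a : ℂ}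
    (h : ∀ j, G j z = a * H j z') : sqSum w G z = ‖a‖ ^ 2 * sqSum w H z' := by
  simp only [sqSum, h, norm_mul, Finset.mul_sum]
  exact Finset.sum_congr rfl fun j _ => by ring

theorem log_sqSum_eq_of_eq_mul {w : Fin 3 → ℝ} {G H : Fin 3 → ℂ → ℂ} {z z' a : ℂ}
    (hw : ∀ j, 0 < w j) (ha : a ≠ 0) (hH : ∃ j, H j z' ≠ 0)
    (h : ∀ j, G j z = a * H j z') :
    Real.log (sqSum w G z) = 2 * Real.log ‖a‖ + Real.log (sqSum w H z') := by
  rw [sqSum_eq_of_eq_mul h, Real.log_mul (pow_ne_zero 2 (norm_ne_zero_iff.2 ha)) (sqSum_pos hw hH).ne',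
    Real.log_pow]
  norm_num

/-- Scaling multiplies e^{-U₁} by |a|² and e^{-U₂} by |a|⁴. In log |a| this contributes 4 - 2·2 = 0
to u₁ and 2 - 2·4 = -6 to u₂. -/
theorem u_mul {lam mu : ℝ} (hl : 0 < lam) (hm : 0 < mu) {a : ℂ → ℂ} {G : Fin 3 → ℂ → ℂ} {z : ℂ}
    (ha : AnalyticAt ℂ a z) (hG : ∀ j, AnalyticAt ℂ (G j) z) (ha0 : a z ≠ 0)
    (h : ∃ j, G j z ≠ 0) (h' : ∃ j, minors G j z ≠ 0) (l : Fin 2) :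
    u lam mu (fun j x => a x * G j x) l z =
      u lam mu G l z + ![0, -6] l * Real.log ‖a z‖ := by
  have e1 := log_sqSum_eq_of_eq_mul (G := fun j x => a x * G j x) (z := z)
    (weights₁_pos hl hm) ha0 h (fun j => rfl)
  have e2 := log_sqSum_eq_of_eq_mul (weights₂_pos hl hm) (pow_ne_zero 2 ha0) h' (minors_mul ha hG)
  rw [norm_pow, Real.log_pow] at e2
  push_cast at e2
  fin_cases l
  · change u lam mu _ 0 z = u lam mu _ 0 z + 0 * _
    rw [u_zero_eq, u_zero_eq, e1, e2]
    ring
  · change u lam mu _ 1 z = u lam mu _ 1 z + -6 * _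
    rw [u_one_eq, u_one_eq, e1, e2]
    ring

/-- Only e^{-U₂} involves derivatives; it acquires |ζ'|², whence the coefficients 2 and -4. -/
theorem u_comp {lam mu : ℝ} (hl : 0 < lam) (hm : 0 < mu) {ζ : ℂ → ℂ} {G : Fin 3 → ℂ → ℂ} {z : ℂ}
    (hζ : AnalyticAt ℂ ζ z) (hG : ∀ j, AnalyticAt ℂ (G j) (ζ z)) (hζ0 : deriv ζ z ≠ 0)
    (h' : ∃ j, minors G j (ζ z) ≠ 0) (l : Fin 2) :
    u lam mu (fun j x => G j (ζ x)) l z =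
      u lam mu G l (ζ z) + ![2, -4] l * Real.log ‖deriv ζ z‖ := by
  have e1 : sqSum (weights₁ lam mu) (fun j x => G j (ζ x)) z =
    sqSum (weights₁ lam mu) G (ζ z) := rfl
  have e2 := log_sqSum_eq_of_eq_mul (weights₂_pos hl hm) hζ0 h' (minors_comp hζ hG)
  fin_cases l
  · change u lam mu _ 0 z = u lam mu _ 0 _ + 2 * _
    rw [u_zero_eq, u_zero_eq, e1, e2]
    ring
  · change u lam mu _ 1 z = u lam mu _ 1 _ + -4 * _
    rw [u_one_eq, u_one_eq, e1, e2]
    ring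

theorem wronskian_eventuallyEq {F G : Fin 3 → ℂ → ℂ} {z : ℂ} (h : ∀ᶠ x in 𝓝 z, ∀ j, F j x = G j x) :
    wronskian F =ᶠ[𝓝 z] wronskian G := by
  have h0 : ∀ j, F j =ᶠ[𝓝 z] G j := fun j => h.mono fun x hx => hx j
  filter_upwards [eventually_all.2 h0, eventually_all.2 fun j => (h0 j).deriv,
    eventually_all.2 fun j => (h0 j).deriv.deriv] with x a b c
  simp only [wronskian_eq, a, b, c]

theorem minors_eventuallyEq {F G : Fin 3 → ℂ → ℂ} {z : ℂ} (h : ∀ᶠ x in 𝓝 z, ∀ j, F j x = G j x) :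
    ∀ᶠ x in 𝓝 z, ∀ j, minors F j x = minors G j x := by
  have h0 : ∀ j, F j =ᶠ[𝓝 z] G j := fun j => h.mono fun x hx => hx j
  filter_upwards [eventually_all.2 h0, eventually_all.2 fun j => (h0 j).deriv] with x a b j
  fin_cases j <;> simp [minors, wronskian₂, a, b]

theorem u_eventuallyEq {lam mu : ℝ} {F G : Fin 3 → ℂ → ℂ} {z : ℂ}
    (h : ∀ᶠ x in 𝓝 z, ∀ j, F j x = G j x) (l : Fin 2) :
    u lam mu F l =ᶠ[𝓝 z] u lam mu G l := by
  filter_upwards [h, minors_eventuallyEq h] with x a b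
  fin_cases l
  · change u lam mu _ 0 x = u lam mu _ 0 x
    simp only [u_zero_eq, sqSum, a, b]
  · change u lam mu _ 1 x = u lam mu _ 1 x
    simp only [u_one_eq, sqSum, a, b]

/-- The transport `(y ∘ ζ) / ζ'` of a triple of solutions along a local change of variables. -/
def transport (ζ : ℂ → ℂ) (y : Fin 3 → ℂ → ℂ) : Fin 3 → ℂ → ℂ :=
  fun j x => (deriv ζ x)⁻¹ * y j (ζ x)

theorem analyticAt_transport {ζ : ℂ → ℂ} {y : Fin 3 → ℂ → ℂ} {z : ℂ} (hζ : AnalyticAt ℂ ζ z)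
    (hy : ∀ j, AnalyticAt ℂ (y j) (ζ z)) (h0 : deriv ζ z ≠ 0) (j : Fin 3) :
    AnalyticAt ℂ (transport ζ y j) z :=
  (hζ.deriv.inv h0).mul ((hy j).comp hζ)

/-- The factor (1/ζ')³ from scaling cancels the factor ζ'³ from the chain rule. -/
theorem wronskian_transport {ζ : ℂ → ℂ} {y : Fin 3 → ℂ → ℂ} {z : ℂ} (hζ : AnalyticAt ℂ ζ z)
    (hy : ∀ j, AnalyticAt ℂ (y j) (ζ z)) (h0 : deriv ζ z ≠ 0) :
    wronskian (transport ζ y) z = wronskian y (ζ z) := by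
  have e : transport ζ y = fun j x => (deriv ζ x)⁻¹ * y j (ζ x) := rfl
  rw [e, wronskian_mul (a := fun x => (deriv ζ x)⁻¹) (hζ.deriv.inv h0)
    (G := fun j x => y j (ζ x)) (fun j => (hy j).comp hζ), wronskian_comp hζ hy]
  field_simp

/-- Scaling and composition are asymmetric in u₁ and u₂, but their combination is not: 2 + 0 = -4 +
6. Both e^{u_k} |dz|² thus transform as conformal metrics, and the system passes to any local
coordinate. -/
theorem u_transport {lam mu : ℝ} (hl : 0 < lam) (hm : 0 < mu) {ζ : ℂ → ℂ} {y : Fin 3 → ℂ → ℂ} {z : ℂ}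
    (hζ : AnalyticAt ℂ ζ z) (hy : ∀ j, AnalyticAt ℂ (y j) (ζ z)) (h0 : deriv ζ z ≠ 0)
    (hW : wronskian y (ζ z) ≠ 0) (l : Fin 2) :
    u lam mu (transport ζ y) l z = u lam mu y l (ζ z) + 2 * Real.log ‖deriv ζ z‖ := by
  obtain ⟨h, h'⟩ := exists_ne_of_wronskian_ne hW
  have e : transport ζ y = fun j x => (deriv ζ x)⁻¹ * y j (ζ x) := rfl
  rw [e, u_mul hl hm (a := fun x => (deriv ζ x)⁻¹) (hζ.deriv.inv h0)
    (G := fun j x => y j (ζ x)) (fun j => (hy j).comp hζ) (inv_ne_zero h0) h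
    (by
      obtain ⟨j, hj⟩ := h'
      exact ⟨j, by rw [minors_comp hζ hy]; exact mul_ne_zero h0 hj⟩), u_comp hl hm hζ hy h0 h']
  rw [norm_inv, Real.log_inv]
  fin_cases l
  · change _ + 2 * _ + 0 * _ = _
    simp
  · change _ + -4 * _ + -6 * _ = _
    simp
    ring

/-! ### Branches of the normalised triple. -/

/-- The Wronskian of a branch is `1`, if the Wronskian of `F` does not vanish identically. -/
theorem IsBranch.wronskian_eq_one {F y : Fin 3 → ℂ → ℂ} {z₀ : ℂ} (h : IsBranch F z₀ y)
    (hW : ∀ᶠ z in 𝓝[≠] z₀, wronskian F z ≠ 0) : ∀ᶠ z in 𝓝 z₀, wronskian y z = 1 := by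
  obtain ⟨c, hc, hq⟩ := h.quotient
  have hy := eventually_all.2 fun j => (h.analyticAt j).eventually_analyticAt
  have e := wronskian_eventuallyEq (F := F) (G := fun j x => c x * y j x)
    (hq.mono fun x hx j => (hx.2 j).symm)
  have key : ∀ᶠ z in 𝓝[≠] z₀, wronskian y z = 1 := by
    filter_upwards [hW, e.filter_mono nhdsWithin_le_nhds, hq.filter_mono nhdsWithin_le_nhds,
      hc.eventually_analyticAt.filter_mono nhdsWithin_le_nhds,
      hy.filter_mono nhdsWithin_le_nhds] with z h1 h2 h3 h4 h5
    rw [wronskian_mul h4 h5, h3.1] at h2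
    exact mul_left_cancel₀ h1 (by rw [← h2, mul_one])
  exact (analyticAt_wronskian h.analyticAt).frequently_eq_iff_eventually_eq
    analyticAt_const |>.1 key.frequently

/-- The requirement c³ = W comes for free from W(c y) = c³ W(y), so a branch can be recognised
without handling the cube root. -/
theorem IsBranch.of_wronskian_eq_one {F y : Fin 3 → ℂ → ℂ} {z₀ : ℂ} {c : ℂ → ℂ}
    (hy : ∀ j, AnalyticAt ℂ (y j) z₀) (hc : AnalyticAt ℂ c z₀)
    (hF : ∀ᶠ z in 𝓝 z₀, ∀ j, F j z = c z * y j z) (hW : ∀ᶠ z in 𝓝 z₀, wronskian y z = 1) :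
    IsBranch F z₀ y := by
  refine ⟨hy, c, hc, ?_⟩
  filter_upwards [hF, wronskian_eventuallyEq hF, hW, hc.eventually_analyticAt,
    eventually_all.2 fun j => (hy j).eventually_analyticAt] with z h1 h2 h3 h4 h5
  refine ⟨?_, fun j => (h1 j).symm⟩
  rw [h2, wronskian_mul h4 h5, h3, mul_one]

theorem IsBranch.eventually {F y : Fin 3 → ℂ → ℂ} {z₀ : ℂ} (h : IsBranch F z₀ y) :
    ∀ᶠ z in 𝓝 z₀, IsBranch F z y := by
  obtain ⟨c, hc, hq⟩ := h.quotient
  filter_upwards [eventually_all.2 fun j => (h.analyticAt j).eventually_analyticAt,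
    hc.eventually_analyticAt, hq.eventually_nhds] with z h1 h2 h3
  exact ⟨h1, c, h2, h3⟩

/-- Formula for `u` at a point where the Wronskian does not vanish. -/
theorem IsBranch.u_eq {lam mu : ℝ} (hl : 0 < lam) (hm : 0 < mu) {F y : Fin 3 → ℂ → ℂ} {z₀ : ℂ}
    (h : IsBranch F z₀ y) (hW : wronskian F z₀ ≠ 0) (l : Fin 2) :
    u lam mu y l z₀ = u lam mu F l z₀ + ![0, 2] l * Real.log ‖wronskian F z₀‖ := by
  obtain ⟨c, hc, hq⟩ := h.quotient
  have e : ∀ᶠ x in 𝓝 z₀, ∀ j, F j x = c x * y j x := hq.mono fun x hx j => (hx.2 j).symm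
  have hq0 := hq.self_of_nhds.1
  have hc0 : c z₀ ≠ 0 := fun h0 => hW (by rw [← hq0, h0]; simp)
  have hWy : wronskian y z₀ ≠ 0 := by
    intro h0
    apply hW
    rw [(wronskian_eventuallyEq e).self_of_nhds, wronskian_mul hc h.analyticAt, h0, mul_zero]
  obtain ⟨h1, h2⟩ := exists_ne_of_wronskian_ne hWy
  -- Since c³ = W, the shift -6 log |c| equals -2 log |W|.
  rw [(u_eventuallyEq e l).self_of_nhds, u_mul hl hm hc h.analyticAt hc0 h1 h2, ← hq0, norm_pow,
    Real.log_pow]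
  fin_cases l
  · simp
  · simp
    ring

/-- Two branches at a point define the same function `u`. -/
theorem IsBranch.u_eq_u {lam mu : ℝ} (hl : 0 < lam) (hm : 0 < mu) {F y y' : Fin 3 → ℂ → ℂ} {z₀ : ℂ}
    (h : IsBranch F z₀ y) (h' : IsBranch F z₀ y') (hW : ∀ᶠ z in 𝓝[≠] z₀, wronskian F z ≠ 0)
    (l : Fin 2) : u lam mu y l z₀ = u lam mu y' l z₀ := by
  -- Where W ≠ 0 both sides are the same expression in `F`. Continuity covers the point itself, at
  -- which W may vanish.
  have key : ∀ᶠ z in 𝓝[≠] z₀, u lam mu y l z = u lam mu y' l z := by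
    filter_upwards [hW, h.eventually.filter_mono nhdsWithin_le_nhds,
      h'.eventually.filter_mono nhdsWithin_le_nhds] with z a b c
    rw [b.u_eq hl hm a, c.u_eq hl hm a]
  have C : ∀ {y : Fin 3 → ℂ → ℂ}, IsBranch F z₀ y →
      Tendsto (u lam mu y l) (𝓝[≠] z₀) (𝓝 (u lam mu y l z₀)) := by
    intro y h
    have := exists_ne_of_wronskian_ne ((h.wronskian_eq_one hW).self_of_nhds.trans_ne one_ne_zero)
    exact ((contDiffAt_u hl hm h.analyticAt this.1 this.2 l).continuousAt).tendsto.mono_left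
      nhdsWithin_le_nhds
  exact tendsto_nhds_unique (C h) ((C h').congr' (key.mono fun _ h => h.symm))


/-! ### Green's identity and the fundamental solution of the Laplacian. -/

theorem laplacian_eq_fderiv_fderiv {f : ℂ → ℝ} {x : ℂ} (hf : ContDiffAt ℝ 2 f x) :
    Δ f x = fderiv ℝ (fun y => fderiv ℝ f y 1) x 1 +
      fderiv ℝ (fun y => fderiv ℝ f y Complex.I) x Complex.I := by
  have hd : DifferentiableAt ℝ (fderiv ℝ f) x :=
    (hf.fderiv_right (m := 1) (by norm_num)).differentiableAt (by norm_num)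
  have e : ∀ v : ℂ, fderiv ℝ (fun y => fderiv ℝ f y v) x v = fderiv ℝ (fderiv ℝ f) x v v := by
    intro v
    rw [fderiv_clm_apply hd (differentiableAt_const v)]
    simp
  rw [InnerProductSpace.laplacian_eq_iteratedFDeriv_complexPlane, e, e]
  simp [iteratedFDeriv_two_apply]

/-- The product of a function continuous on an open set and a continuous function with compact
support in that set. -/
theorem continuous_mul_of_tsupport_subset {U : Set ℂ} {v ψ : ℂ → ℝ}
    (hv : ∀ x ∈ U, ContinuousAt v x) (hψ : Continuous ψ) (hs : tsupport ψ ⊆ U) :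
    Continuous fun x => v x * ψ x := by
  refine continuous_of_tsupport fun x hx => ?_
  have hx' : x ∈ tsupport ψ := tsupport_mul_subset_right hx
  exact (hv x (hs hx')).mul hψ.continuousAt

theorem integrable_mul_of_tsupport_subset {U : Set ℂ} {v ψ : ℂ → ℝ}
    (hv : ∀ x ∈ U, ContinuousAt v x) (hψ : Continuous ψ) (hc : HasCompactSupport ψ)
    (hs : tsupport ψ ⊆ U) : Integrable (fun x => v x * ψ x) :=
  (continuous_mul_of_tsupport_subset hv hψ hs).integrable_of_hasCompactSupport hc.mul_left

theorem tsupport_fderiv_apply_subset' (ψ : ℂ → ℝ) (e : ℂ) :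
    tsupport (fun y => fderiv ℝ ψ y e) ⊆ tsupport ψ :=
  tsupport_fderiv_apply_subset ℝ e

theorem contDiff_fderiv_apply {ψ : ℂ → ℝ} (hψ : ContDiff ℝ ∞ ψ) (e : ℂ) :
    ContDiff ℝ ∞ (fun y => fderiv ℝ ψ y e) :=
  (hψ.fderiv_right (m := ∞) (by simp)).clm_apply contDiff_const

theorem integral_mul_fderiv_fderiv {U : Set ℂ} {v ψ : ℂ → ℝ}
    (hv : ∀ x ∈ U, ContDiffAt ℝ 2 v x) (hψ : ContDiff ℝ ∞ ψ) (hc : HasCompactSupport ψ)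
    (hs : tsupport ψ ⊆ U) (e : ℂ) :
    Integrable (fun x => v x * fderiv ℝ (fun y => fderiv ℝ ψ y e) x e) ∧
    Integrable (fun x => fderiv ℝ (fun y => fderiv ℝ v y e) x e * ψ x) ∧
    ∫ x, v x * fderiv ℝ (fun y => fderiv ℝ ψ y e) x e =
      ∫ x, fderiv ℝ (fun y => fderiv ℝ v y e) x e * ψ x := by
  have hψ1 := contDiff_fderiv_apply hψ e
  have hψ2 := contDiff_fderiv_apply hψ1 e
  have hs1 := (tsupport_fderiv_apply_subset' ψ e).trans hs
  have hs2 := (tsupport_fderiv_apply_subset' _ e).trans hs1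
  have hc1 : HasCompactSupport (fun y => fderiv ℝ ψ y e) := hc.fderiv_apply ℝ e
  have hc2 : HasCompactSupport (fun x => fderiv ℝ (fun y => fderiv ℝ ψ y e) x e) :=
    hc1.fderiv_apply ℝ e
  have hv1 : ∀ x ∈ U, ContDiffAt ℝ 1 (fun y => fderiv ℝ v y e) x := fun x hx =>
    ((hv x hx).fderiv_right (m := 1) (by norm_num)).clm_apply contDiffAt_const
  have hv2 : ∀ x ∈ U, ContDiffAt ℝ 0 (fun x => fderiv ℝ (fun y => fderiv ℝ v y e) x e) x :=
    fun x hx => ((hv1 x hx).fderiv_right (m := 0) (by norm_num)).clm_apply contDiffAt_const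
  have i1 := integrable_mul_of_tsupport_subset (fun x hx => (hv x hx).continuousAt)
    hψ2.continuous hc2 hs2
  have i2 := integrable_mul_of_tsupport_subset (fun x hx => (hv1 x hx).continuousAt)
    hψ1.continuous hc1 hs1
  have i3 := integrable_mul_of_tsupport_subset (fun x hx => (hv x hx).continuousAt)
    hψ1.continuous hc1 hs1
  have i4 := integrable_mul_of_tsupport_subset (fun x hx => (hv2 x hx).continuousAt)
    hψ.continuous hc hs
  have i5 := integrable_mul_of_tsupport_subset (fun x hx => (hv1 x hx).continuousAt)
    hψ.continuous hc hs
  refine ⟨i1, i4, ?_⟩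
  rw [integral_mul_fderiv_eq_neg_fderiv_mul_of_integrable i2 i1 i3
    (fun x hx => (hv x (hs1 hx)).differentiableAt (by norm_num))
    (fun x _ => hψ1.differentiable (by simp) x),
    integral_mul_fderiv_eq_neg_fderiv_mul_of_integrable i4 i2 i5
    (fun x hx => (hv1 x (hs hx)).differentiableAt (by norm_num))
    (fun x _ => hψ.differentiable (by simp) x), neg_neg]

/-- Green's identity. -/
theorem integral_mul_laplacian {U : Set ℂ} {v ψ : ℂ → ℝ}
    (hv : ∀ x ∈ U, ContDiffAt ℝ 2 v x) (hψ : ContDiff ℝ ∞ ψ) (hc : HasCompactSupport ψ)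
    (hs : tsupport ψ ⊆ U) :
    Integrable (fun x => v x * Δ ψ x) ∧ Integrable (fun x => Δ v x * ψ x) ∧
    ∫ x, v x * Δ ψ x = ∫ x, Δ v x * ψ x := by
  obtain ⟨a1, b1, c1⟩ := integral_mul_fderiv_fderiv hv hψ hc hs 1
  obtain ⟨a2, b2, c2⟩ := integral_mul_fderiv_fderiv hv hψ hc hs Complex.I
  have e1 : (fun x => v x * Δ ψ x) = fun x => v x * fderiv ℝ (fun y => fderiv ℝ ψ y 1) x 1 +
      v x * fderiv ℝ (fun y => fderiv ℝ ψ y Complex.I) x Complex.I := by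
    ext x
    rw [laplacian_eq_fderiv_fderiv (hψ.of_le (WithTop.coe_le_coe.2 le_top)).contDiffAt, mul_add]
  have e2 : (fun x => Δ v x * ψ x) = fun x => fderiv ℝ (fun y => fderiv ℝ v y 1) x 1 * ψ x +
      fderiv ℝ (fun y => fderiv ℝ v y Complex.I) x Complex.I * ψ x := by
    ext x
    by_cases hx : x ∈ tsupport ψ
    · rw [laplacian_eq_fderiv_fderiv (hv x (hs hx)), add_mul]
    · rw [image_eq_zero_of_notMem_tsupport hx]
      simp
  rw [e1, e2, integral_add a1 a2, integral_add b1 b2, c1, c2]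
  exact ⟨a1.add a2, b1.add b2, rfl⟩

theorem contDiff_laplacian {ψ : ℂ → ℝ} (hψ : ContDiff ℝ ∞ ψ) : ContDiff ℝ ∞ (Δ ψ) := by
  have : Δ ψ = fun x => fderiv ℝ (fun y => fderiv ℝ ψ y 1) x 1 +
      fderiv ℝ (fun y => fderiv ℝ ψ y Complex.I) x Complex.I := by
    ext x
    rw [laplacian_eq_fderiv_fderiv (hψ.of_le (WithTop.coe_le_coe.2 le_top)).contDiffAt]
  rw [this]
  exact (contDiff_fderiv_apply (contDiff_fderiv_apply hψ _) _).add
    (contDiff_fderiv_apply (contDiff_fderiv_apply hψ _) _)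

theorem tsupport_laplacian_subset (ψ : ℂ → ℝ) : tsupport (Δ ψ) ⊆ tsupport ψ := by
  refine closure_minimal (fun x hx => ?_) (isClosed_tsupport ψ)
  by_contra h
  refine hx ?_
  have := notMem_tsupport_iff_eventuallyEq.1 h
  rw [(InnerProductSpace.laplacian_congr_nhds this).self_of_nhds]
  exact congrFun InnerProductSpace.laplacian_const x

theorem hasCompactSupport_laplacian {ψ : ℂ → ℝ} (hc : HasCompactSupport ψ) :
    HasCompactSupport (Δ ψ) :=
  hc.of_isClosed_subset (isClosed_tsupport _) (tsupport_laplacian_subset ψ)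

theorem integral_laplacian {ψ : ℂ → ℝ} (hψ : ContDiff ℝ ∞ ψ) (hc : HasCompactSupport ψ) :
    ∫ x, Δ ψ x = 0 := by
  have h := (integral_mul_laplacian (U := Set.univ) (v := fun _ => 1) (fun x _ => contDiffAt_const)
    hψ hc (Set.subset_univ _)).2.2
  have e : Δ (fun _ : ℂ => (1 : ℝ)) = 0 := by
    ext x; exact congrFun InnerProductSpace.laplacian_const x
  simpa [e] using h

theorem locallyIntegrable_log_norm : LocallyIntegrable (fun x : ℂ => Real.log ‖x‖) := by
  have h : ∀ r : ℝ, IntegrableOn (fun x : ℂ => Real.log ‖x‖) (Metric.ball 0 r) := by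
    intro r
    rw [integrableOn_fun_norm_addHaar (E := ℂ) volume (f := Real.log)]
    have : Continuous fun y : ℝ => y * Real.log y := Real.continuous_mul_log
    simpa using (this.integrableOn_Icc (a := 0) (b := r)).mono_set Set.Ioo_subset_Icc_self
  intro x
  refine ⟨Metric.ball 0 (‖x‖ + 1), Metric.isOpen_ball.mem_nhds (by simp), h _⟩

/-- The integrand is the Laplacian of ½ log(|x|² + 1). Its total mass 2π is the constant of the
fundamental solution. -/
theorem integral_radial_kernel : ∫ x : ℂ, 2 / (‖x‖ ^ 2 + 1) ^ 2 = 2 * Real.pi ∧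
    Integrable fun x : ℂ => 2 / (‖x‖ ^ 2 + 1) ^ 2 := by
  have hd : ∀ y ∈ Set.Ici (0 : ℝ), HasDerivAt (fun y : ℝ => -(y ^ 2 + 1)⁻¹)
      (y * (2 / (y ^ 2 + 1) ^ 2)) y := by
    intro y _
    have h0 : y ^ 2 + 1 ≠ 0 := by positivity
    have := ((((hasDerivAt_id y).pow 2).add_const 1).inv h0).neg
    refine this.congr_deriv ?_
    simp
    field_simp
  have ht : Tendsto (fun y : ℝ => -(y ^ 2 + 1)⁻¹) atTop (𝓝 (-0)) := by
    refine Tendsto.neg (tendsto_inv_atTop_zero.comp ?_)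
    exact tendsto_atTop_add_const_right _ _ (tendsto_pow_atTop (by norm_num))
  have hn : ∀ y ∈ Set.Ioi (0 : ℝ), 0 ≤ y * (2 / (y ^ 2 + 1) ^ 2) := by
    intro y hy
    have : (0 : ℝ) < y := hy
    positivity
  have i1 := integrableOn_Ioi_deriv_of_nonneg' hd hn ht
  have i2 := integral_Ioi_of_hasDerivAt_of_nonneg' hd hn ht
  constructor
  · rw [integral_fun_norm_addHaar (E := ℂ) volume (f := fun y => 2 / (y ^ 2 + 1) ^ 2)]
    simp only [Complex.finrank_real_complex, Nat.add_one_sub_one, pow_one, smul_eq_mul, i2]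
    simp [Measure.real, Complex.volume_ball]
  · rw [integrable_fun_norm_addHaar (E := ℂ) volume (f := fun y => 2 / (y ^ 2 + 1) ^ 2)]
    simpa using i1

theorem integrable_locallyIntegrable_mul {f ψ : ℂ → ℝ} (hf : LocallyIntegrable f)
    (hψ : Continuous ψ) (hc : HasCompactSupport ψ) : Integrable fun x => f x * ψ x := by
  simpa [mul_comm] using hf.integrable_smul_left_of_hasCompactSupport hψ hc

/-- This is `laplacian_log_sqSum` for the triple (z, δ, 0), whose only nonzero pairwise Wronskian is
the constant δ. -/
theorem laplacian_log_regularised {δ : ℝ} (hδ : 0 < δ) (x : ℂ) :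
    ContDiffAt ℝ 2 (fun x : ℂ => 1 / 2 * Real.log (‖x‖ ^ 2 + δ ^ 2)) x ∧
    Δ (fun x : ℂ => 1 / 2 * Real.log (‖x‖ ^ 2 + δ ^ 2)) x =
      2 * δ ^ 2 / (‖x‖ ^ 2 + δ ^ 2) ^ 2 := by
  set G : Fin 3 → ℂ → ℂ := ![id, fun _ => (δ : ℂ), fun _ => 0] with hGdef
  have hG : ∀ j, AnalyticAt ℂ (G j) x := by
    intro j
    fin_cases j
    · exact analyticAt_id
    · exact analyticAt_const
    · exact analyticAt_const
  have hs : ∀ x, sqSum (fun _ => 1) G x = ‖x‖ ^ 2 + δ ^ 2 := by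
    intro x
    simp [sqSum, Fin.sum_univ_three, hGdef]
  have hpos : sqSum (fun _ => 1) G x ≠ 0 := by
    rw [hs]
    positivity
  have h1 : ContDiffAt ℝ 2 (fun x => Real.log (sqSum (fun _ => 1) G x)) x :=
    ((contDiffAt_sqSum hG).log hpos).of_le (WithTop.coe_le_coe.2 le_top)
  have h2 := laplacian_log_sqSum hG hpos
  have e : (fun x : ℂ => 1 / 2 * Real.log (‖x‖ ^ 2 + δ ^ 2)) =
      (1 / 2 : ℝ) • fun x => Real.log (sqSum (fun _ => 1) G x) := by
    ext x
    simp [hs]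
  rw [e]
  refine ⟨contDiffAt_const.smul h1, ?_⟩
  rw [InnerProductSpace.laplacian_smul _ h1, h2, hs]
  simp [sqSum, Fin.sum_univ_three, minors, wronskian₂, hGdef]
  ring

/-- `log |x| / 2π` is the fundamental solution of the Laplace equation. -/
theorem integral_log_norm_mul_laplacian {ψ : ℂ → ℝ} (hψ : ContDiff ℝ ∞ ψ)
    (hc : HasCompactSupport ψ) : ∫ x, Real.log ‖x‖ * Δ ψ x = 2 * Real.pi * ψ 0 := by
  have hΔc := (contDiff_laplacian hψ).continuous
  have hΔs := hasCompactSupport_laplacian hc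
  -- Green's identity for the regularised logarithm, followed by x = δy, moves all dependence on δ
  -- into the test function. The two sides are then passed to the limit δ → 0 separately.
  have key : ∀ δ : ℝ, 0 < δ → ∫ x : ℂ, 1 / 2 * Real.log (‖x‖ ^ 2 + δ ^ 2) * Δ ψ x =
      ∫ y : ℂ, 2 / (‖y‖ ^ 2 + 1) ^ 2 * ψ (δ • y) := by
    intro δ hδ
    have h1 := (integral_mul_laplacian (U := Set.univ)
      (fun x _ => (laplacian_log_regularised hδ x).1) hψ hc (Set.subset_univ _)).2.2
    rw [h1]
    simp only [(laplacian_log_regularised hδ _).2]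
    have h2 := Measure.integral_comp_smul (volume : Measure ℂ)
      (fun x : ℂ => 2 * δ ^ 2 / (‖x‖ ^ 2 + δ ^ 2) ^ 2 * ψ x) δ
    rw [Complex.finrank_real_complex, abs_of_pos (by positivity), smul_eq_mul,
      eq_inv_mul_iff_mul_eq₀ (by positivity)] at h2
    rw [← h2, ← integral_const_mul]
    refine integral_congr_ae (.of_forall fun y => ?_)
    have hn : ‖δ • y‖ = δ * ‖y‖ := by rw [norm_smul, Real.norm_of_nonneg hδ.le]
    have : ‖y‖ ^ 2 + 1 ≠ 0 := by positivity
    have h3 : (δ * ‖y‖) ^ 2 + δ ^ 2 = δ ^ 2 * (‖y‖ ^ 2 + 1) := by ring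
    simp only [hn, h3]
    field_simp
  have L : Tendsto (fun δ : ℝ => ∫ x : ℂ, 1 / 2 * Real.log (‖x‖ ^ 2 + δ ^ 2) * Δ ψ x)
      (𝓝[>] 0) (𝓝 (∫ x, Real.log ‖x‖ * Δ ψ x)) := by
    refine tendsto_integral_filter_of_dominated_convergence
      -- For δ ≤ 1, log |x|² ≤ log(|x|² + δ²) ≤ |x|² + δ² - 1 ≤ |x|².
      (fun x => (|Real.log ‖x‖| + ‖x‖ ^ 2) * |Δ ψ x|) ?_ ?_ ?_ ?_
    · filter_upwards [self_mem_nhdsWithin] with δ (hδ : 0 < δ)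
      refine Continuous.aestronglyMeasurable (Continuous.mul ?_ hΔc)
      refine continuous_const.mul (Continuous.log (by fun_prop) fun x => ?_)
      positivity
    · filter_upwards [Ioc_mem_nhdsGT (zero_lt_one)] with δ hδ
      have h0 : ∀ᵐ x : ℂ, x ≠ 0 := by simp [ae_iff]
      filter_upwards [h0] with x hx
      have hx0 : 0 < ‖x‖ := norm_pos_iff.2 hx
      rw [norm_mul, Real.norm_eq_abs, Real.norm_eq_abs]
      refine mul_le_mul_of_nonneg_right ?_ (abs_nonneg _)
      have hδ0 := hδ.1
      have hδ2 : δ ^ 2 ≤ 1 := by nlinarith [hδ.1, hδ.2]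
      have a1 := Real.log_le_sub_one_of_pos (show 0 < ‖x‖ ^ 2 + δ ^ 2 by positivity)
      have a2 : Real.log (‖x‖ ^ 2) ≤ Real.log (‖x‖ ^ 2 + δ ^ 2) :=
        Real.log_le_log (by positivity) (by nlinarith)
      rw [Real.log_pow] at a2
      push_cast at a2
      have a3 := neg_abs_le (Real.log ‖x‖)
      have a4 := abs_nonneg (Real.log ‖x‖)
      have a5 := sq_nonneg ‖x‖
      rw [abs_le]
      constructor <;> linarith
    · refine integrable_locallyIntegrable_mul ?_ hΔc.abs hΔs.abs
      have hl : LocallyIntegrable (fun x : ℂ => |Real.log ‖x‖|) := fun x =>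
        let ⟨t, ht, h⟩ := locallyIntegrable_log_norm x
        ⟨t, ht, h.norm⟩
      exact hl.add
        (continuous_norm.pow 2).locallyIntegrable
    · have h0 : ∀ᵐ x : ℂ, x ≠ 0 := by simp [ae_iff]
      filter_upwards [h0] with x hx
      have hx0 : 0 < ‖x‖ := norm_pos_iff.2 hx
      refine Tendsto.mul_const _ ?_
      have : ContinuousAt (fun δ : ℝ => 1 / 2 * Real.log (‖x‖ ^ 2 + δ ^ 2)) 0 := by
        refine continuousAt_const.mul (ContinuousAt.log (by fun_prop) ?_)
        positivity
      have h := this.tendsto.mono_left (nhdsWithin_le_nhds (s := Set.Ioi 0))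
      convert h using 2
      rw [zero_pow two_ne_zero, add_zero, Real.log_pow]
      push_cast
      ring
  have R : Tendsto (fun δ : ℝ => ∫ y : ℂ, 2 / (‖y‖ ^ 2 + 1) ^ 2 * ψ (δ • y))
      (𝓝[>] 0) (𝓝 (∫ y : ℂ, 2 / (‖y‖ ^ 2 + 1) ^ 2 * ψ 0)) := by
    obtain ⟨C, hC⟩ := hψ.continuous.bounded_above_of_compact_support hc
    refine tendsto_integral_filter_of_dominated_convergence
      (fun y => 2 / (‖y‖ ^ 2 + 1) ^ 2 * C) ?_ ?_ (integral_radial_kernel.2.mul_const C) ?_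
    · refine .of_forall fun δ => Continuous.aestronglyMeasurable ?_
      have := hψ.continuous
      refine Continuous.mul (Continuous.div (by fun_prop) (by fun_prop) fun x => ?_) (by fun_prop)
      positivity
    · refine .of_forall fun δ => .of_forall fun y => ?_
      rw [norm_mul, Real.norm_of_nonneg (by positivity)]
      exact mul_le_mul_of_nonneg_left (hC _) (by positivity)
    · refine .of_forall fun y => Tendsto.const_mul _ ?_
      have : ContinuousAt (fun δ : ℝ => ψ (δ • y)) 0 := by
        have := hψ.continuous
        fun_prop
      have h := this.tendsto.mono_left (nhdsWithin_le_nhds (s := Set.Ioi 0))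
      simpa using h
  have R' := R.congr' (by filter_upwards [self_mem_nhdsWithin] with δ hδ using (key δ hδ).symm)
  rw [tendsto_nhds_unique L R', integral_mul_const, integral_radial_kernel.1]


/-! ### Rescaled test functions at a logarithmic singularity. -/

theorem fderiv_comp_affine {h : ℂ → ℝ} (hh : ContDiff ℝ ∞ h) (s : ℂ) (ε : ℝ) (e : ℂ) :
    (fun y => fderiv ℝ (fun y : ℂ => h (s + ε • y)) y e) =
      fun y => ε * fderiv ℝ h (s + ε • y) e := by
  ext y
  have h1 : HasFDerivAt (fun y : ℂ => s + ε • y) (ε • ContinuousLinearMap.id ℝ ℂ) y :=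
    ((hasFDerivAt_id y).const_smul ε).const_add s
  have h2 := ((hh.differentiable (by simp)) (s + ε • y)).hasFDerivAt.comp y h1
  have h3 : fderiv ℝ (fun y : ℂ => h (s + ε • y)) y = _ := h2.fderiv
  rw [h3]
  simp

theorem fderiv_fderiv_comp_affine {h : ℂ → ℝ} (hh : ContDiff ℝ ∞ h) (s : ℂ) (ε : ℝ) (e y : ℂ) :
    fderiv ℝ (fun y => fderiv ℝ (fun y : ℂ => h (s + ε • y)) y e) y e =
      ε ^ 2 * fderiv ℝ (fun y => fderiv ℝ h y e) (s + ε • y) e := by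
  have h1 := contDiff_fderiv_apply hh e
  have h2 := congrFun (fderiv_comp_affine h1 s ε e) y
  rw [fderiv_comp_affine hh, fderiv_const_mul]
  · change ε * fderiv ℝ (fun y : ℂ => fderiv ℝ h (s + ε • y) e) y e = _
    rw [h2]
    ring
  · have := h1.differentiable (by simp)
    fun_prop

theorem contDiff_comp_affine {h : ℂ → ℝ} (hh : ContDiff ℝ ∞ h) (s : ℂ) (ε : ℝ) :
    ContDiff ℝ ∞ (fun y : ℂ => h (s + ε • y)) :=
  hh.comp (contDiff_const.add (contDiff_id.const_smul ε))

theorem laplacian_comp_affine {h : ℂ → ℝ} (hh : ContDiff ℝ ∞ h) (s : ℂ) (ε : ℝ) (y : ℂ) :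
    Δ (fun y : ℂ => h (s + ε • y)) y = ε ^ 2 * Δ h (s + ε • y) := by
  have l2 : ∀ {g : ℂ → ℝ} {x}, ContDiff ℝ ∞ g → ContDiffAt ℝ 2 g x := fun hg =>
    (hg.of_le (WithTop.coe_le_coe.2 le_top)).contDiffAt
  rw [laplacian_eq_fderiv_fderiv (l2 (contDiff_comp_affine hh s ε)),
    laplacian_eq_fderiv_fderiv (l2 hh), fderiv_fderiv_comp_affine hh, fderiv_fderiv_comp_affine hh]
  ring

theorem fderiv_fderiv_mul {a b : ℂ → ℝ} (ha : ContDiff ℝ ∞ a) (hb : ContDiff ℝ ∞ b) (e y : ℂ) :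
    fderiv ℝ (fun y => fderiv ℝ (fun y => a y * b y) y e) y e =
      fderiv ℝ (fun y => fderiv ℝ a y e) y e * b y + 2 * (fderiv ℝ a y e * fderiv ℝ b y e) +
        a y * fderiv ℝ (fun y => fderiv ℝ b y e) y e := by
  have da := ha.differentiable (by simp)
  have db := hb.differentiable (by simp)
  have da' := (contDiff_fderiv_apply ha e).differentiable (by simp)
  have db' := (contDiff_fderiv_apply hb e).differentiable (by simp)
  have h1 : (fun y => fderiv ℝ (fun y => a y * b y) y e) =
      fun y => a y * fderiv ℝ b y e + b y * fderiv ℝ a y e := by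
    ext y
    rw [fderiv_fun_mul (da y) (db y)]
    simp
  rw [h1, fderiv_fun_add ((da y).fun_mul (db' y)) ((db y).fun_mul (da' y)),
    fderiv_fun_mul (da y) (db' y), fderiv_fun_mul (db y) (da' y)]
  simp
  ring

theorem exists_bound_of_hasCompactSupport {g : ℂ → ℝ} (hg : Continuous g) (hc : HasCompactSupport g) :
    ∃ C, 0 ≤ C ∧ ∀ x, |g x| ≤ C := by
  obtain ⟨C, hC⟩ := hg.bounded_above_of_compact_support hc
  exact ⟨C, (norm_nonneg _).trans (hC 0), hC⟩

/-- The second derivatives of `y ↦ ψ (s + ε y) χ y` are bounded uniformly in `ε`, and converge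
as `ε → 0`. -/
theorem bound_fderiv_fderiv_scaled {ψ χ : ℂ → ℝ} (hψ : ContDiff ℝ ∞ ψ) (hψc : HasCompactSupport ψ)
    (hχ : ContDiff ℝ ∞ χ) (hχc : HasCompactSupport χ) (s e : ℂ) :
    (∃ M, 0 ≤ M ∧ ∀ ε : ℝ, 0 ≤ ε → ε ≤ 1 → ∀ y,
      |fderiv ℝ (fun y => fderiv ℝ (fun y => ψ (s + ε • y) * χ y) y e) y e| ≤ M) ∧
    ∀ y, Tendsto (fun ε : ℝ =>
      fderiv ℝ (fun y => fderiv ℝ (fun y => ψ (s + ε • y) * χ y) y e) y e) (𝓝 0)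
      (𝓝 (ψ s * fderiv ℝ (fun y => fderiv ℝ χ y e) y e)) := by
  have hψ1 := contDiff_fderiv_apply hψ e
  have hψ2 := contDiff_fderiv_apply hψ1 e
  have hχ1 := contDiff_fderiv_apply hχ e
  have hχ2 := contDiff_fderiv_apply hχ1 e
  have hψc1 : HasCompactSupport (fun y => fderiv ℝ ψ y e) := hψc.fderiv_apply ℝ e
  have hχc1 : HasCompactSupport (fun y => fderiv ℝ χ y e) := hχc.fderiv_apply ℝ e
  obtain ⟨A0, a0, hA0⟩ := exists_bound_of_hasCompactSupport hψ.continuous hψc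
  obtain ⟨A1, a1, hA1⟩ := exists_bound_of_hasCompactSupport hψ1.continuous hψc1
  obtain ⟨A2, a2, hA2⟩ := exists_bound_of_hasCompactSupport hψ2.continuous (hψc1.fderiv_apply ℝ e)
  obtain ⟨B0, b0, hB0⟩ := exists_bound_of_hasCompactSupport hχ.continuous hχc
  obtain ⟨B1, b1, hB1⟩ := exists_bound_of_hasCompactSupport hχ1.continuous hχc1
  obtain ⟨B2, b2, hB2⟩ := exists_bound_of_hasCompactSupport hχ2.continuous (hχc1.fderiv_apply ℝ e)
  have key : ∀ (ε : ℝ) (y : ℂ),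
      fderiv ℝ (fun y => fderiv ℝ (fun y => ψ (s + ε • y) * χ y) y e) y e =
      ε ^ 2 * fderiv ℝ (fun y => fderiv ℝ ψ y e) (s + ε • y) e * χ y +
      2 * (ε * fderiv ℝ ψ (s + ε • y) e * fderiv ℝ χ y e) +
      ψ (s + ε • y) * fderiv ℝ (fun y => fderiv ℝ χ y e) y e := by
    intro ε y
    rw [fderiv_fderiv_mul (contDiff_comp_affine hψ s ε) hχ, fderiv_fderiv_comp_affine hψ]
    have : fderiv ℝ (fun y : ℂ => ψ (s + ε • y)) y e = ε * fderiv ℝ ψ (s + ε • y) e :=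
      congrFun (fderiv_comp_affine hψ s ε e) y
    rw [this]
  constructor
  · refine ⟨A2 * B0 + 2 * (A1 * B1) + A0 * B2, by positivity, fun ε h0 h1 y => ?_⟩
    rw [key]
    refine (abs_add_le _ _).trans (add_le_add ((abs_add_le _ _).trans (add_le_add ?_ ?_)) ?_)
    · rw [abs_mul, abs_mul, abs_of_nonneg (pow_nonneg h0 2)]
      refine mul_le_mul ?_ (hB0 y) (abs_nonneg _) a2
      calc _ ≤ 1 * A2 := mul_le_mul (pow_le_one₀ h0 h1) (hA2 _) (abs_nonneg _) zero_le_one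
        _ = A2 := one_mul _
    · rw [abs_mul, abs_mul, abs_mul, abs_of_nonneg h0, abs_two]
      refine mul_le_mul_of_nonneg_left (mul_le_mul ?_ (hB1 y) (abs_nonneg _) a1) zero_le_two
      calc _ ≤ 1 * A1 := mul_le_mul h1 (hA1 _) (abs_nonneg _) zero_le_one
        _ = A1 := one_mul _
    · rw [abs_mul]
      exact mul_le_mul (hA0 _) (hB2 y) (abs_nonneg _) a0
  · intro y
    simp only [key]
    have c0 := hψ.continuous
    have c1 := hψ1.continuous
    have c2 := hψ2.continuous
    have d2 : Continuous fun ε : ℝ => fderiv ℝ (fun y => fderiv ℝ ψ y e) (s + ε • y) e :=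
      c2.comp (by fun_prop : Continuous fun ε : ℝ => s + ε • y)
    have d1 : Continuous fun ε : ℝ => fderiv ℝ ψ (s + ε • y) e :=
      c1.comp (by fun_prop : Continuous fun ε : ℝ => s + ε • y)
    have : Continuous fun ε : ℝ => ε ^ 2 * fderiv ℝ (fun y => fderiv ℝ ψ y e) (s + ε • y) e * χ y +
      2 * (ε * fderiv ℝ ψ (s + ε • y) e * fderiv ℝ χ y e) +
      ψ (s + ε • y) * fderiv ℝ (fun y => fderiv ℝ χ y e) y e := by fun_prop
    have h := this.tendsto 0
    simpa using h

theorem laplacian_smooth {h : ℂ → ℝ} (hh : ContDiff ℝ ∞ h) (y : ℂ) :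
    Δ h y = fderiv ℝ (fun y => fderiv ℝ h y 1) y 1 +
      fderiv ℝ (fun y => fderiv ℝ h y Complex.I) y Complex.I :=
  laplacian_eq_fderiv_fderiv (hh.of_le (WithTop.coe_le_coe.2 le_top)).contDiffAt

theorem laplacian_add_smooth {h k : ℂ → ℝ} (hh : ContDiff ℝ ∞ h) (hk : ContDiff ℝ ∞ k) (y : ℂ) :
    Δ (fun y => h y + k y) y = Δ h y + Δ k y :=
  ((hh.of_le (WithTop.coe_le_coe.2 le_top)).contDiffAt).laplacian_add
    (hk.of_le (WithTop.coe_le_coe.2 le_top)).contDiffAt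

/-- The integral of `v` against the Laplacian of a test function concentrated near a logarithmic
singularity of `v`. -/
theorem tendsto_integral_mul_laplacian_scaled {s : ℂ} {α L : ℝ} {v ψ χ : ℂ → ℝ}
    (hv : LocallyIntegrable v)
    (hlim : Tendsto (fun x => v x - α * Real.log ‖x - s‖) (𝓝[≠] s) (𝓝 L))
    (hψ : ContDiff ℝ ∞ ψ) (hψc : HasCompactSupport ψ)
    (hχ : ContDiff ℝ ∞ χ) (hχc : HasCompactSupport χ) :
    Tendsto (fun ε : ℝ => ∫ x, v x * Δ (fun x => ψ x * χ (ε⁻¹ • (x - s))) x) (𝓝[>] 0)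
      (𝓝 (2 * Real.pi * α * (ψ s * χ 0))) := by
  have hk : ∀ ε : ℝ, ContDiff ℝ ∞ (fun y => ψ (s + ε • y) * χ y) := fun ε =>
    (contDiff_comp_affine hψ s ε).mul hχ
  have hkc : ∀ ε : ℝ, HasCompactSupport (fun y => ψ (s + ε • y) * χ y) := fun ε => hχc.mul_left
  obtain ⟨⟨M1, m1, hM1⟩, t1⟩ := bound_fderiv_fderiv_scaled hψ hψc hχ hχc s 1
  obtain ⟨⟨M2, m2, hM2⟩, t2⟩ := bound_fderiv_fderiv_scaled hψ hψc hχ hχc s Complex.I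
  -- In dimension two, x = s + εy leaves the integral of v times a Laplacian unchanged. The
  -- divergent constant α log ε + L may be subtracted because the Laplacian of a compactly supported
  -- function has integral zero.
  have step : ∀ ε : ℝ, 0 < ε → ∫ x, v x * Δ (fun x => ψ x * χ (ε⁻¹ • (x - s))) x =
      ∫ y, (v (s + ε • y) - α * Real.log ε - L) * Δ (fun y => ψ (s + ε • y) * χ y) y := by
    intro ε hε
    have hh : ContDiff ℝ ∞ (fun x => ψ x * χ (ε⁻¹ • (x - s))) :=
      hψ.mul (hχ.comp ((contDiff_id.sub contDiff_const).const_smul ε⁻¹))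
    have e1 : ∀ y, Δ (fun y => ψ (s + ε • y) * χ y) y =
        ε ^ 2 * Δ (fun x => ψ x * χ (ε⁻¹ • (x - s))) (s + ε • y) := by
      intro y
      rw [← laplacian_comp_affine hh]
      refine congrArg (fun g : ℂ → ℝ => Δ g y) ?_
      ext y
      rw [add_sub_cancel_left, smul_smul, inv_mul_cancel₀ hε.ne', one_smul]
    have e2 : ∫ x, v x * Δ (fun x => ψ x * χ (ε⁻¹ • (x - s))) x =
        ∫ y, v (s + ε • y) * Δ (fun y => ψ (s + ε • y) * χ y) y := by
      rw [← integral_add_left_eq_self _ s]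
      have h2 := Measure.integral_comp_smul (volume : Measure ℂ)
        (fun x : ℂ => v (s + x) * Δ (fun x => ψ x * χ (ε⁻¹ • (x - s))) (s + x)) ε
      rw [Complex.finrank_real_complex, abs_of_pos (by positivity), smul_eq_mul,
        eq_inv_mul_iff_mul_eq₀ (by positivity)] at h2
      rw [← h2, ← integral_const_mul]
      refine integral_congr_ae (.of_forall fun y => ?_)
      simp only [e1]
      ring
    have hint : Integrable fun y => v (s + ε • y) * Δ (fun y => ψ (s + ε • y) * χ y) y := by
      have h3 : Integrable fun x => v x * Δ (fun x => ψ x * χ (ε⁻¹ • (x - s))) x :=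
        integrable_locallyIntegrable_mul hv (contDiff_laplacian hh).continuous
          (hasCompactSupport_laplacian hψc.mul_right)
      have h4 := ((h3.comp_add_left s).comp_smul hε.ne').const_mul (ε ^ 2)
      refine h4.congr (.of_forall fun y => ?_)
      simp only [e1]
      ring
    rw [e2]
    have e3 : ∀ y, (v (s + ε • y) - α * Real.log ε - L) * Δ (fun y => ψ (s + ε • y) * χ y) y =
        v (s + ε • y) * Δ (fun y => ψ (s + ε • y) * χ y) y -
          (α * Real.log ε + L) * Δ (fun y => ψ (s + ε • y) * χ y) y := fun y => by ring
    simp only [e3]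
    rw [integral_sub hint, integral_const_mul, integral_laplacian (hk ε) (hkc ε), mul_zero,
      sub_zero]
    exact ((contDiff_laplacian (hk ε)).continuous.integrable_of_hasCompactSupport
      (hasCompactSupport_laplacian (hkc ε))).const_mul _
  have lim0 : 2 * Real.pi * α * (ψ s * χ 0) =
      ∫ y, α * Real.log ‖y‖ * (ψ s * Δ χ y) := by
    have e : ∀ y, α * Real.log ‖y‖ * (ψ s * Δ χ y) = (α * ψ s) * (Real.log ‖y‖ * Δ χ y) :=
      fun y => by ring
    simp only [e]
    rw [integral_const_mul, integral_log_norm_mul_laplacian hχ hχc]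
    ring
  rw [lim0]
  have main : Tendsto (fun ε : ℝ =>
      ∫ y, (v (s + ε • y) - α * Real.log ε - L) * Δ (fun y => ψ (s + ε • y) * χ y) y) (𝓝[>] 0)
      (𝓝 (∫ y, α * Real.log ‖y‖ * (ψ s * Δ χ y))) := by
    obtain ⟨r, hr0, hr⟩ : ∃ r : ℝ, 0 < r ∧ tsupport χ ⊆ Metric.closedBall 0 r := by
      obtain ⟨r, hr⟩ := hχc.isBounded.subset_closedBall 0
      exact ⟨max r 1, by positivity, hr.trans (Metric.closedBall_subset_closedBall (le_max_left _ _))⟩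
    have hnear : ∀ᶠ x in 𝓝[≠] s, |v x - α * Real.log ‖x - s‖ - L| < 1 := by
      have := hlim.sub_const L
      rw [sub_self] at this
      have h := this.abs
      rw [abs_zero] at h
      exact h.eventually_lt_const one_pos
    obtain ⟨δ, hδ, hball⟩ := Metric.mem_nhdsWithin_iff.1 hnear
    have hform : ∀ (ε : ℝ) (y : ℂ), 0 < ε → y ≠ 0 → v (s + ε • y) - α * Real.log ε - L =
        α * Real.log ‖y‖ + (v (s + ε • y) - α * Real.log ‖s + ε • y - s‖ - L) := by
      intro ε y hε hy
      rw [add_sub_cancel_left, norm_smul, Real.norm_of_nonneg hε.le,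
        Real.log_mul hε.ne' (norm_ne_zero_iff.2 hy)]
      ring
    have hzero : ∀ (ε : ℝ) (y : ℂ), r < ‖y‖ → Δ (fun y => ψ (s + ε • y) * χ y) y = 0 := by
      intro ε y hy
      refine image_eq_zero_of_notMem_tsupport fun h => ?_
      have := hr (tsupport_mul_subset_right (tsupport_laplacian_subset _ h))
      rw [mem_closedBall_zero_iff] at this
      linarith
    have hne : ∀ᵐ x : ℂ, x ≠ 0 := by simp [ae_iff]
    have hmeas : ∀ ε : ℝ, 0 < ε → AEStronglyMeasurable (fun y => v (s + ε • y)) := by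
      intro ε hε
      have hv0 := hv.aestronglyMeasurable
      have q : Measure.QuasiMeasurePreserving (fun y : ℂ => s + ε • y) := by
        refine ((measurePreserving_add_left volume s).quasiMeasurePreserving).comp ⟨by fun_prop, ?_⟩
        rw [Measure.map_addHaar_smul volume hε.ne']
        exact Measure.smul_absolutelyContinuous
      exact hv0.comp_quasiMeasurePreserving q
    -- On the support |y| ≤ r, for small ε the point s + εy is so close to s that v differs from its
    -- logarithmic model by less than 1. The Laplacian is bounded by M1 + M2 uniformly in ε.
    refine tendsto_integral_filter_of_dominated_convergence
      (fun y => (|α| * |Real.log ‖y‖| + 1) * (M1 + M2) *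
        (Metric.closedBall (0 : ℂ) r).indicator 1 y) ?_ ?_ ?_ ?_
    · filter_upwards [self_mem_nhdsWithin] with ε (hε : 0 < ε)
      exact (((hmeas ε hε).sub aestronglyMeasurable_const).sub aestronglyMeasurable_const).mul
        (contDiff_laplacian (hk ε)).continuous.aestronglyMeasurable
    · have hε1 : (0 : ℝ) < min 1 (δ / (r + 1)) := by positivity
      filter_upwards [Ioo_mem_nhdsGT hε1] with ε hε
      filter_upwards [hne] with y hy
      have h1 : ε < 1 := hε.2.trans_le (min_le_left _ _)
      have h2 : ε < δ / (r + 1) := hε.2.trans_le (min_le_right _ _)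
      by_cases hyr : r < ‖y‖
      · rw [hzero ε y hyr, mul_zero, norm_zero]
        have : y ∉ Metric.closedBall (0 : ℂ) r := by
          rw [mem_closedBall_zero_iff]; exact not_le.2 hyr
        simp [Set.indicator_of_notMem this]
      · have hy' : y ∈ Metric.closedBall (0 : ℂ) r := by
          rw [mem_closedBall_zero_iff]; exact not_lt.1 hyr
        rw [Set.indicator_of_mem hy', Pi.one_apply, mul_one, norm_mul, Real.norm_eq_abs,
          Real.norm_eq_abs]
        have hx : |v (s + ε • y) - α * Real.log ‖s + ε • y - s‖ - L| < 1 := by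
          refine hball ⟨?_, ?_⟩
          · rw [Metric.mem_ball, dist_eq_norm, add_sub_cancel_left, norm_smul,
              Real.norm_of_nonneg hε.1.le]
            rw [lt_div_iff₀ (by positivity)] at h2
            have := not_lt.1 hyr
            nlinarith [hε.1, norm_nonneg y]
          · simp [hε.1.ne', hy]
        refine mul_le_mul ?_ ?_ (abs_nonneg _) (by positivity)
        · rw [hform ε y hε.1 hy]
          refine (abs_add_le _ _).trans (add_le_add ?_ hx.le)
          rw [abs_mul]
        · rw [laplacian_smooth (hk ε)]
          exact (abs_add_le _ _).trans (add_le_add (hM1 ε hε.1.le h1.le y) (hM2 ε hε.1.le h1.le y))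
    · have hl : LocallyIntegrable (fun x : ℂ => (|α| * |Real.log ‖x‖| + 1) * (M1 + M2)) := by
        intro x
        obtain ⟨t, ht, h⟩ := locallyIntegrable_log_norm x
        obtain ⟨t', ht', h'⟩ := (locallyIntegrable_const (μ := volume) (1 : ℝ)) x
        exact ⟨t ∩ t', inter_mem ht ht', ((((h.mono_set Set.inter_subset_left).norm).const_mul |α|).add
          (h'.mono_set Set.inter_subset_right)).mul_const (M1 + M2)⟩
      have h := (hl.integrableOn_isCompact (isCompact_closedBall (0 : ℂ) r))
      rw [← integrable_indicator_iff Metric.isClosed_closedBall.measurableSet] at h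
      refine h.congr (.of_forall fun y => ?_)
      by_cases hy : y ∈ Metric.closedBall (0 : ℂ) r <;> simp [hy]
    · filter_upwards [hne] with y hy
      have c1 : Tendsto (fun ε : ℝ => Δ (fun y => ψ (s + ε • y) * χ y) y) (𝓝[>] 0)
          (𝓝 (ψ s * Δ χ y)) := by
        simp only [laplacian_smooth (hk _), laplacian_smooth hχ, mul_add]
        exact ((t1 y).add (t2 y)).mono_left nhdsWithin_le_nhds
      refine Tendsto.mul ?_ c1
      have c2 : Tendsto (fun ε : ℝ => s + ε • y) (𝓝[>] 0) (𝓝[≠] s) := by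
        refine tendsto_nhdsWithin_iff.2 ⟨?_, ?_⟩
        · have : ContinuousAt (fun ε : ℝ => s + ε • y) 0 := by fun_prop
          have h := this.tendsto.mono_left (nhdsWithin_le_nhds (s := Set.Ioi 0))
          simpa using h
        · filter_upwards [self_mem_nhdsWithin] with ε (hε : 0 < ε)
          simp [hε.ne', hy]
      have c3 := ((hlim.comp c2).sub_const L).const_add (α * Real.log ‖y‖)
      rw [sub_self, add_zero] at c3
      refine c3.congr' ?_
      filter_upwards [self_mem_nhdsWithin] with ε (hε : 0 < ε)
      exact (hform ε y hε hy).symm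
  refine main.congr' ?_
  filter_upwards [self_mem_nhdsWithin] with ε hε using (step ε hε).symm


/-! ### Distributional Poisson equation with Dirac masses. -/

/-- A function continuous off a finite set, with at most logarithmic singularities, is locally
integrable. -/
theorem locallyIntegrable_of_log_bound {S : Set ℂ} (hS : S.Finite) {v : ℂ → ℝ}
    (hc : ∀ x ∉ S, ContinuousAt v x)
    (hs : ∀ s ∈ S, ∃ C, ∀ᶠ x in 𝓝[≠] s, |v x| ≤ C * (|Real.log ‖x - s‖| + 1)) :
    LocallyIntegrable v := by
  have hopen : IsOpen Sᶜ := hS.isClosed.isOpen_compl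
  have hnull : ∀ᵐ x : ℂ, x ∉ S := by
    rw [ae_iff]
    simpa using hS.measure_zero volume
  have hcont : ContinuousOn v Sᶜ := fun x hx => (hc x hx).continuousWithinAt
  have hm : AEStronglyMeasurable v := by
    have h := hcont.aestronglyMeasurable (μ := volume) hopen.measurableSet
    rwa [Measure.restrict_eq_self_of_ae_mem (s := Sᶜ) hnull] at h
  intro x
  by_cases hx : x ∈ S
  · obtain ⟨C, hC⟩ := hs x hx
    obtain ⟨δ, hδ, hball⟩ := Metric.mem_nhdsWithin_iff.1 hC
    have hl : LocallyIntegrable (fun y : ℂ => C * (|Real.log ‖y - x‖| + 1)) := by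
      intro y
      obtain ⟨t, ht, h⟩ := locallyIntegrable_log_norm (y - x)
      obtain ⟨t', ht', h'⟩ := (locallyIntegrable_const (μ := volume) (1 : ℝ)) y
      have hcont : ContinuousAt (fun y : ℂ => y - x) y := by fun_prop
      refine ⟨(fun y => y - x) ⁻¹' t ∩ t', inter_mem (hcont ht) ht', ?_⟩
      have h2 : IntegrableOn (fun y : ℂ => Real.log ‖y - x‖) ((fun y => y - x) ⁻¹' t) :=
        ((measurePreserving_sub_right volume x).integrableOn_comp_preimage
          (MeasurableEquiv.subRight x).measurableEmbedding).2 h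
      exact (((h2.mono_set Set.inter_subset_left).norm).add
        (h'.mono_set Set.inter_subset_right)).const_mul C
    obtain ⟨t, ht, h⟩ := hl x
    refine ⟨t ∩ Metric.ball x δ, inter_mem ht (Metric.ball_mem_nhds x hδ), ?_⟩
    refine Integrable.mono' (h.mono_set Set.inter_subset_left) hm.restrict ?_
    have hm2 : ∀ᵐ y ∂(volume.restrict (Metric.ball x δ)), y ∈ Metric.ball x δ :=
      ae_restrict_mem Metric.isOpen_ball.measurableSet
    have hm3 := ae_mono (Measure.restrict_mono (Set.inter_subset_right (s := t)) le_rfl) hm2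
    filter_upwards [hm3, ae_restrict_of_ae hnull] with y hy hyS
    exact hball ⟨hy, fun h : y = x => hyS (h ▸ hx)⟩
  · have h1 : ∀ᶠ y in 𝓝 x, ‖v y‖ ≤ ‖v x‖ + 1 := by
      have := (hc x hx).norm
      exact this.eventually_le_const (by simp)
    obtain ⟨t', ht', h'⟩ := (locallyIntegrable_const (μ := volume) (‖v x‖ + 1 : ℝ)) x
    obtain ⟨r, hr, hb⟩ := Metric.eventually_nhds_iff_ball.1 h1
    refine ⟨t' ∩ Metric.ball x r, inter_mem ht' (Metric.ball_mem_nhds x hr), ?_⟩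
    refine Integrable.mono' (h'.mono_set Set.inter_subset_left) hm.restrict ?_
    have hm2 : ∀ᵐ y ∂(volume.restrict (Metric.ball x r)), y ∈ Metric.ball x r :=
      ae_restrict_mem Metric.isOpen_ball.measurableSet
    have hm3 := ae_mono (Measure.restrict_mono (Set.inter_subset_right (s := t')) le_rfl) hm2
    filter_upwards [hm3] with y hy using hb y hy

/-- The distribution `Δ v + f` applied to a test function. -/
def pairing (v f ψ : ℂ → ℝ) : ℝ := ∫ x, (v x * Δ ψ x + f x * ψ x)

theorem integrable_pairing {v f ψ : ℂ → ℝ} (hv : LocallyIntegrable v) (hf : LocallyIntegrable f)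
    (hψ : ContDiff ℝ ∞ ψ) (hc : HasCompactSupport ψ) :
    Integrable (fun x => v x * Δ ψ x) ∧ Integrable (fun x => f x * ψ x) :=
  ⟨integrable_locallyIntegrable_mul hv (contDiff_laplacian hψ).continuous
    (hasCompactSupport_laplacian hc), integrable_locallyIntegrable_mul hf hψ.continuous hc⟩

theorem pairing_add {v f ψ ψ' : ℂ → ℝ} (hv : LocallyIntegrable v) (hf : LocallyIntegrable f)
    (hψ : ContDiff ℝ ∞ ψ) (hc : HasCompactSupport ψ) (hψ' : ContDiff ℝ ∞ ψ')
    (hc' : HasCompactSupport ψ') :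
    pairing v f (fun x => ψ x + ψ' x) = pairing v f ψ + pairing v f ψ' := by
  obtain ⟨a, b⟩ := integrable_pairing hv hf hψ hc
  obtain ⟨a', b'⟩ := integrable_pairing hv hf hψ' hc'
  have e := integral_add (a.add b) (a'.add b')
  simp only [Pi.add_apply] at e
  rw [pairing, pairing, pairing, ← e]
  refine integral_congr_ae (.of_forall fun x => ?_)
  simp only [laplacian_add_smooth hψ hψ']
  ring

theorem pairing_sum {ι : Type*} (S : Finset ι) {v f : ℂ → ℝ} {ψ : ι → ℂ → ℝ}
    (hv : LocallyIntegrable v) (hf : LocallyIntegrable f) (hψ : ∀ i, ContDiff ℝ ∞ (ψ i))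
    (hc : ∀ i, HasCompactSupport (ψ i)) :
    HasCompactSupport (fun x => ∑ i ∈ S, ψ i x) ∧
    pairing v f (fun x => ∑ i ∈ S, ψ i x) = ∑ i ∈ S, pairing v f (ψ i) := by
  classical
  induction S using Finset.induction_on with
  | empty =>
    have : Δ (fun _ : ℂ => (0 : ℝ)) = 0 := by
      ext x
      exact congrFun InnerProductSpace.laplacian_const x
    simp only [Finset.sum_empty]
    refine ⟨HasCompactSupport.zero, ?_⟩
    simp [pairing, this]
  | insert i S hi ih =>
    simp only [Finset.sum_insert hi]
    exact ⟨(hc i).add ih.1, by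
      rw [pairing_add hv hf (hψ i) (hc i) (ContDiff.sum fun i _ => hψ i) ih.1, ih.2]⟩

/-- A function which is smooth off a finite set with logarithmic singularities there satisfies a
Poisson equation with Dirac masses. -/
theorem pairing_eq_sum_of_log_singularities {S : Finset ℂ} {α : ℂ → ℝ} {v f : ℂ → ℝ}
    (hv : ∀ x ∉ S, ContDiffAt ℝ 2 v x) (hΔ : ∀ x ∉ S, Δ v x = -f x)
    (hlim : ∀ s ∈ S, ∃ L, Tendsto (fun x => v x - α s * Real.log ‖x - s‖) (𝓝[≠] s) (𝓝 L))
    (hvI : LocallyIntegrable v) (hfI : LocallyIntegrable f) {φ : ℂ → ℝ} (hφ : ContDiff ℝ ∞ φ)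
    (hφc : HasCompactSupport φ) :
    pairing v f φ = ∑ s ∈ S, 2 * Real.pi * α s * φ s := by
  -- The bump is 1 on the unit ball and 0 outside radius 2, so `h ε s` agrees with φ within ε of s
  -- and vanishes beyond 2ε.
  let χ : ContDiffBump (0 : ℂ) := ⟨1, 2, one_pos, one_lt_two⟩
  have hχ : ContDiff ℝ ∞ χ := χ.contDiff
  have hχc : HasCompactSupport χ := χ.hasCompactSupport
  set h : ℝ → ℂ → ℂ → ℝ := fun ε s x => φ x * χ (ε⁻¹ • (x - s)) with hh
  have hsm : ∀ ε s, ContDiff ℝ ∞ (h ε s) := fun ε s =>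
    hφ.mul (hχ.comp ((contDiff_id.sub contDiff_const).const_smul ε⁻¹))
  have hcs : ∀ ε s, HasCompactSupport (h ε s) := fun ε s => hφc.mul_right
  have lim : ∀ s ∈ S, Tendsto (fun ε => pairing v f (h ε s)) (𝓝[>] 0)
      (𝓝 (2 * Real.pi * α s * φ s)) := by
    intro s hs
    obtain ⟨L, hL⟩ := hlim s hs
    have t1 := tendsto_integral_mul_laplacian_scaled hvI hL hφ hφc hχ hχc
    have hχ0 : χ 0 = 1 := χ.one_of_mem_closedBall (by simp [χ])
    rw [hχ0, mul_one] at t1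
    -- The locally integrable part `f` carries no mass at s: the cut-off tends to zero off s.
    have t2 : Tendsto (fun ε => ∫ x, f x * h ε s x) (𝓝[>] 0) (𝓝 (∫ _ : ℂ, (0 : ℝ))) := by
      refine tendsto_integral_filter_of_dominated_convergence (fun x => ‖f x * φ x‖) ?_ ?_ ?_ ?_
      · exact .of_forall fun ε => (integrable_pairing hvI hfI (hsm ε s) (hcs ε s)).2.1
      · refine .of_forall fun ε => .of_forall fun x => ?_
        rw [hh]
        simp only
        rw [← mul_assoc, norm_mul]
        refine mul_le_of_le_one_right (norm_nonneg _) ?_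
        rw [Real.norm_of_nonneg χ.nonneg]
        exact χ.le_one
      · exact (integrable_pairing hvI hfI hφ hφc).2.norm
      · have hne : ∀ᵐ x : ℂ, x ≠ s := by simp [ae_iff]
        filter_upwards [hne] with x hx
        refine tendsto_const_nhds.congr' ?_
        have hx0 : 0 < ‖x - s‖ / 2 := by
          have := norm_pos_iff.2 (sub_ne_zero.2 hx)
          positivity
        filter_upwards [Ioo_mem_nhdsGT hx0] with ε hε
        have : χ (ε⁻¹ • (x - s)) = 0 := by
          refine χ.zero_of_le_dist ?_
          have h1 := hε.1
          have h2 := hε.2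
          rw [dist_zero_right, norm_smul, norm_inv, Real.norm_of_nonneg h1.le, inv_mul_eq_div,
            le_div_iff₀ h1]
          change 2 * ε ≤ _
          linarith
        simp only [hh, this, mul_zero]
    have t3 := t1.add t2
    rw [integral_zero, add_zero] at t3
    refine t3.congr fun ε => ?_
    obtain ⟨a, b⟩ := integrable_pairing hvI hfI (hsm ε s) (hcs ε s)
    rw [pairing, integral_add a b]
  have limS := tendsto_finsetSum S lim
  have evtl : ∀ᶠ ε : ℝ in 𝓝[>] 0, ∑ s ∈ S, pairing v f (h ε s) = pairing v f φ := by
    -- Separation 3ε = ε + 2ε keeps the ε-ball about one singularity off the support of the cut-off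
    -- at any other.
    have hsep : ∀ᶠ ε : ℝ in 𝓝[>] 0, ∀ s ∈ S, ∀ s' ∈ S, s ≠ s' → 3 * ε < ‖s - s'‖ := by
      rw [Filter.eventually_all_finset]
      intro s _
      rw [Filter.eventually_all_finset]
      intro s' _
      by_cases hss : s = s'
      · exact .of_forall fun _ h => absurd hss h
      · have : 0 < ‖s - s'‖ / 3 := by
          have := norm_pos_iff.2 (sub_ne_zero.2 hss)
          positivity
        filter_upwards [Ioo_mem_nhdsGT this] with ε hε _
        linarith [hε.2]
    filter_upwards [hsep, self_mem_nhdsWithin] with ε hsep (hε : 0 < ε)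
    obtain ⟨sc, sp⟩ := pairing_sum S hvI hfI (hsm ε) (hcs ε)
    have ssm : ContDiff ℝ ∞ (fun x => ∑ s ∈ S, h ε s x) := ContDiff.sum fun s _ => hsm ε s
    -- The remainder vanishes near every singularity, so Green's identity and the pointwise equation
    -- give it pairing zero.
    set g : ℂ → ℝ := fun x => φ x + -∑ s ∈ S, h ε s x with hg
    have gsm : ContDiff ℝ ∞ g := hφ.add ssm.neg
    have gc : HasCompactSupport g := hφc.add sc.neg
    have hφg : φ = fun x => g x + ∑ s ∈ S, h ε s x := by
      ext x
      simp [hg]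
    have gsupp : tsupport g ⊆ (S : Set ℂ)ᶜ := by
      intro x hx hxS
      refine notMem_tsupport_iff_eventuallyEq.2 ?_ hx
      filter_upwards [Metric.ball_mem_nhds x hε] with y hy
      rw [Metric.mem_ball, dist_eq_norm] at hy
      have e1 : h ε x y = φ y := by
        have : χ (ε⁻¹ • (y - x)) = 1 := by
          refine χ.one_of_mem_closedBall ?_
          rw [mem_closedBall_zero_iff, norm_smul, norm_inv, Real.norm_of_nonneg hε.le,
            inv_mul_eq_div, div_le_iff₀ hε]
          change _ ≤ 1 * ε
          linarith
        simp only [hh, this, mul_one]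
      have e2 : ∀ s ∈ S, s ≠ x → h ε s y = 0 := by
        intro s hs hsx
        have h3 := hsep s hs x hxS hsx
        have : χ (ε⁻¹ • (y - s)) = 0 := by
          refine χ.zero_of_le_dist ?_
          rw [dist_zero_right, norm_smul, norm_inv, Real.norm_of_nonneg hε.le, inv_mul_eq_div,
            le_div_iff₀ hε]
          change 2 * ε ≤ _
          have h4 : ‖s - x‖ ≤ ‖y - s‖ + ‖y - x‖ := by
            rw [← norm_neg (y - s)]
            calc ‖s - x‖ = ‖-(y - s) + (y - x)‖ := by congr 1; ring
              _ ≤ _ := norm_add_le _ _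
          linarith
        simp only [hh, this, mul_zero]
      simp only [hg, Pi.zero_apply]
      rw [Finset.sum_eq_single_of_mem x hxS e2, e1]
      ring
    have g0 : pairing v f g = 0 := by
      obtain ⟨a, b⟩ := integrable_pairing hvI hfI gsm gc
      obtain ⟨_, _, c⟩ := integral_mul_laplacian (U := (S : Set ℂ)ᶜ) (fun x hx => hv x hx)
        gsm gc gsupp
      rw [pairing, integral_add a b, c, ← integral_add]
      · rw [← integral_zero ℂ ℝ]
        refine integral_congr_ae (.of_forall fun x => ?_)
        by_cases hx : x ∈ tsupport g
        · simp only [hΔ x (gsupp hx)]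
          ring
        · simp [image_eq_zero_of_notMem_tsupport hx]
      · assumption
      · exact b
    conv_rhs => rw [hφg]
    rw [pairing_add hvI hfI gsm gc ssm sc, g0, zero_add, sp]
  exact tendsto_nhds_unique ((tendsto_const_nhds.congr' (evtl.mono fun _ h => h.symm))) limS


/-! ### The modular function w and its behaviour at the cusp. -/

theorem modularForm_smul {k : ℤ} (f : ModularForm 𝒮ℒ k) (γ : SL(2, ℤ)) (z : ℍ) :
    f (γ • z) = denom (γ : GL (Fin 2) ℝ) z ^ k * f z := by
  have h : (γ : GL (Fin 2) ℝ) ∈ 𝒮ℒ := ⟨γ, rfl⟩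
  exact SlashInvariantForm.slash_action_eqn'' f h z

theorem denom_smul_ne_zero (γ : SL(2, ℤ)) (z : ℍ) : denom (γ : GL (Fin 2) ℝ) z ≠ 0 :=
  denom_ne_zero _ z

theorem ext_coe (f : ℍ → ℂ) (z : ℍ) : ext f z = f z := by
  simp [ext]

theorem eventually_im_pos (z : ℍ) : ∀ᶠ x : ℂ in 𝓝 (z : ℂ), 0 < x.im :=
  isOpen_upperHalfPlaneSet.mem_nhds z.im_pos

theorem ext_of_im_pos (f : ℍ → ℂ) {x : ℂ} (hx : 0 < x.im) : ext f x = f ⟨x, hx⟩ := by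
  rw [ext, ofComplex_apply_of_im_pos hx]

theorem analyticAt_ext {k : ℤ} (f : ModularForm 𝒮ℒ k) (z : ℍ) : AnalyticAt ℂ (ext f) z :=
  ((UpperHalfPlane.mdifferentiable_iff.1 f.holo').analyticAt
    (isOpen_upperHalfPlaneSet.mem_nhds z.im_pos))

theorem E_sub_eq (z : ℍ) : ModularForm.E₄ z ^ 3 - ModularForm.E₆ z ^ 2 =
    1728 * CuspForm.discriminant z := by
  have := ModularForm.discriminant_eq_E₄_cube_sub_E₆_sq z
  rw [CuspForm.coe_discriminant, this]
  ring

theorem disc_ne_zero (z : ℍ) : CuspForm.discriminant z ≠ 0 := ModularForm.discriminant_ne_zero z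

/-- The discriminant as a modular form. -/
def discForm : ModularForm 𝒮ℒ 12 where
  toFun := CuspForm.discriminant
  slash_action_eq' := CuspForm.discriminant.slash_action_eq'
  holo' := CuspForm.discriminant.holo'
  bdd_at_cusps' := fun hc => ModularFormClass.bdd_at_cusps CuspForm.discriminant hc

theorem discForm_ne_zero (z : ℍ) : discForm z ≠ 0 := ModularForm.discriminant_ne_zero z

theorem wfun_eq (z : ℍ) : wfun z = ModularForm.E₄ z ^ 3 / (1728 * discForm z) := by
  rw [wfun, E_sub_eq]
  rfl

theorem wfun_sub_one_eq (z : ℍ) : wfun z - 1 = ModularForm.E₆ z ^ 2 / (1728 * discForm z) := by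
  have h := E_sub_eq z
  have h0 : discForm z ≠ 0 := discForm_ne_zero z
  change _ = 1728 * discForm z at h
  rw [wfun_eq]
  field_simp
  linear_combination h

theorem wfun_smul (γ : SL(2, ℤ)) (z : ℍ) : wfun (γ • z) = wfun z := by
  have h0 := denom_smul_ne_zero γ z
  have h1 := discForm_ne_zero z
  rw [wfun_eq, wfun_eq, modularForm_smul, modularForm_smul]
  have e : denom (γ : GL (Fin 2) ℝ) z ^ (12 : ℤ) = (denom (γ : GL (Fin 2) ℝ) z ^ (4 : ℤ)) ^ 3 := by
    rw [← zpow_natCast, ← zpow_mul]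
    norm_num
  have h2 := zpow_ne_zero 4 h0
  rw [mul_pow, e]
  field_simp

theorem ext_wfun_eq (x : ℂ) : ext wfun x =
    ext ModularForm.E₄ x ^ 3 / (1728 * ext discForm x) := wfun_eq _

theorem ext_wfun_sub_one_eq (x : ℂ) : ext wfun x - 1 =
    ext ModularForm.E₆ x ^ 2 / (1728 * ext discForm x) := wfun_sub_one_eq _

theorem ext_discForm_ne_zero (x : ℂ) : ext discForm x ≠ 0 := discForm_ne_zero _

theorem analyticAt_wfun (z : ℍ) : AnalyticAt ℂ (ext wfun) z := by
  have : ext wfun = _ := funext ext_wfun_eq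
  rw [this]
  refine ((analyticAt_ext _ z).pow 3).div (analyticAt_const.mul (analyticAt_ext _ z)) ?_
  exact mul_ne_zero (by norm_num) (ext_discForm_ne_zero _)

/-- The parameter `q = exp (2πi z)` at the cusp. -/
def qpar (z : ℂ) : ℂ := Function.Periodic.qParam 1 z

theorem hasDerivAt_qpar (z : ℂ) : HasDerivAt qpar (2 * Real.pi * Complex.I * qpar z) z := by
  have h : qpar = fun z => Complex.exp (2 * Real.pi * Complex.I * z) := by
    ext z
    simp [qpar, Function.Periodic.qParam]
  rw [h]
  have := ((hasDerivAt_id z).const_mul (2 * Real.pi * Complex.I)).cexp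
  refine this.congr_deriv ?_
  simp [mul_comm]

theorem qpar_ne_zero (z : ℂ) : qpar z ≠ 0 := by
  simp [qpar, Function.Periodic.qParam]

theorem norm_qpar_lt_one {z : ℂ} (hz : 0 < z.im) : ‖qpar z‖ < 1 := by
  have := (Function.Periodic.norm_qParam_lt_iff zero_lt_one 0 z).2 hz
  simpa [qpar] using this

theorem tendsto_qpar : Tendsto (fun z : ℍ => qpar z) atImInfty (𝓝[≠] 0) :=
  tendsto_nhdsWithin_iff.2 ⟨qParam_tendsto_atImInfty one_pos, .of_forall fun _ => qpar_ne_zero _⟩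

/-- The function of `q` defined by a modular form. -/
def cuspFun {k : ℤ} (f : ModularForm 𝒮ℒ k) : ℂ → ℂ := cuspFunction 1 f

theorem analyticAt_cuspFun {k : ℤ} (f : ModularForm 𝒮ℒ k) {q : ℂ} (hq : ‖q‖ < 1) :
    AnalyticAt ℂ (cuspFun f) q := by
  have h : DifferentiableOn ℂ (cuspFun f) (Metric.ball 0 1) := fun x hx =>
    (ModularFormClass.differentiableAt_cuspFunction f one_pos one_mem_strictPeriods_SL
      (mem_ball_zero_iff.1 hx)).differentiableWithinAt
  exact h.analyticAt (Metric.isOpen_ball.mem_nhds (mem_ball_zero_iff.2 hq))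

theorem ext_eq_cuspFun {k : ℤ} (f : ModularForm 𝒮ℒ k) {x : ℂ} (hx : 0 < x.im) :
    ext f x = cuspFun f (qpar x) := by
  rw [ext_of_im_pos _ hx]
  exact (SlashInvariantFormClass.eq_cuspFunction f ⟨x, hx⟩ one_mem_strictPeriods_SL
    one_ne_zero).symm

theorem deriv_comp_qpar {φ : ℂ → ℂ} {x : ℂ} (h : AnalyticAt ℂ φ (qpar x)) :
    deriv (fun x => φ (qpar x)) x = 2 * Real.pi * Complex.I * (qpar x * deriv φ (qpar x)) := by
  have := (h.differentiableAt.hasDerivAt).comp x (hasDerivAt_qpar x)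
  refine this.deriv.trans ?_
  ring

theorem deriv_ext_eq {k : ℤ} (f : ModularForm 𝒮ℒ k) {x : ℂ} (hx : 0 < x.im) :
    deriv (ext f) x = 2 * Real.pi * Complex.I * (qpar x * deriv (cuspFun f) (qpar x)) := by
  have e : ext f =ᶠ[𝓝 x] fun x => cuspFun f (qpar x) := by
    filter_upwards [isOpen_upperHalfPlaneSet.mem_nhds hx] with y hy using ext_eq_cuspFun f hy
  rw [e.deriv_eq, deriv_comp_qpar (analyticAt_cuspFun f (norm_qpar_lt_one hx))]

theorem tendsto_modularForm {k : ℤ} (f : ModularForm 𝒮ℒ k) :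
    Tendsto f atImInfty (𝓝 (cuspFun f 0)) := by
  have h := ((analyticAt_cuspFun f (q := 0) (by simp)).continuousAt.tendsto).comp
    (tendsto_qpar.mono_right nhdsWithin_le_nhds)
  refine h.congr fun z => ?_
  rw [Function.comp, ← ext_eq_cuspFun f z.im_pos, ext_coe]

theorem tendsto_deriv_modularForm {k : ℤ} (f : ModularForm 𝒮ℒ k) :
    Tendsto (fun z : ℍ => deriv (ext f) z) atImInfty (𝓝 0) := by
  have h := (((analyticAt_cuspFun f (q := 0) (by simp)).deriv.continuousAt.tendsto).comp
    (tendsto_qpar.mono_right nhdsWithin_le_nhds))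
  have h2 := ((tendsto_qpar.mono_right nhdsWithin_le_nhds).mul h).const_mul
    (2 * Real.pi * Complex.I)
  rw [zero_mul, mul_zero] at h2
  exact h2.congr fun z => (deriv_ext_eq f z.im_pos).symm

theorem cuspFun_E₄_zero : cuspFun ModularForm.E₄ 0 = 1 := by
  have h := EisensteinSeries.E_qExpansion_coeff_zero (k := 4) (by norm_num) ⟨2, rfl⟩
  rw [qExpansion_coeff] at h
  simp only [Nat.factorial_zero, Nat.cast_one, inv_one, iteratedDeriv_zero, one_mul] at h
  exact h

theorem cuspFun_discForm : cuspFun discForm 0 = 0 ∧ deriv (cuspFun discForm) 0 = 1 := by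
  constructor
  · have h := CuspFormClass.cuspFunction_apply_zero (h := 1) CuspForm.discriminant one_pos
      one_mem_strictPeriods_SL
    exact h
  · have h := ModularForm.discriminant_qExpansion_coeff_one
    rw [qExpansion_coeff] at h
    simp only [Nat.factorial_one, Nat.cast_one, inv_one, iteratedDeriv_one, one_mul] at h
    exact h

theorem E₄_ne : ∀ᶠ z : ℍ in atImInfty, ModularForm.E₄ z ≠ 0 := by
  have := tendsto_modularForm ModularForm.E₄
  rw [cuspFun_E₄_zero] at this
  exact this.eventually_ne one_ne_zero

/-- Near the cusp, `w` is `q⁻¹` times a nonvanishing holomorphic function of `q`. -/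
theorem exists_wfun_eq_div_qpar : ∃ κ : ℂ → ℂ, AnalyticAt ℂ κ 0 ∧ κ 0 ≠ 0 ∧
    ∀ᶠ q in 𝓝 (0 : ℂ), ∀ x : ℂ, 0 < x.im → qpar x = q → ext wfun x = κ q / q := by
  have hd := analyticAt_cuspFun discForm (q := 0) (by simp)
  have ho : analyticOrderAt (cuspFun discForm) 0 = ((1 : ℕ) : ℕ∞) := by
    exact hd.analyticOrderAt_eq_one_of_zero_deriv_ne_zero cuspFun_discForm.1
      (by rw [cuspFun_discForm.2]; exact one_ne_zero)
  obtain ⟨g, hg, hg0, hge⟩ := hd.analyticOrderAt_eq_natCast.1 ho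
  have h4 := analyticAt_cuspFun ModularForm.E₄ (q := 0) (by simp)
  refine ⟨fun q => cuspFun ModularForm.E₄ q ^ 3 / (1728 * g q),
    (h4.pow 3).div (analyticAt_const.mul hg) (mul_ne_zero (by norm_num) hg0), ?_, ?_⟩
  · simp only [cuspFun_E₄_zero]
    have := hg0
    simp [this]
  · filter_upwards [hge] with q hq x hx hxq
    rw [ext_wfun_eq, ext_eq_cuspFun _ hx, ext_eq_cuspFun _ hx, hxq, hq]
    simp only [sub_zero, pow_one, smul_eq_mul]
    rw [div_div]
    ring_nf

theorem tendsto_wfun : Tendsto (fun z : ℍ => ‖wfun z‖) atImInfty atTop := by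
  obtain ⟨κ, hκ, hκ0, h⟩ := exists_wfun_eq_div_qpar
  have t1 : Tendsto (fun q => ‖κ q / q‖) (𝓝[≠] 0) atTop := by
    simp only [div_eq_mul_inv, norm_mul, norm_inv]
    refine Tendsto.pos_mul_atTop (norm_pos_iff.2 hκ0)
      (hκ.continuousAt.norm.tendsto.mono_left nhdsWithin_le_nhds) ?_
    exact tendsto_inv_nhdsGT_zero.comp (tendsto_norm_nhdsNE_zero)
  refine (t1.comp tendsto_qpar).congr' ?_
  filter_upwards [(tendsto_qpar.mono_right nhdsWithin_le_nhds).eventually h] with z hz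
  rw [Function.comp, ← hz z z.im_pos rfl, ext_coe]


/-! ### The derivative and the ramification of w. -/

theorem cuspFun_E₆_zero : cuspFun ModularForm.E₆ 0 = 1 := by
  have h := EisensteinSeries.E_qExpansion_coeff_zero (k := 6) (by norm_num) ⟨3, rfl⟩
  rw [qExpansion_coeff] at h
  simp only [Nat.factorial_zero, Nat.cast_one, inv_one, iteratedDeriv_zero, one_mul] at h
  exact h

theorem eventually_modularForm_ne_zero {k : ℤ} {f : ModularForm 𝒮ℒ k} (hf : f ≠ 0) (z : ℍ) :
    ∀ᶠ x in 𝓝[≠] (z : ℂ), ext f x ≠ 0 := by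
  refine (analyticAt_ext f z).eventually_eq_zero_or_eventually_ne_zero.resolve_left fun h => hf ?_
  have h2 : AnalyticOnNhd ℂ (ext f) upperHalfPlaneSet := fun x hx => analyticAt_ext f ⟨x, hx⟩
  have h3 := h2.eqOn_zero_of_preconnected_of_eventuallyEq_zero
    ((convex_halfSpace_im_gt 0).isPreconnected) z.im_pos h
  ext x
  have := h3 x.im_pos
  rwa [ext_coe] at this

theorem analyticOrderAt_modularForm_ne_top {k : ℤ} {f : ModularForm 𝒮ℒ k} (hf : f ≠ 0) (z : ℍ) :
    analyticOrderAt (ext f) z ≠ ⊤ := by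
  rw [Ne, analyticOrderAt_eq_top]
  intro h
  obtain ⟨x, hx1, hx2⟩ :=
    ((eventually_modularForm_ne_zero hf z).and (h.filter_mono nhdsWithin_le_nhds)).exists
  exact hx1 hx2

/-- The action of `γ` on the upper half plane as a function of a complex variable. -/
def mobius (γ : SL(2, ℤ)) (x : ℂ) : ℂ := ((γ 0 0 : ℤ) * x + (γ 0 1 : ℤ)) / ((γ 1 0 : ℤ) * x + (γ 1 1 : ℤ))

theorem mobius_coe (γ : SL(2, ℤ)) (z : ℍ) : mobius γ z = (γ • z : ℍ) := by
  rw [coe_specialLinearGroup_apply]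
  simp [mobius]

theorem denom_eq (γ : SL(2, ℤ)) (x : ℂ) :
    denom (γ : GL (Fin 2) ℝ) x = (γ 1 0 : ℤ) * x + (γ 1 1 : ℤ) := by
  simp [denom]

theorem mobius_of_im_pos (γ : SL(2, ℤ)) {x : ℂ} (hx : 0 < x.im) :
    mobius γ x = (γ • (⟨x, hx⟩ : ℍ) : ℍ) := mobius_coe γ ⟨x, hx⟩

theorem hasDerivAt_mobius (γ : SL(2, ℤ)) (z : ℍ) :
    HasDerivAt (mobius γ) ((denom (γ : GL (Fin 2) ℝ) z ^ 2)⁻¹) z := by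
  have h0 := denom_smul_ne_zero γ z
  rw [denom_eq] at h0 ⊢
  have h1 : HasDerivAt (fun x : ℂ => (γ 0 0 : ℤ) * x + (γ 0 1 : ℤ)) ((γ 0 0 : ℤ) : ℂ) z := by
    simpa using ((hasDerivAt_id (z : ℂ)).const_mul ((γ 0 0 : ℤ) : ℂ)).add_const ((γ 0 1 : ℤ) : ℂ)
  have h2 : HasDerivAt (fun x : ℂ => (γ 1 0 : ℤ) * x + (γ 1 1 : ℤ)) ((γ 1 0 : ℤ) : ℂ) z := by
    simpa using ((hasDerivAt_id (z : ℂ)).const_mul ((γ 1 0 : ℤ) : ℂ)).add_const ((γ 1 1 : ℤ) : ℂ)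
  refine (h1.div h2 h0).congr_deriv ?_
  have hdet : ((γ 0 0 : ℤ) : ℂ) * (γ 1 1 : ℤ) - (γ 0 1 : ℤ) * (γ 1 0 : ℤ) = 1 := by
    have := Matrix.det_fin_two γ.1
    rw [γ.2] at this
    exact_mod_cast this.symm
  rw [div_eq_iff (pow_ne_zero 2 h0), inv_mul_cancel₀ (pow_ne_zero 2 h0)]
  linear_combination hdet

theorem deriv_mobius (γ : SL(2, ℤ)) (z : ℍ) :
    deriv (mobius γ) z = (denom (γ : GL (Fin 2) ℝ) z ^ 2)⁻¹ := (hasDerivAt_mobius γ z).deriv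

theorem deriv_mobius_ne_zero (γ : SL(2, ℤ)) (z : ℍ) : deriv (mobius γ) z ≠ 0 := by
  rw [deriv_mobius]
  exact inv_ne_zero (pow_ne_zero 2 (denom_smul_ne_zero γ z))

theorem analyticAt_mobius (γ : SL(2, ℤ)) (z : ℍ) : AnalyticAt ℂ (mobius γ) z := by
  have h0 := denom_smul_ne_zero γ z
  rw [denom_eq] at h0
  exact ((analyticAt_const.mul analyticAt_id).add analyticAt_const).div
    ((analyticAt_const.mul analyticAt_id).add analyticAt_const) h0

theorem ext_mobius (f : ℍ → ℂ) (γ : SL(2, ℤ)) {x : ℂ} (hx : 0 < x.im) :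
    ext f (mobius γ x) = f (γ • (⟨x, hx⟩ : ℍ)) := by
  rw [mobius_of_im_pos γ hx, ext_coe]

theorem eventually_wfun_mobius (γ : SL(2, ℤ)) (z : ℍ) :
    ∀ᶠ x in 𝓝 (z : ℂ), ext wfun (mobius γ x) = ext wfun x := by
  filter_upwards [eventually_im_pos z] with x hx
  rw [ext_mobius _ _ hx, wfun_smul, ext_of_im_pos _ hx]

theorem deriv_wfun_smul (γ : SL(2, ℤ)) (z : ℍ) :
    deriv (ext wfun) (γ • z : ℍ) = denom (γ : GL (Fin 2) ℝ) z ^ 2 * deriv (ext wfun) z := by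
  have h : deriv (ext wfun ∘ mobius γ) z = deriv (ext wfun) z :=
    EventuallyEq.deriv_eq (eventually_wfun_mobius γ z)
  have hd : DifferentiableAt ℂ (ext wfun) (mobius γ z) := by
    rw [mobius_coe]
    exact (analyticAt_wfun _).differentiableAt
  rw [deriv_comp _ hd (analyticAt_mobius γ z).differentiableAt, deriv_mobius, mobius_coe] at h
  rw [← h]
  have h0 := denom_smul_ne_zero γ z
  field_simp

theorem differentiableOn_upperHalfPlaneSet {f : ℂ → ℂ} (h : ∀ z : ℍ, AnalyticAt ℂ f z) :
    DifferentiableOn ℂ f upperHalfPlaneSet :=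
  fun x hx => (h ⟨x, hx⟩).differentiableAt.differentiableWithinAt

/-- Differentiating Δ·w = E₄³/1728 gives Δw' = (E₄³)'/1728 - Δ'w. The first term tends to 0; in the
second the zero of Δ' in q cancels the pole of w. The limit supplies both boundedness at the cusp
and non-vanishing of the form Δw'. -/
theorem tendsto_disc_mul_deriv_wfun : ∃ L : ℂ, L ≠ 0 ∧
    Tendsto (fun z : ℍ => discForm z * deriv (ext wfun) z) atImInfty (𝓝 L) := by
  obtain ⟨κ, hκ, hκ0, h⟩ := exists_wfun_eq_div_qpar
  have hq := tendsto_qpar.mono_right nhdsWithin_le_nhds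
  have hπ : (2 * Real.pi * Complex.I : ℂ) ≠ 0 := by
    simp [Real.pi_ne_zero]
  have hd := analyticAt_cuspFun discForm (q := 0) (by simp)
  have t1 : Tendsto (fun z : ℍ => 3 * ModularForm.E₄ z ^ 2 * deriv (ext ModularForm.E₄) z / 1728)
      atImInfty (𝓝 0) := by
    have := ((((tendsto_modularForm ModularForm.E₄).pow 2).const_mul 3).mul
      (tendsto_deriv_modularForm ModularForm.E₄)).div_const 1728
    simpa using this
  have t2 : Tendsto (fun z : ℍ => 2 * Real.pi * Complex.I * (deriv (cuspFun discForm) (qpar z) *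
      κ (qpar z))) atImInfty (𝓝 (2 * Real.pi * Complex.I * (1 * κ 0))) := by
    rw [← cuspFun_discForm.2]
    exact ((hd.deriv.continuousAt.tendsto.comp hq).mul (hκ.continuousAt.tendsto.comp hq)).const_mul _
  refine ⟨0 - 2 * Real.pi * Complex.I * (1 * κ 0), ?_, (t1.sub t2).congr' ?_⟩
  · rw [zero_sub, one_mul]
    exact neg_ne_zero.2 (mul_ne_zero hπ hκ0)
  · filter_upwards [hq.eventually h] with z hz
    have e1 : (fun x => ext discForm x * ext wfun x) = fun x => ext ModularForm.E₄ x ^ 3 / 1728 := by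
      ext x
      rw [ext_wfun_eq]
      have := ext_discForm_ne_zero x
      field_simp
    have e2 := congrArg (fun φ => deriv φ (z : ℂ)) e1
    have hE := (analyticAt_ext ModularForm.E₄ z).differentiableAt
    simp only [deriv_div_const] at e2
    rw [deriv_fun_mul (analyticAt_ext discForm z).differentiableAt
      (analyticAt_wfun z).differentiableAt, deriv_fun_pow hE, deriv_ext_eq discForm z.im_pos,
      hz z z.im_pos rfl, ext_coe, ext_coe] at e2
    have hq0 := qpar_ne_zero z
    have e3 : 2 * Real.pi * Complex.I * (qpar z * deriv (cuspFun discForm) (qpar z)) *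
        (κ (qpar z) / qpar z) = 2 * Real.pi * Complex.I * (deriv (cuspFun discForm) (qpar z) *
      κ (qpar z)) := by
      field_simp
    rw [e3] at e2
    push_cast at e2
    linear_combination -e2

theorem disc_mul_deriv_wfun_slash (γ : SL(2, ℤ)) :
    SlashAction.map (14 : ℤ) γ (fun z : ℍ => discForm z * deriv (ext wfun) z) =
      fun z : ℍ => discForm z * deriv (ext wfun) z := by
  ext z
  have h0 := denom_smul_ne_zero γ z
  rw [ModularForm.SL_slash_apply, modularForm_smul, deriv_wfun_smul]
  change _ * denom (γ : GL (Fin 2) ℝ) z ^ (-14 : ℤ) = _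
  have e : denom (γ : GL (Fin 2) ℝ) z ^ (12 : ℤ) * denom (γ : GL (Fin 2) ℝ) z ^ 2 *
      denom (γ : GL (Fin 2) ℝ) z ^ (-14 : ℤ) = 1 := by
    rw [← zpow_natCast, ← zpow_add₀ h0, ← zpow_add₀ h0]
    norm_num
  linear_combination (discForm z * deriv (ext wfun) z) * e

/-- `Δ · w'`, a modular form of weight `14`. -/
def discDerivW : ModularForm 𝒮ℒ 14 where
  toFun z := discForm z * deriv (ext wfun) z
  slash_action_eq' := by
    rintro _ ⟨γ, rfl⟩
    exact disc_mul_deriv_wfun_slash γ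
  holo' := by
    rw [UpperHalfPlane.mdifferentiable_iff]
    have h := differentiableOn_upperHalfPlaneSet (f := fun x => ext discForm x * deriv (ext wfun) x)
      fun z => (analyticAt_ext discForm z).mul (analyticAt_wfun z).deriv
    refine h.congr fun x hx => ?_
    simp only [Function.comp, ext, ofComplex_apply_of_im_pos hx]
    rfl
  bdd_at_cusps' {c} hc := by
    -- Slash invariance reduces every cusp to ∞, where the function has a finite limit.
    rw [OnePoint.isBoundedAt_iff_forall_SL2Z hc]
    intro γ _
    obtain ⟨L, -, hL⟩ := tendsto_disc_mul_deriv_wfun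
    rw [disc_mul_deriv_wfun_slash]
    exact hL.isBigO_one ℝ

theorem discDerivW_apply (z : ℍ) : discDerivW z = discForm z * deriv (ext wfun) z := rfl

/-- The space of forms of weight 14 is one-dimensional, spanned by E₄²E₆, and Δw' lies in it. Hence
w' vanishes only at zeros of E₄ and E₆. -/
theorem exists_disc_mul_deriv_wfun_eq : ∃ c : ℂ, c ≠ 0 ∧ ∀ z : ℍ,
    discForm z * deriv (ext wfun) z = c * (ModularForm.E₄ z ^ 2 * ModularForm.E₆ z) := by
  let P : ModularForm 𝒮ℒ 14 := (ModularForm.E₄.mul ModularForm.E₄).mul ModularForm.E₆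
  have hP : ∀ z, P z = ModularForm.E₄ z ^ 2 * ModularForm.E₆ z := fun z => by
    rw [sq]; rfl
  have hlim : Tendsto P atImInfty (𝓝 1) := by
    have := ((tendsto_modularForm ModularForm.E₄).pow 2).mul (tendsto_modularForm ModularForm.E₆)
    rw [cuspFun_E₄_zero, cuspFun_E₆_zero, one_pow, one_mul] at this
    exact this.congr fun z => (hP z).symm
  have hP0 : P ≠ 0 := by
    intro h
    obtain ⟨z, hz⟩ := (hlim.eventually_ne one_ne_zero).exists
    exact hz (by rw [h]; rfl)
  have hr : Module.rank ℂ (ModularForm 𝒮ℒ ((14 : ℕ) : ℤ)) = 1 := by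
    rw [ModularForm.dimension_level_one 14 ⟨7, rfl⟩, if_pos (by decide)]
    norm_num
  obtain ⟨c, hc⟩ := (finrank_eq_one_iff_of_nonzero' P hP0).1
    (Module.rank_eq_one_iff_finrank_eq_one.1 hr) discDerivW
  have hcz : ∀ z : ℍ,
      discForm z * deriv (ext wfun) z = c * (ModularForm.E₄ z ^ 2 * ModularForm.E₆ z) := by
    intro z
    rw [← discDerivW_apply, ← hc, ← hP]
    rfl
  refine ⟨c, ?_, hcz⟩
  rintro rfl
  obtain ⟨L, hL, hL2⟩ := tendsto_disc_mul_deriv_wfun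
  obtain ⟨z, hz⟩ := (hL2.eventually_ne hL).exists
  exact hz (by rw [hcz, zero_mul])

theorem E₄_ne_zero' : ModularForm.E₄ ≠ 0 := by
  intro h
  obtain ⟨z, hz⟩ := E₄_ne.exists
  exact hz (by rw [h]; rfl)

theorem E₆_ne_zero' : ModularForm.E₆ ≠ 0 := by
  intro h
  have := tendsto_modularForm ModularForm.E₆
  rw [cuspFun_E₆_zero] at this
  obtain ⟨z, hz⟩ := (this.eventually_ne one_ne_zero).exists
  exact hz (by rw [h]; rfl)

theorem E₄_ne_zero_or_E₆_ne_zero (z : ℍ) : ModularForm.E₄ z ≠ 0 ∨ ModularForm.E₆ z ≠ 0 := by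
  by_contra! h
  have := E_sub_eq z
  rw [h.1, h.2] at this
  have := disc_ne_zero z
  simp_all

theorem analyticOrderAt_deriv_wfun (z : ℍ) : analyticOrderAt (deriv (ext wfun)) z =
    2 * analyticOrderAt (ext ModularForm.E₄) z + analyticOrderAt (ext ModularForm.E₆) z := by
  obtain ⟨c, hc0, hc⟩ := exists_disc_mul_deriv_wfun_eq
  have e : (ext discForm * deriv (ext wfun)) =ᶠ[𝓝 (z : ℂ)]
      ((fun _ => c) * (ext ModularForm.E₄ ^ 2 * ext ModularForm.E₆)) := by
    filter_upwards [eventually_im_pos z] with x hx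
    have := hc ⟨x, hx⟩
    simp only [Pi.mul_apply, Pi.pow_apply, ext_of_im_pos _ hx]
    exact this
  have h4 := analyticAt_ext ModularForm.E₄ z
  have h6 := analyticAt_ext ModularForm.E₆ z
  have hd := analyticAt_ext discForm z
  have := analyticOrderAt_congr e
  rw [analyticOrderAt_mul hd (analyticAt_wfun z).deriv,
    analyticOrderAt_mul analyticAt_const ((h4.pow 2).mul h6), analyticOrderAt_mul (h4.pow 2) h6,
    analyticOrderAt_pow h4, hd.analyticOrderAt_eq_zero.2 (ext_discForm_ne_zero _),
    AnalyticAt.analyticOrderAt_eq_zero (f := fun _ => c) analyticAt_const |>.2 hc0] at this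
  simpa using this

theorem wfun_order_one {z : ℍ} (h4 : ModularForm.E₄ z ≠ 0) (h6 : ModularForm.E₆ z ≠ 0) :
    deriv (ext wfun) z ≠ 0 := by
  obtain ⟨c, hc0, hc⟩ := exists_disc_mul_deriv_wfun_eq
  intro h
  have := hc z
  rw [h, mul_zero, eq_comm, mul_eq_zero, mul_eq_zero] at this
  simp_all

/-- If E₄ vanishes to order a, then w has order 3a and w' has order 2a, so 2a + 1 = 3a and a = 1.
Simplicity of the zero thus comes out of the formula for w'. -/
theorem analyticOrderAt_wfun_of_E₄_eq_zero {z : ℍ} (h4 : ModularForm.E₄ z = 0) :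
    analyticOrderAt (fun x => ext wfun x - wfun z) z = (3 : ℕ) := by
  have h6 : ModularForm.E₆ z ≠ 0 := (E₄_ne_zero_or_E₆_ne_zero z).resolve_left (not_not.2 h4)
  have hE := analyticAt_ext ModularForm.E₄ z
  have hd := analyticAt_ext discForm z
  have h1 := (analyticAt_wfun z).analyticOrderAt_deriv_add_one
  rw [analyticOrderAt_deriv_wfun, (analyticAt_ext ModularForm.E₆ z).analyticOrderAt_eq_zero.2
    (by rwa [ext_coe]), ext_coe] at h1
  have hw0 : wfun z = 0 := by rw [wfun_eq, h4]; simp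
  have h2 : (fun x => ext wfun x - wfun z) = ext ModularForm.E₄ ^ 3 * fun x => (1728 * ext discForm x)⁻¹ := by
    ext x
    rw [hw0, sub_zero, ext_wfun_eq]
    rfl
  have hd0 : (1728 * ext discForm (z : ℂ)) ≠ 0 :=
    mul_ne_zero (by norm_num) (ext_discForm_ne_zero _)
  have hu : AnalyticAt ℂ (fun x => (1728 * ext discForm x)⁻¹) (z : ℂ) :=
    (analyticAt_const.mul hd).inv hd0
  have h3 : analyticOrderAt _ (z : ℂ) = analyticOrderAt _ (z : ℂ) := congrArg (analyticOrderAt · (z : ℂ)) h2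
  rw [analyticOrderAt_mul (hE.pow 3) hu, analyticOrderAt_pow hE,
    hu.analyticOrderAt_eq_zero.2 (inv_ne_zero hd0)] at h3
  have ht := analyticOrderAt_modularForm_ne_top E₄_ne_zero' z
  rw [h3] at h1 ⊢
  obtain ⟨a, ha⟩ := ENat.ne_top_iff_exists.1 ht
  rw [← ha] at h1 ⊢
  rw [nsmul_eq_mul] at h1 ⊢
  norm_cast at h1 ⊢
  omega

/-- The same comparison for w - 1: with a the order of E₆, a + 1 = 2a. -/
theorem analyticOrderAt_wfun_of_E₆_eq_zero {z : ℍ} (h6 : ModularForm.E₆ z = 0) :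
    analyticOrderAt (fun x => ext wfun x - wfun z) z = (2 : ℕ) := by
  have h4 : ModularForm.E₄ z ≠ 0 := (E₄_ne_zero_or_E₆_ne_zero z).resolve_right (not_not.2 h6)
  have hE := analyticAt_ext ModularForm.E₆ z
  have hd := analyticAt_ext discForm z
  have h1 := (analyticAt_wfun z).analyticOrderAt_deriv_add_one
  rw [analyticOrderAt_deriv_wfun, (analyticAt_ext ModularForm.E₄ z).analyticOrderAt_eq_zero.2
    (by rwa [ext_coe]), ext_coe] at h1
  have hw0 : wfun z = 1 := by rw [← sub_eq_zero, wfun_sub_one_eq, h6]; simp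
  have h2 : (fun x => ext wfun x - wfun z) = ext ModularForm.E₆ ^ 2 * fun x => (1728 * ext discForm x)⁻¹ := by
    ext x
    rw [hw0, ext_wfun_sub_one_eq]
    rfl
  have hd0 : (1728 * ext discForm (z : ℂ)) ≠ 0 :=
    mul_ne_zero (by norm_num) (ext_discForm_ne_zero _)
  have hu : AnalyticAt ℂ (fun x => (1728 * ext discForm x)⁻¹) (z : ℂ) :=
    (analyticAt_const.mul hd).inv hd0
  have h3 : analyticOrderAt _ (z : ℂ) = analyticOrderAt _ (z : ℂ) := congrArg (analyticOrderAt · (z : ℂ)) h2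
  rw [analyticOrderAt_mul (hE.pow 2) hu, analyticOrderAt_pow hE,
    hu.analyticOrderAt_eq_zero.2 (inv_ne_zero hd0)] at h3
  have ht := analyticOrderAt_modularForm_ne_top E₆_ne_zero' z
  rw [h3] at h1 ⊢
  obtain ⟨a, ha⟩ := ENat.ne_top_iff_exists.1 ht
  rw [← ha] at h1 ⊢
  rw [nsmul_eq_mul] at h1 ⊢
  norm_cast at h1 ⊢
  omega

/-- The transformation law at the fixed point i of S reads E₆(i) = i⁶ E₆(i) = -E₆(i). -/
theorem E₆_I : ModularForm.E₆ I = 0 := by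
  have h := modularForm_smul ModularForm.E₆ ModularGroup.S I
  have h1 : ModularGroup.S • I = I := ModularGroup.stabilizer_I.2 (by simp)
  rw [h1, denom_eq] at h
  simp only [ModularGroup.S, Matrix.of_apply, Matrix.cons_val', Matrix.cons_val_zero,
    Matrix.cons_val_one, Matrix.cons_val_fin_one, Int.cast_one, Int.cast_zero, one_mul, add_zero,
    coe_I] at h
  have e : (Complex.I : ℂ) ^ (6 : ℤ) = -1 := by
    rw [zpow_ofNat, show 6 = 2 * 3 from rfl, pow_mul, Complex.I_sq]
    norm_num
  rw [e] at h
  linear_combination h / 2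

theorem rho_sq : (rho : ℂ) ^ 2 = -1 - rho := by
  have h3 : ((Real.sqrt 3 : ℝ) : ℂ) ^ 2 = 3 := by
    rw [← Complex.ofReal_pow, Real.sq_sqrt (by norm_num)]
    norm_num
  have e : (rho : ℂ) = -1 / 2 + (Real.sqrt 3 / 2 : ℝ) * Complex.I := by
    apply Complex.ext <;> simp [rho]
  rw [e]
  push_cast
  linear_combination (-1/4 : ℂ) * h3 + (Real.sqrt 3 / 2 : ℂ)^2 * Complex.I_sq

/-- The generator `z ↦ -1 / (z + 1)` of the stabilizer of `ρ`. -/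
def elliptic₃ : SL(2, ℤ) := ⟨!![0, -1; 1, 1], by simp⟩

theorem rho_add_one_ne_zero : (rho : ℂ) + 1 ≠ 0 := by
  intro h
  have := rho_sq
  rw [eq_neg_of_add_eq_zero_left h] at this
  norm_num at this

theorem denom_elliptic₃ (x : ℂ) : denom (elliptic₃ : GL (Fin 2) ℝ) x = x + 1 := by
  rw [denom_eq]
  simp [elliptic₃]

theorem elliptic₃_smul_rho : elliptic₃ • rho = rho := by
  ext
  rw [← mobius_coe, mobius]
  simp only [elliptic₃, Matrix.of_apply, Matrix.cons_val', Matrix.cons_val_zero,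
    Matrix.cons_val_one, Matrix.cons_val_fin_one, Int.cast_one, Int.cast_zero, one_mul, zero_mul,
    zero_add, Int.cast_neg]
  rw [div_eq_iff rho_add_one_ne_zero]
  linear_combination -rho_sq

/-- The law at a fixed point again, now with the automorphy factor (ρ + 1)⁴ = -1 - ρ ≠ 1. -/
theorem E₄_rho : ModularForm.E₄ rho = 0 := by
  have h := modularForm_smul ModularForm.E₄ elliptic₃ rho
  rw [elliptic₃_smul_rho, denom_elliptic₃] at h
  have h2 := rho_sq
  have e : ((rho : ℂ) + 1) ^ (4 : ℤ) = -1 - rho := by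
    rw [zpow_ofNat]
    linear_combination ((rho : ℂ)^2 + 3 * rho + 2) * h2
  rw [e] at h
  have h3 : (rho : ℂ) + 2 ≠ 0 := by
    intro h
    rw [eq_neg_of_add_eq_zero_left h] at h2
    norm_num at h2
  have : ((rho : ℂ) + 2) * ModularForm.E₄ rho = 0 := by linear_combination h
  exact (mul_eq_zero.1 this).resolve_left h3

theorem wfun_I : wfun I = 1 := by
  rw [← sub_eq_zero, wfun_sub_one_eq, E₆_I]
  simp

theorem wfun_rho : wfun rho = 0 := by
  rw [wfun_eq, E₄_rho]
  simp

theorem E₄_eq_zero_iff (z : ℍ) : ModularForm.E₄ z = 0 ↔ wfun z = 0 := by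
  rw [wfun_eq]
  simp [discForm_ne_zero]

theorem E₆_eq_zero_iff (z : ℍ) : ModularForm.E₆ z = 0 ↔ wfun z = 1 := by
  rw [← sub_eq_zero (a := wfun z), wfun_sub_one_eq]
  simp [discForm_ne_zero]


/-! ### w is a bijection from the orbits of the modular group onto ℂ. -/

theorem exists_analyticOrderAt_wfun (z : ℍ) : ∃ e : ℕ, 0 < e ∧
    analyticOrderAt (fun x => ext wfun x - wfun z) z = e := by
  by_cases h4 : ModularForm.E₄ z = 0
  · exact ⟨3, by norm_num, analyticOrderAt_wfun_of_E₄_eq_zero h4⟩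
  by_cases h6 : ModularForm.E₆ z = 0
  · exact ⟨2, by norm_num, analyticOrderAt_wfun_of_E₆_eq_zero h6⟩
  refine ⟨1, one_pos, ?_⟩
  have h := (analyticAt_wfun z).analyticOrderAt_deriv_add_one
  rw [(analyticAt_wfun z).deriv.analyticOrderAt_eq_zero.2 (wfun_order_one h4 h6), ext_coe] at h
  rw [← h]
  rfl

theorem map_coe_nhds (z : ℍ) : map ((↑) : ℍ → ℂ) (𝓝 z) = 𝓝 (z : ℂ) :=
  isOpenEmbedding_coe.map_nhds_eq z

theorem continuous_wfun : Continuous wfun := by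
  rw [continuous_iff_continuousAt]
  intro z
  have h := (analyticAt_wfun z).continuousAt.tendsto.comp (continuous_coe.tendsto z)
  rw [ext_coe] at h
  exact h.congr fun x => ext_coe _ _

theorem nhds_le_map_ext_wfun (z : ℍ) : 𝓝 (wfun z) ≤ map (ext wfun) (𝓝 (z : ℂ)) := by
  have h := (analyticAt_wfun z).eventually_constant_or_nhds_le_map_nhds
  rw [ext_coe] at h
  refine h.resolve_left fun h => ?_
  obtain ⟨e, -, he⟩ := exists_analyticOrderAt_wfun z
  have : analyticOrderAt (fun x => ext wfun x - wfun z) z = ⊤ := by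
    rw [analyticOrderAt_eq_top]
    filter_upwards [h] with x hx
    rw [hx, sub_self]
  rw [he] at this
  exact ENat.natCast_ne_top _ this

theorem isOpenMap_wfun : IsOpenMap wfun := by
  rw [isOpenMap_iff_nhds_le]
  intro z
  have h := nhds_le_map_ext_wfun z
  rw [← map_coe_nhds, Filter.map_map] at h
  have e : ext wfun ∘ ((↑) : ℍ → ℂ) = wfun := funext fun x => ext_coe _ _
  rwa [e] at h

theorem exists_im_le_of_norm_wfun_le (R : ℝ) : ∃ Y : ℝ, ∀ z : ℍ, ‖wfun z‖ ≤ R → z.im ≤ Y := by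
  obtain ⟨Y, hY⟩ := (atImInfty_mem _).1 (tendsto_wfun.eventually_gt_atTop R)
  refine ⟨Y, fun z hz => ?_⟩
  by_contra! h
  exact absurd hz (not_le.2 (hY z h.le))

theorem exists_lt_im_of_lt_norm_wfun (Y : ℝ) : ∃ R : ℝ, ∀ z ∈ ModularGroup.fd,
    R < ‖wfun z‖ → Y < z.im := by
  obtain ⟨R, hR⟩ := ((ModularGroup.isCompact_truncatedFundamentalDomain Y).image
    continuous_wfun).isBounded.exists_norm_le
  refine ⟨R, fun z hz h => ?_⟩
  by_contra! h2
  exact absurd (hR _ ⟨z, ⟨hz, h2⟩, rfl⟩) (not_le.2 h)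

theorem exists_fd_wfun_eq (z : ℍ) : ∃ γ : SL(2, ℤ), γ • z ∈ ModularGroup.fd ∧
    wfun (γ • z) = wfun z :=
  (ModularGroup.exists_smul_mem_fd z).imp fun γ h => ⟨h, wfun_smul γ z⟩

/-- A bound on w bounds the height, and the fundamental domain cut off at a height is compact. This
is the properness of w on the orbit space. -/
theorem exists_subseq_of_tendsto_wfun {s : ℕ → ℍ} (hs : ∀ n, s n ∈ ModularGroup.fd) {c : ℂ}
    (h : Tendsto (fun n => wfun (s n)) atTop (𝓝 c)) :
    ∃ (z : ℍ) (φ : ℕ → ℕ), StrictMono φ ∧ Tendsto (s ∘ φ) atTop (𝓝 z) ∧ wfun z = c := by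
  obtain ⟨R, hR⟩ := (Metric.isBounded_range_of_tendsto _ h).exists_norm_le
  obtain ⟨Y, hY⟩ := exists_im_le_of_norm_wfun_le R
  obtain ⟨z, -, φ, hφ, hz⟩ := (ModularGroup.isCompact_truncatedFundamentalDomain Y).tendsto_subseq
    fun n => ⟨hs n, hY _ (hR _ ⟨n, rfl⟩)⟩
  exact ⟨z, φ, hφ, hz, tendsto_nhds_unique ((continuous_wfun.tendsto z).comp hz)
    (h.comp hφ.tendsto_atTop)⟩

/-- The range is open by the open mapping theorem, closed by properness, and ℂ is connected. -/
theorem wfun_surjective : Function.Surjective wfun := by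
  have hc : IsClosed (Set.range wfun) := by
    refine IsSeqClosed.isClosed fun x c hx hc => ?_
    choose z hz using hx
    choose γ hγ hw using fun n => exists_fd_wfun_eq (z n)
    obtain ⟨z', -, -, -, h⟩ := exists_subseq_of_tendsto_wfun hγ (c := c)
      (by simpa only [hw, hz] using hc)
    exact ⟨z', h⟩
  have ho : IsOpen (Set.range wfun) := isOpenMap_wfun.isOpen_range
  exact Set.range_eq_univ.1 (IsClopen.eq_univ ⟨hc, ho⟩ ⟨_, ⟨I, rfl⟩⟩)

/-- Equivalence of points under the modular group. -/
def Equivalent (a b : ℍ) : Prop := ∃ γ : SL(2, ℤ), b = γ • a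

theorem Equivalent.symm {a b : ℍ} (h : Equivalent a b) : Equivalent b a := by
  obtain ⟨γ, rfl⟩ := h
  exact ⟨γ⁻¹, by simp⟩

theorem Equivalent.trans {a b c : ℍ} (h : Equivalent a b) (h' : Equivalent b c) :
    Equivalent a c := by
  obtain ⟨γ, rfl⟩ := h
  obtain ⟨δ, rfl⟩ := h'
  exact ⟨δ * γ, by simp [mul_smul]⟩

theorem Equivalent.wfun_eq {a b : ℍ} (h : Equivalent a b) : wfun b = wfun a := by
  obtain ⟨γ, rfl⟩ := h
  exact wfun_smul γ a

/-- The action is properly discontinuous, so the orbit space is Hausdorff. -/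
theorem exists_nhds_not_equivalent {a b : ℍ} (h : ¬ Equivalent a b) :
    ∃ A ∈ 𝓝 a, ∃ B ∈ 𝓝 b, ∀ x ∈ A, ∀ y ∈ B, ¬ Equivalent x y := by
  have : T2Space (Quotient (MulAction.orbitRel 𝒮ℒ ℍ)) :=
    t2Space_of_properlyDiscontinuousSMul_of_t2Space
  let π : ℍ → Quotient (MulAction.orbitRel 𝒮ℒ ℍ) := Quotient.mk (MulAction.orbitRel 𝒮ℒ ℍ)
  have hπ : Continuous π := continuous_quot_mk
  have key : ∀ x y : ℍ, π x = π y ↔ Equivalent x y := by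
    intro x y
    constructor
    · intro hxy
      obtain ⟨⟨-, γ, rfl⟩, hγ⟩ := MulAction.orbitRel_apply.1 (Quotient.exact (s := MulAction.orbitRel 𝒮ℒ ℍ) hxy.symm)
      exact ⟨γ, hγ.symm⟩
    · rintro ⟨γ, rfl⟩
      exact Quotient.sound (s := MulAction.orbitRel 𝒮ℒ ℍ) ((MulAction.orbitRel 𝒮ℒ ℍ).symm'
        (MulAction.orbitRel_apply.2 ⟨⟨_, γ, rfl⟩, rfl⟩))
  obtain ⟨A, B, hA, hB, ha, hb, hAB⟩ := t2_separation (mt (key a b).1 h)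
  exact ⟨_, hπ.continuousAt (hA.mem_nhds ha), _, hπ.continuousAt (hB.mem_nhds hb),
    fun x hx y hy hxy => hAB.ne_of_mem hx hy ((key x y).2 hxy)⟩

/-- Values taken by `w` at two inequivalent points. -/
def badValues : Set ℂ := {c | ∃ a b : ℍ, wfun a = c ∧ wfun b = c ∧ ¬ Equivalent a b}

theorem isOpen_badValues : IsOpen badValues := by
  rw [isOpen_iff_mem_nhds]
  rintro _ ⟨a, b, rfl, hb, hab⟩
  obtain ⟨A, hA, B, hB, h⟩ := exists_nhds_not_equivalent hab
  have h1 := isOpenMap_wfun.image_mem_nhds hA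
  have h2 := isOpenMap_wfun.image_mem_nhds hB
  rw [hb] at h2
  filter_upwards [h1, h2]
  rintro _ ⟨x, hx, rfl⟩ ⟨y, hy, hxy⟩
  exact ⟨x, y, rfl, hxy, h x hx y hy⟩

theorem exists_injOn_of_deriv_ne_zero {f : ℂ → ℂ} {z : ℂ} (hf : AnalyticAt ℂ f z)
    (h : deriv f z ≠ 0) : ∃ A ∈ 𝓝 z, Set.InjOn f A := by
  have hs := hf.hasStrictDerivAt.hasStrictFDerivAt_equiv h
  refine ⟨_, hs.eventually_left_inverse, fun x hx y hy hxy => ?_⟩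
  rw [← hx, ← hy, hxy]

theorem exists_injOn_wfun {z : ℍ} (h : deriv (ext wfun) z ≠ 0) :
    ∃ A ∈ 𝓝 z, Set.InjOn wfun A := by
  obtain ⟨A, hA, hi⟩ := exists_injOn_of_deriv_ne_zero (analyticAt_wfun z) h
  refine ⟨_, continuous_coe.continuousAt hA, fun x hx y hy hxy => ?_⟩
  exact UpperHalfPlane.ext (hi hx hy (by rw [ext_coe, ext_coe, hxy]))

theorem continuous_smul_upperHalfPlane (γ : SL(2, ℤ)) : Continuous fun z : ℍ => γ • z :=
  continuous_const_smul (γ : GL (Fin 2) ℝ)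

/-- Representatives in the fundamental domain converge along a subsequence. If the two limits were
equivalent, both sequences could be moved close to one point, where w is injective because its value
is neither 0 nor 1; the pairs would then be equivalent. -/
theorem mem_badValues_of_tendsto {x : ℕ → ℂ} (hx : ∀ n, x n ∈ badValues) {c : ℂ}
    (hc : Tendsto x atTop (𝓝 c)) (h0 : c ≠ 0) (h1 : c ≠ 1) : c ∈ badValues := by
  choose a' b' ha' hb' hab' using hx
  choose γ hγ hγw using fun n => exists_fd_wfun_eq (a' n)
  choose δ hδ hδw using fun n => exists_fd_wfun_eq (b' n)
  have hab : ∀ n, ¬ Equivalent (γ n • a' n) (δ n • b' n) := fun n h =>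
    hab' n ((Equivalent.trans ⟨γ n, rfl⟩ h).trans ⟨(δ n)⁻¹, by simp⟩)
  obtain ⟨z, φ, hφ, hz, hzc⟩ := exists_subseq_of_tendsto_wfun hγ (c := c)
    (by simpa only [hγw, ha'] using hc)
  obtain ⟨y, ψ, hψ, hy, hyc⟩ := exists_subseq_of_tendsto_wfun (s := fun n => δ (φ n) • b' (φ n))
    (fun n => hδ _) (c := c) (by simp only [hδw, hb']; exact hc.comp hφ.tendsto_atTop)
  refine ⟨z, y, hzc, hyc, fun ⟨σ, hσ⟩ => ?_⟩
  have hd : deriv (ext wfun) z ≠ 0 := wfun_order_one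
    (by rw [Ne, E₄_eq_zero_iff, hzc]; exact h0) (by rw [Ne, E₆_eq_zero_iff, hzc]; exact h1)
  obtain ⟨A, hA, hinj⟩ := exists_injOn_wfun hd
  have t1 : Tendsto (fun n => γ (φ (ψ n)) • a' (φ (ψ n))) atTop (𝓝 z) := hz.comp hψ.tendsto_atTop
  have t2 : Tendsto (fun n => σ⁻¹ • (δ (φ (ψ n)) • b' (φ (ψ n)))) atTop (𝓝 z) := by
    have : z = σ⁻¹ • y := by rw [hσ]; simp
    rw [this]
    exact ((continuous_smul_upperHalfPlane σ⁻¹).tendsto y).comp hy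
  obtain ⟨n, hn1, hn2⟩ := ((t1.eventually hA).and (t2.eventually hA)).exists
  refine hab (φ (ψ n)) ⟨σ, ?_⟩
  have := hinj hn1 hn2 (by rw [wfun_smul σ⁻¹, hγw, hδw, ha', hb'])
  rw [this, smul_inv_smul]

/-- Near the cusp 1/w = q/κ(q) is injective in q, so w determines q, and q determines z up to an
integer translation. -/
theorem exists_norm_le_of_mem_badValues : ∃ R : ℝ, ∀ c ∈ badValues, ‖c‖ ≤ R := by
  obtain ⟨κ, hκ, hκ0, h⟩ := exists_wfun_eq_div_qpar
  have ha : AnalyticAt ℂ (fun q => q / κ q) 0 := analyticAt_id.div hκ hκ0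
  have hd : deriv (fun q => q / κ q) 0 ≠ 0 := by
    have := (hasDerivAt_id (0 : ℂ)).div hκ.differentiableAt.hasDerivAt hκ0
    have e : deriv (fun q => q / κ q) 0 = _ := this.deriv
    rw [e]
    simp [hκ0]
  obtain ⟨A, hA, hinj⟩ : ∃ A ∈ 𝓝 (0 : ℂ), Set.InjOn (fun q => q / κ q) A :=
    exists_injOn_of_deriv_ne_zero ha hd
  have ht := (tendsto_qpar.mono_right nhdsWithin_le_nhds).eventually
    (h.and ((hκ.continuousAt.eventually_ne hκ0).and hA))
  obtain ⟨Y, hY⟩ := (atImInfty_mem _).1 ht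
  obtain ⟨R, hR⟩ := exists_lt_im_of_lt_norm_wfun Y
  refine ⟨R, ?_⟩
  rintro c ⟨a', b', ha', hb', hab⟩
  by_contra! hc
  obtain ⟨γ, hγ, hγw⟩ := exists_fd_wfun_eq a'
  obtain ⟨δ, hδ, hδw⟩ := exists_fd_wfun_eq b'
  obtain ⟨h1, h2, h3⟩ := hY _ (hR _ hγ (by rwa [hγw, ha'])).le
  obtain ⟨k1, k2, k3⟩ := hY _ (hR _ hδ (by rwa [hδw, hb'])).le
  have e1 := h1 _ (γ • a').im_pos rfl
  have e2 := k1 _ (δ • b').im_pos rfl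
  rw [ext_coe, hγw, ha'] at e1
  rw [ext_coe, hδw, hb'] at e2
  have e3 := hinj h3 k3 (by
    rw [e1] at e2
    have := congrArg (·⁻¹) e2
    simpa [inv_div] using this)
  obtain ⟨n, hn⟩ : ∃ n : ℤ, ((γ • a' : ℍ) : ℂ) = (δ • b' : ℍ) + n := by
    simp only [qpar, Function.Periodic.qParam] at e3
    obtain ⟨n, hn⟩ := Complex.exp_eq_exp_iff_exists_int.1 e3
    refine ⟨n, ?_⟩
    have hπ : (2 * Real.pi * Complex.I : ℂ) ≠ 0 := by
      simp [Real.pi_ne_zero]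
    apply mul_left_cancel₀ hπ
    simp only [Complex.ofReal_one, div_one] at hn
    rw [hn]
    ring
  refine hab ((Equivalent.trans ⟨γ, rfl⟩ ?_).trans ⟨δ⁻¹, (inv_smul_smul _ _).symm⟩)
  refine Equivalent.symm ⟨ModularGroup.T ^ n, ?_⟩
  ext
  rw [ModularGroup.coe_T_zpow_smul_eq, hn]

/-- Within the connected set ℂ ∖ {0, 1} the bad values are open, closed and bounded, hence absent.
An open subset of {0, 1} is empty. -/
theorem badValues_eq_empty : badValues = ∅ := by
  obtain ⟨R, hR⟩ := exists_norm_le_of_mem_badValues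
  have hcount : ({0, 1} : Set ℂ).Countable := (Set.toFinite _).countable
  have hconn : IsConnected ({0, 1}ᶜ : Set ℂ) :=
    (hcount.isPathConnected_compl_of_one_lt_rank (by simp [Complex.rank_real_complex])).isConnected
  have hsub : badValues ⊆ {0, 1} := by
    by_contra hsub
    obtain ⟨c, hc, hc'⟩ := Set.not_subset.1 hsub
    have hall := hconn.isPreconnected.subset_of_closure_inter_subset isOpen_badValues ⟨c, hc', hc⟩
      (by
        rintro x ⟨hx, hx'⟩
        obtain ⟨s, hs, hsx⟩ := mem_closure_iff_seq_limit.1 hx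
        simp only [Set.mem_compl_iff, Set.mem_insert_iff, Set.mem_singleton_iff, not_or] at hx'
        exact mem_badValues_of_tendsto hs hsx hx'.1 hx'.2)
    have h2 := hR ((|R| + 2 : ℝ) : ℂ) (hall ?_)
    · rw [Complex.norm_real, Real.norm_eq_abs] at h2
      have := le_abs_self (|R| + 2)
      have := le_abs_self R
      linarith
    · have h0 := abs_nonneg R
      simp only [Set.mem_compl_iff, Set.mem_insert_iff, Set.mem_singleton_iff, not_or]
      constructor
      · norm_cast
        linarith
      · norm_cast
        linarith
  by_contra hne
  obtain ⟨c, hc⟩ := Set.nonempty_iff_ne_empty.2 hne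
  have := isOpen_badValues.mem_nhds hc
  have h2 : (𝓝[≠] c).NeBot := inferInstance
  have hinf : badValues.Infinite := infinite_of_mem_nhds c this
  exact hinf ((Set.toFinite _).subset hsub)

/-- `w` separates the orbits of the modular group. -/
theorem wfun_eq_wfun_iff {a b : ℍ} : wfun b = wfun a ↔ Equivalent a b := by
  refine ⟨fun h => ?_, Equivalent.wfun_eq⟩
  by_contra hab
  have : wfun a ∈ badValues := ⟨a, b, rfl, h, hab⟩
  rwa [badValues_eq_empty] at this


/-! ### Adapted bases and leading terms of jet determinants. -/

/-- Echelon form for the functionals `c m`, which play the role of Taylor coefficients: take the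
least m on which `U` does not vanish, choose a vector there, and continue in the kernel of `c m`,
whose dimension is one less. -/
theorem exists_adapted_basis_of_submodule {V : Type*} [AddCommGroup V] [Module ℂ V]
    (c : ℕ → V →ₗ[ℂ] ℂ) (hc : ∀ v : V, (∀ m, c m v = 0) → v = 0) (d N : ℕ)
    (U : Submodule ℂ V) [FiniteDimensional ℂ U] (hU : Module.finrank ℂ U = d)
    (hN : ∀ v ∈ U, ∀ m < N, c m v = 0) :
    ∃ (v : Fin d → V) (n : Fin d → ℕ), LinearIndependent ℂ v ∧ StrictMono n ∧ (∀ j, N ≤ n j) ∧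
      (∀ j, v j ∈ U) ∧ ∀ j, (∀ m < n j, c m (v j) = 0) ∧ c (n j) (v j) ≠ 0 := by
  induction d generalizing N U with
  | zero => exact ⟨Fin.elim0, Fin.elim0, linearIndependent_empty_type, fun a => a.elim0,
      fun a => a.elim0, fun a => a.elim0, fun a => a.elim0⟩
  | succ d ih =>
    classical
    have hex : ∃ m, ∃ v ∈ U, c m v ≠ 0 := by
      by_contra! h
      have : U = ⊥ := (Submodule.eq_bot_iff _).2 fun v hv => hc v fun m => h m v hv
      rw [this, finrank_bot] at hU
      omega
    set a := Nat.find hex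
    obtain ⟨u₀, hu₀, hu₀a⟩ : ∃ v ∈ U, c a v ≠ 0 := Nat.find_spec hex
    have hmin : ∀ v ∈ U, ∀ m < a, c m v = 0 := by
      intro v hv m hm
      by_contra h
      exact Nat.find_min hex hm ⟨v, hv, h⟩
    have hNa : N ≤ a := by
      by_contra! h
      exact hu₀a (hN u₀ hu₀ a h)
    let φ : U →ₗ[ℂ] ℂ := c a ∘ₗ U.subtype
    have hφ : Module.finrank ℂ (LinearMap.ker φ) = d := by
      have h1 := LinearMap.finrank_range_add_finrank_ker φ
      have h2 : LinearMap.range φ = ⊤ := by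
        refine LinearMap.range_eq_top.2 fun y => ⟨(y / c a u₀) • ⟨u₀, hu₀⟩, ?_⟩
        change c a ((y / c a u₀) • u₀) = y
        rw [map_smul, smul_eq_mul, div_mul_cancel₀ _ hu₀a]
      rw [h2, finrank_top, Module.finrank_self] at h1
      omega
    let U' : Submodule ℂ V := (LinearMap.ker φ).map U.subtype
    have hU' : Module.finrank ℂ U' = d := by
      rw [← hφ]
      exact ((Submodule.equivMapOfInjective U.subtype (Submodule.subtype_injective U) _).finrank_eq).symm
    have hmem : ∀ v ∈ U', v ∈ U ∧ c a v = 0 := by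
      rintro _ ⟨x, hx, rfl⟩
      exact ⟨x.2, hx⟩
    obtain ⟨v, n, hv, hn, hna, hvU, hvn⟩ := ih (a + 1) U' hU' (by
      intro v hv m hm
      rcases (Nat.lt_succ_iff_lt_or_eq.1 hm) with h | rfl
      · exact hmin v (hmem v hv).1 m h
      · exact (hmem v hv).2)
    refine ⟨Fin.cons u₀ v, Fin.cons a n, ?_, ?_, ?_, ?_, ?_⟩
    · rw [linearIndependent_finCons]
      refine ⟨hv, fun h => hu₀a ?_⟩
      exact (hmem u₀ ((Submodule.span_le.2 (by rintro _ ⟨j, rfl⟩; exact hvU j)) h)).2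
    · intro i j hij
      cases j using Fin.cases with
      | zero => exact absurd hij (Fin.not_lt_zero i)
      | succ j =>
        cases i using Fin.cases with
        | zero => exact hna j
        | succ i => exact hn (Fin.succ_lt_succ_iff.1 hij)
    · intro j
      cases j using Fin.cases with
      | zero => exact hNa
      | succ j => exact hNa.trans ((Nat.le_succ a).trans (hna j))
    · intro j
      cases j using Fin.cases with
      | zero => exact hu₀
      | succ j => exact (hmem _ (hvU j)).1
    · intro j
      cases j using Fin.cases with
      | zero => exact ⟨hmin u₀ hu₀, hu₀a⟩
      | succ j => exact hvn j

/-- A triple of linearly independent germs of holomorphic functions has a basis with distinct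
orders of vanishing. -/
theorem exists_adapted_basis {F : Fin 3 → ℂ → ℂ} {z₀ : ℂ} (hF : ∀ j, AnalyticAt ℂ (F j) z₀)
    (hlin : ∀ a : Fin 3 → ℂ, (∀ᶠ z in 𝓝 z₀, ∑ i, a i * F i z = 0) → a = 0) :
    ∃ (M : Matrix (Fin 3) (Fin 3) ℂ) (n : Fin 3 → ℕ), M.det ≠ 0 ∧ StrictMono n ∧
      ∀ j, analyticOrderAt (fun z => ∑ i, M j i * F i z) z₀ = n j := by
  let c : ℕ → (Fin 3 → ℂ) →ₗ[ℂ] ℂ := fun m =>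
    ∑ i, (iteratedDeriv m (F i) z₀) • LinearMap.proj i
  have hc : ∀ m (a : Fin 3 → ℂ), c m a = iteratedDeriv m (fun z => ∑ i, a i * F i z) z₀ := by
    intro m a
    rw [iteratedDeriv_fun_sum (f := fun i z => a i * F i z)
      fun i _ => (analyticAt_const.mul (hF i)).contDiffAt]
    simp only [c, LinearMap.coe_sum, LinearMap.coe_smul, Finset.sum_apply, Pi.smul_apply,
      LinearMap.proj_apply, smul_eq_mul, iteratedDeriv_const_mul_field]
    exact Finset.sum_congr rfl fun _ _ => mul_comm _ _
  have hA : ∀ a : Fin 3 → ℂ, AnalyticAt ℂ (fun z => ∑ i, a i * F i z) z₀ := fun a =>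
    Finset.analyticAt_fun_sum _ fun i _ => analyticAt_const.mul (hF i)
  obtain ⟨v, n, hv, hn, -, -, hvn⟩ := exists_adapted_basis_of_submodule c (by
    intro a ha
    refine hlin a ?_
    rw [← analyticOrderAt_eq_top (f := fun z => ∑ i, a i * F i z), ENat.eq_top_iff_forall_ge]
    intro m
    rw [natCast_le_analyticOrderAt_iff_iteratedDeriv_eq_zero (hA a)]
    intro i _
    rw [← hc]
    exact ha i) 3 0 ⊤ (by simp) (fun _ _ m hm => absurd hm (Nat.not_lt_zero m))
  refine ⟨Matrix.of v, n, ?_, hn, fun j => ?_⟩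
  · have := Matrix.linearIndependent_rows_iff_isUnit (A := Matrix.of v)
    exact ((Matrix.isUnit_iff_isUnit_det _).1 (this.1 hv)).ne_zero
  · obtain ⟨h1, h2⟩ := hvn j
    refine le_antisymm ?_ ?_
    · by_contra! h
      have h3 : ((n j + 1 : ℕ) : ℕ∞) ≤ analyticOrderAt (fun z => ∑ i, v j i * F i z) z₀ := by
        push_cast
        exact Order.add_one_le_of_lt h
      rw [natCast_le_analyticOrderAt_iff_iteratedDeriv_eq_zero (hA _)] at h3
      exact h2 ((hc _ _).trans (h3 _ (Nat.lt_succ_self _)))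
    · change _ ≤ analyticOrderAt (fun z => ∑ i, v j i * F i z) z₀
      rw [natCast_le_analyticOrderAt_iff_iteratedDeriv_eq_zero (hA _)]
      intro i hi
      rw [← hc]
      exact h1 i hi

/-- Expansions of the jets `J i 0, J i 1, …` of three functions along a filter, in powers of
`t → 0`: in a suitable basis, `J j k ~ γ j * ℓ k (n j) * t ^ n j`. -/
def JetExpansion {X : Type*} (l : Filter X) (t : X → ℂ) (ℓ : ℕ → ℕ → ℂ) (n : Fin 3 → ℕ)
    (J : Fin 3 → ℕ → X → ℂ) : Prop :=
  ∃ (B : Matrix (Fin 3) (Fin 3) ℂ) (γ : Fin 3 → ℂ) (g : Fin 3 → ℕ → X → ℂ), B.det ≠ 0 ∧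
    (∀ j, γ j ≠ 0) ∧ (∀ j k, Tendsto (g j k) l (𝓝 (ℓ k (n j) * γ j))) ∧
    ∀ᶠ x in l, ∀ i k, J i k x = ∑ j, B i j * (t x ^ n j * g j k x)

/-- The determinant formed by three columns of the jet matrix. -/
def jetDet {X : Type*} (J : Fin 3 → ℕ → X → ℂ) (k : Fin 3 → ℕ) (x : X) : ℂ :=
  Matrix.det (Matrix.of fun i j : Fin 3 => J i (k j) x)

variable {X : Type*} {l : Filter X} {t : X → ℂ} {ℓ : ℕ → ℕ → ℂ} {n : Fin 3 → ℕ}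
  {J : Fin 3 → ℕ → X → ℂ}

/-- The jet matrix factors as `B` · diag(t^n) · (`g`), so any choice of columns has the same power
of t, and the columns enter the leading constant only through a determinant in `ℓ`. -/
theorem JetExpansion.exists_tendsto_jetDet (h : JetExpansion l t ℓ n J)
    (ht : ∀ᶠ x in l, t x ≠ 0) : ∃ C : ℂ, C ≠ 0 ∧ ∀ k : Fin 3 → ℕ,
      Tendsto (fun x => jetDet J k x / t x ^ (n 0 + n 1 + n 2)) l
        (𝓝 (C * Matrix.det (Matrix.of fun j i : Fin 3 => ℓ (k i) (n j)))) := by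
  obtain ⟨B, γ, g, hB, hγ, hg, hJ⟩ := h
  refine ⟨B.det * ∏ j, γ j, mul_ne_zero hB (Finset.prod_ne_zero_iff.2 fun j _ => hγ j),
    fun k => ?_⟩
  have h1 : Tendsto (fun x => B.det * Matrix.det (Matrix.of fun j i : Fin 3 => g j (k i) x)) l
      (𝓝 (B.det * Matrix.det (Matrix.of fun j i : Fin 3 => ℓ (k i) (n j) * γ j))) := by
    refine Tendsto.const_mul _ ?_
    have hcont : Continuous fun A : Fin 3 → Fin 3 → ℂ => Matrix.det (Matrix.of A) :=
      Continuous.matrix_det continuous_id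
    exact (hcont.tendsto _).comp (tendsto_pi_nhds.2 fun j => tendsto_pi_nhds.2 fun i => hg j (k i))
  have e : B.det * Matrix.det (Matrix.of fun j i : Fin 3 => ℓ (k i) (n j) * γ j) =
      B.det * (∏ j, γ j) * Matrix.det (Matrix.of fun j i : Fin 3 => ℓ (k i) (n j)) := by
    rw [mul_assoc, ← Matrix.det_mul_column]
    simp only [Matrix.of_apply, mul_comm]
  rw [← e]
  refine h1.congr' ?_
  filter_upwards [hJ, ht] with x hx htx
  have e2 : (Matrix.of fun i j : Fin 3 => J i (k j) x) =
      B * (Matrix.of fun j i : Fin 3 => t x ^ n j * (Matrix.of fun j i : Fin 3 => g j (k i) x) j i) := by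
    ext i j
    simp [Matrix.mul_apply, hx]
  rw [jetDet, e2, Matrix.det_mul, Matrix.det_mul_column]
  rw [Fin.prod_univ_three, ← pow_add, ← pow_add]
  field_simp

/-- The smallest order dominates, with coefficients from a column of the invertible matrix `B`,
which cannot vanish. -/
theorem JetExpansion.exists_tendsto_zero (h : JetExpansion l t ℓ n J) (hn : StrictMono n)
    (ht : Tendsto t l (𝓝[≠] 0)) (hℓ : ∀ m, ℓ 0 m = 1) : ∃ β : Fin 3 → ℂ, (∃ i, β i ≠ 0) ∧
      ∀ i, Tendsto (fun x => J i 0 x / t x ^ n 0) l (𝓝 (β i)) := by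
  obtain ⟨B, γ, g, hB, hγ, hg, hJ⟩ := h
  have ht0 : ∀ᶠ x in l, t x ≠ 0 := (tendsto_nhdsWithin_iff.1 ht).2
  have ht1 : Tendsto t l (𝓝 0) := (tendsto_nhdsWithin_iff.1 ht).1
  have hp : ∀ m, 0 < m → Tendsto (fun x => t x ^ m) l (𝓝 0) := fun m hm => by
    simpa [hm.ne'] using ht1.pow m
  have h01 : n 0 < n 1 := hn (by decide)
  have h02 : n 0 < n 2 := hn (by decide)
  refine ⟨fun i => B i 0 * γ 0, ?_, fun i => ?_⟩
  · by_contra! hz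
    refine hB (Matrix.det_eq_zero_of_column_eq_zero 0 fun i => ?_)
    exact (mul_eq_zero.1 (hz i)).resolve_right (hγ 0)
  · have := (((hg 0 0).const_mul (B i 0)).add
      (((hp _ (Nat.sub_pos_of_lt h01)).mul (hg 1 0)).const_mul (B i 1))).add
      (((hp _ (Nat.sub_pos_of_lt h02)).mul (hg 2 0)).const_mul (B i 2))
    simp only [hℓ, one_mul, zero_mul, mul_zero, add_zero] at this
    refine this.congr' ?_
    filter_upwards [hJ, ht0] with x hx htx
    rw [hx, Fin.sum_univ_three, eq_div_iff (pow_ne_zero _ htx)]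
    have e1 : t x ^ n 1 = t x ^ (n 1 - n 0) * t x ^ n 0 := by rw [← pow_add]; congr 1; omega
    have e2 : t x ^ n 2 = t x ^ (n 2 - n 0) * t x ^ n 0 := by rw [← pow_add]; congr 1; omega
    rw [e1, e2]
    ring

/-- The minors `J i 1 * J i' 0 - J i' 1 * J i 0` of the jet matrix. -/
def jetMinors (J : Fin 3 → ℕ → X → ℂ) : Fin 3 → X → ℂ :=
  ![fun x => J 0 1 x * J 1 0 x - J 1 1 x * J 0 0 x, fun x => J 1 1 x * J 2 0 x - J 2 1 x * J 1 0 x,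
    fun x => J 2 1 x * J 0 0 x - J 0 1 x * J 2 0 x]

/-- The leading coefficients are the 2×2 minors of two columns of `B`, times a constant that is
nonzero because `ℓ 1` separates the orders. If all these minors vanished, so would det `B`. -/
theorem JetExpansion.exists_tendsto_jetMinors (h : JetExpansion l t ℓ n J) (hn : StrictMono n)
    (ht : Tendsto t l (𝓝[≠] 0)) (hℓ : ∀ m, ℓ 0 m = 1) (hℓ1 : Function.Injective (ℓ 1)) :
    ∃ β : Fin 3 → ℂ, (∃ i, β i ≠ 0) ∧
      ∀ i, Tendsto (fun x => jetMinors J i x / t x ^ (n 0 + n 1)) l (𝓝 (β i)) := by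
  obtain ⟨B, γ, g, hB, hγ, hg, hJ⟩ := h
  have ht0 : ∀ᶠ x in l, t x ≠ 0 := (tendsto_nhdsWithin_iff.1 ht).2
  have ht1 : Tendsto t l (𝓝 0) := (tendsto_nhdsWithin_iff.1 ht).1
  have hp : ∀ m, 0 < m → Tendsto (fun x => t x ^ m) l (𝓝 0) := fun m hm => by
    simpa [hm.ne'] using ht1.pow m
  have h01 : n 0 < n 1 := hn (by decide)
  have h12 : n 1 < n 2 := hn (by decide)
  set c : ℂ := γ 0 * γ 1 * (ℓ 1 (n 0) - ℓ 1 (n 1))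
  have hc : c ≠ 0 := mul_ne_zero (mul_ne_zero (hγ 0) (hγ 1))
    (sub_ne_zero.2 fun h => h01.ne (hℓ1 h))
  let μ : Fin 3 → Fin 3 → ℂ := fun i i' => c * (B i 0 * B i' 1 - B i' 0 * B i 1)
  have key : ∀ i i', Tendsto (fun x => (J i 1 x * J i' 0 x - J i' 1 x * J i 0 x) /
      t x ^ (n 0 + n 1)) l (𝓝 (μ i i')) := by
    intro i i'
    -- `H` gathers the two higher orders divided by t^(n 1). The terms in t^(2 n 0) cancel in the
    -- minor, so t^(n 0 + n 1) leads.
    let H : Fin 3 → ℕ → X → ℂ := fun i k x =>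
      B i 1 * g 1 k x + B i 2 * (t x ^ (n 2 - n 1) * g 2 k x)
    have hH : ∀ i k, Tendsto (H i k) l (𝓝 (B i 1 * (ℓ k (n 1) * γ 1))) := by
      intro i k
      have := ((hg 1 k).const_mul (B i 1)).add
        (((hp _ (Nat.sub_pos_of_lt h12)).mul (hg 2 k)).const_mul (B i 2))
      simpa only [zero_mul, mul_zero, add_zero] using this
    have h0 := fun k => hg 0 k
    have h3 := hp _ (Nat.sub_pos_of_lt h01)
    have := (((((h0 1).const_mul (B i 0)).mul (hH i' 0)).add
      ((hH i 1).mul ((h0 0).const_mul (B i' 0)))).sub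
      ((((h0 1).const_mul (B i' 0)).mul (hH i 0)).add
      ((hH i' 1).mul ((h0 0).const_mul (B i 0))))).add
      (h3.mul (((hH i 1).mul (hH i' 0)).sub ((hH i' 1).mul (hH i 0))))
    convert! this.congr' ?_ using 2
    · simp only [μ, c, hℓ]
      ring
    · filter_upwards [hJ, ht0] with x hx htx
      rw [eq_div_iff (pow_ne_zero _ htx)]
      have e1 : t x ^ n 1 = t x ^ (n 1 - n 0) * t x ^ n 0 := by rw [← pow_add]; congr 1; omega
      have e2 : t x ^ n 2 = t x ^ (n 2 - n 1) * (t x ^ (n 1 - n 0) * t x ^ n 0) := by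
        rw [← pow_add, ← pow_add]; congr 1; omega
      have hJ' : ∀ i k, J i k x = t x ^ n 0 * (B i 0 * g 0 k x + t x ^ (n 1 - n 0) * H i k x) := by
        intro i k
        rw [hx, Fin.sum_univ_three, e1, e2]
        simp only [H]
        ring
      rw [hJ', hJ', hJ', hJ', pow_add, e1]
      ring
  refine ⟨![μ 0 1, μ 1 2, μ 2 0], ?_, fun i => ?_⟩
  · by_contra! hz
    have z0 := (mul_eq_zero.1 (hz 0)).resolve_left hc
    have z1 := (mul_eq_zero.1 (hz 1)).resolve_left hc
    have z2 := (mul_eq_zero.1 (hz 2)).resolve_left hc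
    refine hB ?_
    rw [Matrix.det_fin_three]
    linear_combination B 2 2 * z0 + B 0 2 * z1 + B 1 2 * z2
  · fin_cases i
    · exact key 0 1
    · exact key 1 2
    · exact key 2 0

theorem tendsto_log_sum_norm_sq {w : Fin 3 → ℝ} (hw : ∀ j, 0 < w j) {f : Fin 3 → X → ℂ}
    {β : Fin 3 → ℂ} (hβ : ∃ i, β i ≠ 0) {N : ℕ} (ht : ∀ᶠ x in l, t x ≠ 0)
    (h : ∀ i, Tendsto (fun x => f i x / t x ^ N) l (𝓝 (β i))) :
    Tendsto (fun x => Real.log (∑ j, w j * ‖f j x‖ ^ 2) - 2 * N * Real.log ‖t x‖) l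
      (𝓝 (Real.log (∑ j, w j * ‖β j‖ ^ 2))) := by
  have hpos : 0 < ∑ j, w j * ‖β j‖ ^ 2 := sqSum_pos (G := fun j _ => β j) (z := 0) hw hβ
  have h1 : Tendsto (fun x => ∑ j, w j * ‖f j x / t x ^ N‖ ^ 2) l (𝓝 (∑ j, w j * ‖β j‖ ^ 2)) :=
    tendsto_finsetSum _ fun j _ => ((h j).norm.pow 2).const_mul (w j)
  refine ((Real.continuousAt_log hpos.ne').tendsto.comp h1).congr' ?_
  filter_upwards [ht, h1.eventually_ne hpos.ne'] with x hx hne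
  have htp : 0 < ‖t x‖ := norm_pos_iff.2 hx
  have e : ∑ j, w j * ‖f j x‖ ^ 2 = ‖t x‖ ^ (2 * N) * ∑ j, w j * ‖f j x / t x ^ N‖ ^ 2 := by
    rw [Finset.mul_sum]
    refine Finset.sum_congr rfl fun j _ => ?_
    rw [norm_div, norm_pow]
    field_simp
    ring
  rw [e, Real.log_mul (pow_pos htp _).ne' hne, Real.log_pow, Function.comp]
  push_cast
  ring


/-! ### Orders and local exponents in the upper half plane. -/

/-- The falling factorial `N (N - 1) ⋯ (N - k + 1)`. -/
def fall (k N : ℕ) : ℂ := ∏ i ∈ Finset.range k, ((N : ℂ) - i)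

theorem exists_pow_mul_iteratedDeriv_eq {G : ℂ → ℂ} {z₀ : ℂ} (hG : AnalyticAt ℂ G z₀) {N : ℕ}
    (hN : analyticOrderAt G z₀ = N) : ∃ γ : ℂ, γ ≠ 0 ∧ ∀ k : ℕ, ∃ g : ℂ → ℂ, AnalyticAt ℂ g z₀ ∧
      g z₀ = fall k N * γ ∧
      ∀ᶠ x in 𝓝 z₀, (x - z₀) ^ k * iteratedDeriv k G x = (x - z₀) ^ N * g x := by
  obtain ⟨g₀, hg₀, hg₀0, hg₀e⟩ := hG.analyticOrderAt_eq_natCast.1 hN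
  refine ⟨g₀ z₀, hg₀0, fun k => ?_⟩
  induction k with
  | zero =>
    refine ⟨g₀, hg₀, by simp [fall], ?_⟩
    filter_upwards [hg₀e] with x hx
    simp [hx]
  | succ k ih =>
    obtain ⟨g, hg, hg0, hge⟩ := ih
    -- Differentiating (x - z₀)^k G^(k) = (x - z₀)^N g and multiplying by x - z₀ yields this
    -- recursion; its value at z₀ produces the next factor N - k.
    refine ⟨fun x => ((N : ℂ) - k) * g x + (x - z₀) * deriv g x, ?_, ?_, ?_⟩
    · exact (analyticAt_const.mul hg).add ((analyticAt_id.sub analyticAt_const).mul hg.deriv)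
    · simp only [hg0, sub_self, zero_mul, add_zero, fall, Finset.prod_range_succ]
      ring
    · filter_upwards [hge.eventually_nhds, hG.eventually_analyticAt, hg.eventually_analyticAt]
        with x hx hGx hgx
      have hd := Filter.EventuallyEq.deriv_eq hx
      have hD : DifferentiableAt ℂ (iteratedDeriv k G) x :=
        (AnalyticAt.iterated_deriv hGx k |>.differentiableAt |> fun h => by
          rwa [iteratedDeriv_eq_iterate])
      have hs : ∀ m : ℕ, HasDerivAt (fun x => (x - z₀) ^ m) (m * (x - z₀) ^ (m - 1)) x := fun m => by
        simpa using ((hasDerivAt_id x).sub_const z₀).fun_pow m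
      rw [((hs k).fun_mul hD.hasDerivAt).deriv, ((hs N).fun_mul hgx.differentiableAt.hasDerivAt).deriv,
        ← iteratedDeriv_succ] at hd
      have hm : ∀ m : ℕ, (m : ℂ) * (x - z₀) ^ (m - 1) * (x - z₀) = m * (x - z₀) ^ m := by
        intro m
        cases m with
        | zero => simp
        | succ m => rw [Nat.add_sub_cancel, pow_succ]; ring
      have e0 := hx.self_of_nhds
      have h1 := hm k
      have h2 := hm N
      linear_combination (x - z₀) * hd - iteratedDeriv k G x * h1 + g x * h2 - k * e0

/-- The functions `(z - z₀) ^ k * F i ^ (k)`. -/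
def jetAt (F : Fin 3 → ℂ → ℂ) (z₀ : ℂ) (i : Fin 3) (k : ℕ) (x : ℂ) : ℂ :=
  (x - z₀) ^ k * iteratedDeriv k (F i) x

/-- The span of `F` has a basis with orders of vanishing `n 0 < n 1 < n 2` at `z₀`. -/
def HasOrders (F : Fin 3 → ℂ → ℂ) (z₀ : ℂ) (n : Fin 3 → ℕ) : Prop :=
  ∃ M : Matrix (Fin 3) (Fin 3) ℂ, M.det ≠ 0 ∧ StrictMono n ∧
      ∀ j, analyticOrderAt (fun z => ∑ i, M j i * F i z) z₀ = n j

theorem eq_sum_of_eq_sum {M : Matrix (Fin 3) (Fin 3) ℂ} (hM : M.det ≠ 0) {f g : Fin 3 → ℂ}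
    (h : ∀ j, g j = ∑ i, M j i * f i) (i : Fin 3) : f i = ∑ j, M⁻¹ i j * g j := by
  have h1 : g = M *ᵥ f := funext h
  have h2 : f = M⁻¹ *ᵥ g := by
    rw [h1, Matrix.mulVec_mulVec, Matrix.nonsing_inv_mul _ (isUnit_iff_ne_zero.2 hM),
      Matrix.one_mulVec]
  exact congrFun h2 i

theorem det_inv_ne_zero {M : Matrix (Fin 3) (Fin 3) ℂ} (hM : M.det ≠ 0) : M⁻¹.det ≠ 0 :=
  (Matrix.isUnit_nonsing_inv_det M (isUnit_iff_ne_zero.2 hM)).ne_zero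

theorem HasOrders.strictMono {F : Fin 3 → ℂ → ℂ} {z₀ : ℂ} {n : Fin 3 → ℕ}
    (h : HasOrders F z₀ n) : StrictMono n := h.choose_spec.2.1

theorem tendsto_sub_nhdsNE (z₀ : ℂ) : Tendsto (fun x => x - z₀) (𝓝[≠] z₀) (𝓝[≠] 0) := by
  refine tendsto_nhdsWithin_iff.2 ⟨?_, ?_⟩
  · have : Tendsto (fun x => x - z₀) (𝓝 z₀) (𝓝 (z₀ - z₀)) := tendsto_id.sub_const z₀
    rw [sub_self] at this
    exact this.mono_left nhdsWithin_le_nhds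
  · filter_upwards [self_mem_nhdsWithin] with x hx using sub_ne_zero.2 hx

theorem HasOrders.jetExpansion {F : Fin 3 → ℂ → ℂ} {z₀ : ℂ} {n : Fin 3 → ℕ}
    (h : HasOrders F z₀ n) (hF : ∀ j, AnalyticAt ℂ (F j) z₀) :
    JetExpansion (𝓝[≠] z₀) (fun x => x - z₀) fall n (jetAt F z₀) := by
  obtain ⟨M, hM, hn, hord⟩ := h
  have hG : ∀ j, AnalyticAt ℂ (fun z => ∑ i, M j i * F i z) z₀ := fun j =>
    Finset.analyticAt_fun_sum _ fun i _ => analyticAt_const.mul (hF i)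
  choose γ hγ hg using fun j => exists_pow_mul_iteratedDeriv_eq (hG j) (hord j)
  choose g hga hg0 hge using hg
  refine ⟨M⁻¹, γ, fun j k x => (x - z₀) ^ k * iteratedDeriv k (fun z => ∑ i, M j i * F i z) x /
    (x - z₀) ^ n j, det_inv_ne_zero hM, hγ, fun j k => ?_, ?_⟩
  · rw [← hg0]
    refine ((hga j k).continuousAt.tendsto.mono_left nhdsWithin_le_nhds).congr' ?_
    filter_upwards [(hge j k).filter_mono nhdsWithin_le_nhds, self_mem_nhdsWithin] with x hx hx0
    rw [hx, mul_div_cancel_left₀]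
    exact pow_ne_zero _ (sub_ne_zero.2 hx0)
  · have ha : ∀ᶠ x in 𝓝 z₀, ∀ j, AnalyticAt ℂ (fun z => ∑ i, M j i * F i z) x :=
      eventually_all.2 fun j => (hG j).eventually_analyticAt
    filter_upwards [ha.filter_mono nhdsWithin_le_nhds, self_mem_nhdsWithin] with x hx hx0 i k
    have e : F i = fun z => ∑ j, M⁻¹ i j * (fun z => ∑ i, M j i * F i z) z := by
      ext z
      exact eq_sum_of_eq_sum hM (f := fun i => F i z) (fun j => rfl) i
    have e2 : iteratedDeriv k (F i) x =
        ∑ j, M⁻¹ i j * iteratedDeriv k (fun z => ∑ i, M j i * F i z) x := by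
      conv_lhs => rw [e]
      rw [iteratedDeriv_fun_sum (f := fun j z => M⁻¹ i j * (fun z => ∑ i, M j i * F i z) z)
        fun j _ => (analyticAt_const.mul (hx j)).contDiffAt]
      simp only [iteratedDeriv_const_mul_field]
    rw [jetAt, e2, Finset.mul_sum]
    refine Finset.sum_congr rfl fun j _ => ?_
    have : (x - z₀) ^ n j ≠ 0 := pow_ne_zero _ (sub_ne_zero.2 hx0)
    field_simp

/-- The determinant formed by three columns of derivatives. -/
def derivDet (F : Fin 3 → ℂ → ℂ) (k : Fin 3 → ℕ) (x : ℂ) : ℂ :=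
  jetDet (fun i k => iteratedDeriv k (F i)) k x

theorem derivDet_wronskian (F : Fin 3 → ℂ → ℂ) (x : ℂ) :
    derivDet F ![0, 1, 2] x = wronskian F x := by
  rw [derivDet, jetDet, wronskian, Matrix.det_fin_three, Matrix.det_fin_three]
  rfl

theorem jetDet_jetAt (F : Fin 3 → ℂ → ℂ) (z₀ : ℂ) (k : Fin 3 → ℕ) (x : ℂ) :
    jetDet (jetAt F z₀) k x = (x - z₀) ^ (k 0 + k 1 + k 2) * derivDet F k x := by
  have : Matrix.of (fun i j : Fin 3 => jetAt F z₀ i (k j) x) = Matrix.of fun i j : Fin 3 =>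
      (x - z₀) ^ k j * (Matrix.of fun i j : Fin 3 => iteratedDeriv (k j) (F i) x) i j := rfl
  rw [jetDet, this, Matrix.det_mul_row, Fin.prod_univ_three, ← pow_add, ← pow_add]
  rfl

theorem jetMinors_jetAt (F : Fin 3 → ℂ → ℂ) (z₀ : ℂ) (i : Fin 3) (x : ℂ) :
    jetMinors (jetAt F z₀) i x = (x - z₀) * minors F i x := by
  fin_cases i <;>
  · simp [jetMinors, jetAt, minors, wronskian₂]
    ring

theorem analyticOrderAt_eq_of_tendsto {f : ℂ → ℂ} {z₀ L : ℂ} {N : ℕ} (hf : AnalyticAt ℂ f z₀)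
    (hL : L ≠ 0) (h : Tendsto (fun x => f x / (x - z₀) ^ N) (𝓝[≠] z₀) (𝓝 L)) :
    analyticOrderAt f z₀ = N := by
  have hs := tendsto_sub_nhdsNE z₀
  have hs0 : ∀ᶠ x in 𝓝[≠] z₀, x - z₀ ≠ 0 := (tendsto_nhdsWithin_iff.1 hs).2
  have hs1 := (tendsto_nhdsWithin_iff.1 hs).1
  have hpow : ∀ m, 0 < m → Tendsto (fun x => (x - z₀) ^ m) (𝓝[≠] z₀) (𝓝 0) := fun m hm => by
    simpa [hm.ne'] using hs1.pow m
  have hN : Tendsto f (𝓝[≠] z₀) (𝓝 (f z₀)) := hf.continuousAt.tendsto.mono_left nhdsWithin_le_nhds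
  have hnt : analyticOrderAt f z₀ ≠ ⊤ := by
    rw [Ne, analyticOrderAt_eq_top]
    intro h0
    refine hL (tendsto_nhds_unique h ?_)
    refine tendsto_const_nhds.congr' ?_
    filter_upwards [h0.filter_mono nhdsWithin_le_nhds] with x hx
    rw [hx, zero_div]
  obtain ⟨m, hm⟩ := ENat.ne_top_iff_exists.1 hnt
  obtain ⟨g, hg, hg0, hge⟩ := hf.analyticOrderAt_eq_natCast.1 hm.symm
  have hgt : Tendsto g (𝓝[≠] z₀) (𝓝 (g z₀)) := hg.continuousAt.tendsto.mono_left nhdsWithin_le_nhds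
  have hge' := hge.filter_mono (nhdsWithin_le_nhds (s := {z₀}ᶜ))
  rw [← hm]
  rcases lt_trichotomy m N with hlt | rfl | hlt
  · have h1 := h.mul (hpow (N - m) (Nat.sub_pos_of_lt hlt))
    rw [mul_zero] at h1
    refine absurd (tendsto_nhds_unique hgt (h1.congr' ?_)) hg0
    filter_upwards [hge', hs0] with x hx hx0
    rw [hx, smul_eq_mul]
    have : (x - z₀) ^ N = (x - z₀) ^ (N - m) * (x - z₀) ^ m := by rw [← pow_add]; congr 1; omega
    rw [this]
    field_simp
  · rfl
  · have h1 := hgt.mul (hpow (m - N) (Nat.sub_pos_of_lt hlt))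
    rw [mul_zero] at h1
    refine absurd (tendsto_nhds_unique h (h1.congr' ?_)) hL
    filter_upwards [hge', hs0] with x hx hx0
    rw [hx, smul_eq_mul]
    have : (x - z₀) ^ m = (x - z₀) ^ (m - N) * (x - z₀) ^ N := by rw [← pow_add]; congr 1; omega
    rw [this]
    field_simp

theorem det_fall_012 (n : Fin 3 → ℕ) :
    Matrix.det (Matrix.of fun j i : Fin 3 => fall (![0, 1, 2] i) (n j)) =
      ((n 1 : ℂ) - n 0) * ((n 2 : ℂ) - n 0) * ((n 2 : ℂ) - n 1) := by
  rw [Matrix.det_fin_three]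
  simp [fall, Finset.prod_range_succ]
  ring

/-- Up to the Vandermonde factor, this and the next determinant are, up to sign, the coefficients of
the indicial polynomial of the equation satisfied by `F` itself, whose roots are the orders `n j`.
-/
theorem det_fall_023 (n : Fin 3 → ℕ) :
    Matrix.det (Matrix.of fun j i : Fin 3 => fall (![0, 2, 3] i) (n j)) =
      ((n 0 : ℂ) * n 1 + n 1 * n 2 + n 2 * n 0 - (n 0 + n 1 + n 2) + 1) *
      (((n 1 : ℂ) - n 0) * ((n 2 : ℂ) - n 0) * ((n 2 : ℂ) - n 1)) := by
  rw [Matrix.det_fin_three]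
  simp [fall, Finset.prod_range_succ]
  ring

theorem det_fall_123 (n : Fin 3 → ℕ) :
    Matrix.det (Matrix.of fun j i : Fin 3 => fall (![1, 2, 3] i) (n j)) =
      ((n 0 : ℂ) * n 1 * n 2) *
      (((n 1 : ℂ) - n 0) * ((n 2 : ℂ) - n 0) * ((n 2 : ℂ) - n 1)) := by
  rw [Matrix.det_fin_three]
  simp [fall, Finset.prod_range_succ]
  ring

theorem vandermonde_ne_zero {n : Fin 3 → ℕ} (hn : StrictMono n) :
    ((n 1 : ℂ) - n 0) * ((n 2 : ℂ) - n 0) * ((n 2 : ℂ) - n 1) ≠ 0 := by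
  have h : ∀ i j, i < j → ((n j : ℂ) - n i) ≠ 0 := fun i j hij =>
    sub_ne_zero.2 (Nat.cast_injective.ne (hn hij).ne')
  exact mul_ne_zero (mul_ne_zero (h _ _ (by decide)) (h _ _ (by decide))) (h _ _ (by decide))

theorem three_le_sum {n : Fin 3 → ℕ} (hn : StrictMono n) : 3 ≤ n 0 + n 1 + n 2 := by
  have h1 : n 0 < n 1 := hn (by decide)
  have h2 : n 1 < n 2 := hn (by decide)
  omega

section Point

variable {F : Fin 3 → ℂ → ℂ} {z₀ : ℂ} {n : Fin 3 → ℕ}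

/-- The 3 is 0 + 1 + 2, the total number of derivatives in W; the Vandermonde factor excludes
further cancellation. -/
theorem HasOrders.analyticOrderAt_wronskian (h : HasOrders F z₀ n)
    (hF : ∀ j, AnalyticAt ℂ (F j) z₀) :
    analyticOrderAt (wronskian F) z₀ = (n 0 + n 1 + n 2 - 3 : ℕ) := by
  have ht : ∀ᶠ x in 𝓝[≠] z₀, x - z₀ ≠ 0 := (tendsto_nhdsWithin_iff.1 (tendsto_sub_nhdsNE z₀)).2
  obtain ⟨C, hC, hJ⟩ := (h.jetExpansion hF).exists_tendsto_jetDet ht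
  have h1 := hJ ![0, 1, 2]
  rw [det_fall_012] at h1
  refine analyticOrderAt_eq_of_tendsto (analyticAt_wronskian hF)
    (mul_ne_zero hC (vandermonde_ne_zero h.strictMono)) (h1.congr' ?_)
  filter_upwards [ht] with x hx
  rw [jetDet_jetAt, derivDet_wronskian]
  have e : (x - z₀) ^ (n 0 + n 1 + n 2) = (x - z₀) ^ 3 * (x - z₀) ^ (n 0 + n 1 + n 2 - 3) := by
    rw [← pow_add]
    congr 1
    have := three_le_sum h.strictMono
    omega
  rw [e]
  simp only [Matrix.cons_val_zero, Matrix.cons_val_one, Matrix.cons_val]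
  have := pow_ne_zero 3 hx
  have := pow_ne_zero (n 0 + n 1 + n 2 - 3) hx
  field_simp

theorem HasOrders.eventually_wronskian_ne_zero (h : HasOrders F z₀ n)
    (hF : ∀ j, AnalyticAt ℂ (F j) z₀) : ∀ᶠ x in 𝓝[≠] z₀, wronskian F x ≠ 0 := by
  refine (analyticAt_wronskian hF).eventually_eq_zero_or_eventually_ne_zero.resolve_left fun h0 => ?_
  have := analyticOrderAt_eq_top.2 h0
  rw [h.analyticOrderAt_wronskian hF] at this
  exact ENat.natCast_ne_top _ this

/-- The coefficient of `y'` in the equation satisfied by the functions `F j / ∛W`. -/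
def rawQ₂ (F : Fin 3 → ℂ → ℂ) (x : ℂ) : ℂ :=
  iteratedDeriv 2 (wronskian F) x / wronskian F x -
    4 / 3 * (iteratedDeriv 1 (wronskian F) x / wronskian F x) ^ 2 +
    derivDet F ![0, 2, 3] x / wronskian F x

/-- The coefficient of `y` in the equation satisfied by the functions `F j / ∛W`. -/
def rawQ₃ (F : Fin 3 → ℂ → ℂ) (x : ℂ) : ℂ :=
  1 / 3 * (iteratedDeriv 3 (wronskian F) x / wronskian F x) -
    iteratedDeriv 1 (wronskian F) x / wronskian F x *
      (iteratedDeriv 2 (wronskian F) x / wronskian F x) +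
    16 / 27 * (iteratedDeriv 1 (wronskian F) x / wronskian F x) ^ 3 +
    1 / 3 * (derivDet F ![0, 2, 3] x / wronskian F x *
      (iteratedDeriv 1 (wronskian F) x / wronskian F x)) -
    derivDet F ![1, 2, 3] x / wronskian F x

/-- Dividing by ∛W shifts the orders to n_j - (n₀ + n₁ + n₂ - 3)/3. In terms of the gaps minus one
these are the claimed exponents. -/
theorem HasOrders.hasLocalExponents_raw (h : HasOrders F z₀ n)
    (hF : ∀ j, AnalyticAt ℂ (F j) z₀) : HasLocalExponents (rawQ₂ F) (rawQ₃ F) z₀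
      (exponents 1 ![n 1 - n 0 - 1, n 2 - n 1 - 1]) := by
  have ht : ∀ᶠ x in 𝓝[≠] z₀, x - z₀ ≠ 0 := (tendsto_nhdsWithin_iff.1 (tendsto_sub_nhdsNE z₀)).2
  have hW := h.eventually_wronskian_ne_zero hF
  obtain ⟨C, hC, hJ⟩ := (h.jetExpansion hF).exists_tendsto_jetDet ht
  have hV := vandermonde_ne_zero h.strictMono
  have h012 := hJ ![0, 1, 2]
  have h023 := hJ ![0, 2, 3]
  have h123 := hJ ![1, 2, 3]
  rw [det_fall_012] at h012
  rw [det_fall_023] at h023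
  rw [det_fall_123] at h123
  have hCV := mul_ne_zero hC hV
  have hp2 : Tendsto (fun x => (x - z₀) ^ 2 * (derivDet F ![0, 2, 3] x / wronskian F x)) (𝓝[≠] z₀)
      (𝓝 ((n 0 : ℂ) * n 1 + n 1 * n 2 + n 2 * n 0 - (n 0 + n 1 + n 2) + 1)) := by
    have := h023.div h012 hCV
    rw [mul_left_comm, mul_div_cancel_right₀ _ hCV] at this
    refine this.congr' ?_
    filter_upwards [ht, hW] with x hx hWx
    simp only [Pi.div_apply, jetDet_jetAt, derivDet_wronskian]
    simp only [Matrix.cons_val_zero, Matrix.cons_val_one, Matrix.cons_val]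
    have := pow_ne_zero (n 0 + n 1 + n 2) hx
    field_simp
    ring
  have hp3 : Tendsto (fun x => (x - z₀) ^ 3 * (derivDet F ![1, 2, 3] x / wronskian F x)) (𝓝[≠] z₀)
      (𝓝 ((n 0 : ℂ) * n 1 * n 2)) := by
    have := h123.div h012 hCV
    rw [mul_left_comm, mul_div_cancel_right₀ _ hCV] at this
    refine this.congr' ?_
    filter_upwards [ht, hW] with x hx hWx
    simp only [Pi.div_apply, jetDet_jetAt, derivDet_wronskian]
    simp only [Matrix.cons_val_zero, Matrix.cons_val_one, Matrix.cons_val]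
    have := pow_ne_zero (n 0 + n 1 + n 2) hx
    field_simp
    ring
  obtain ⟨γ, hγ, hg⟩ := exists_pow_mul_iteratedDeriv_eq (analyticAt_wronskian hF)
    (h.analyticOrderAt_wronskian hF)
  set N := n 0 + n 1 + n 2 - 3 with hN
  have hNc : (N : ℂ) = n 0 + n 1 + n 2 - 3 := by
    rw [hN, Nat.cast_sub (three_le_sum h.strictMono)]
    push_cast
    ring
  have hr : ∀ k, Tendsto (fun x => (x - z₀) ^ k * (iteratedDeriv k (wronskian F) x / wronskian F x))
      (𝓝[≠] z₀) (𝓝 (fall k N)) := by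
    intro k
    obtain ⟨g, hga, hg0, hge⟩ := hg k
    obtain ⟨g', hga', hg0', hge'⟩ := hg 0
    have hγ0 : g' z₀ ≠ 0 := by
      rw [hg0']
      simpa [fall] using hγ
    have h1 := (hga.continuousAt.div hga'.continuousAt hγ0).tendsto.mono_left
      (nhdsWithin_le_nhds (s := {z₀}ᶜ))
    have e : g z₀ / g' z₀ = fall k N := by
      rw [hg0, hg0']
      simp [fall, hγ]
    simp only [Pi.div_apply] at h1
    rw [e] at h1
    refine h1.congr' ?_
    filter_upwards [ht, hW, hge.filter_mono nhdsWithin_le_nhds, hge'.filter_mono nhdsWithin_le_nhds]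
      with x hx hWx e1 e2
    simp only [pow_zero, iteratedDeriv_zero, one_mul] at e2
    have hp := pow_ne_zero N hx
    have hg'x : g' x ≠ 0 := fun h0 => hWx (by rw [e2, h0, mul_zero])
    rw [Pi.div_apply, mul_div_assoc', e1, e2]
    field_simp
  refine ⟨_, _, Tendsto.congr' ?_ (((hr 2).sub (((hr 1).pow 2).const_mul (4 / 3))).add hp2),
    Tendsto.congr' ?_ ((((((hr 3).const_mul (1 / 3)).sub ((hr 1).mul (hr 2))).add
      (((hr 1).pow 3).const_mul (16 / 27))).add ((hp2.mul (hr 1)).const_mul (1 / 3))).sub hp3), ?_⟩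
  · filter_upwards with x
    simp only [rawQ₂]
    ring
  · filter_upwards with x
    simp only [rawQ₃]
    ring
  · intro X
    have h01 : n 0 < n 1 := h.strictMono (by decide)
    have h12 : n 1 < n 2 := h.strictMono (by decide)
    have c1 : ((n 1 - n 0 - 1 : ℕ) : ℂ) = n 1 - n 0 - 1 := by
      rw [Nat.sub_sub, Nat.cast_sub h01]
      push_cast
      ring
    have c2 : ((n 2 - n 1 - 1 : ℕ) : ℂ) = n 2 - n 1 - 1 := by
      rw [Nat.sub_sub, Nat.cast_sub h12]
      push_cast
      ring
    simp only [fall, Finset.prod_range_succ, Finset.prod_range_zero, hNc, exponents,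
      Fin.prod_univ_three, Matrix.cons_val_zero, Matrix.cons_val_one, Matrix.cons_val, c1, c2]
    push_cast
    ring

end Point


/-! ### The differential equation of a triple with Wronskian one. -/

theorem analyticAt_iteratedDeriv {f : ℂ → ℂ} {z : ℂ} (hf : AnalyticAt ℂ f z) (k : ℕ) :
    AnalyticAt ℂ (iteratedDeriv k f) z := by
  rw [iteratedDeriv_eq_iterate]
  exact hf.iterated_deriv k

theorem hasDerivAt_iteratedDeriv {f : ℂ → ℂ} {z : ℂ} (hf : AnalyticAt ℂ f z) (k : ℕ) :
    HasDerivAt (iteratedDeriv k f) (iteratedDeriv (k + 1) f z) z := by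
  rw [iteratedDeriv_succ]
  exact (analyticAt_iteratedDeriv hf k).differentiableAt.hasDerivAt

theorem analyticAt_derivDet {F : Fin 3 → ℂ → ℂ} {z : ℂ} (hF : ∀ j, AnalyticAt ℂ (F j) z)
    (k : Fin 3 → ℕ) : AnalyticAt ℂ (derivDet F k) z := by
  have e : derivDet F k = _ := funext fun x => Matrix.det_fin_three _
  have h := fun i j => analyticAt_iteratedDeriv (hF i) j
  rw [e]
  simp only [Matrix.of_apply]
  have := h 0; have := h 1; have := h 2
  fun_prop

theorem derivDet_eq (F : Fin 3 → ℂ → ℂ) (a b c : ℕ) (x : ℂ) : derivDet F ![a, b, c] x =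
    iteratedDeriv a (F 0) x * iteratedDeriv b (F 1) x * iteratedDeriv c (F 2) x -
    iteratedDeriv a (F 0) x * iteratedDeriv c (F 1) x * iteratedDeriv b (F 2) x -
    iteratedDeriv b (F 0) x * iteratedDeriv a (F 1) x * iteratedDeriv c (F 2) x +
    iteratedDeriv b (F 0) x * iteratedDeriv c (F 1) x * iteratedDeriv a (F 2) x +
    iteratedDeriv c (F 0) x * iteratedDeriv a (F 1) x * iteratedDeriv b (F 2) x -
    iteratedDeriv c (F 0) x * iteratedDeriv b (F 1) x * iteratedDeriv a (F 2) x := by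
  rw [derivDet, jetDet, Matrix.det_fin_three]
  rfl

theorem deriv_wronskian {F : Fin 3 → ℂ → ℂ} {z : ℂ} (hF : ∀ j, AnalyticAt ℂ (F j) z) :
    deriv (wronskian F) z = derivDet F ![0, 1, 3] z := by
  have e : wronskian F = fun x => _ := funext fun x => by rw [← derivDet_wronskian, derivDet_eq]
  have h := fun i k => hasDerivAt_iteratedDeriv (hF i) k
  rw [e]
  refine HasDerivAt.deriv ((((((((h 0 0).fun_mul (h 1 1)).fun_mul (h 2 2)).fun_sub
    (((h 0 0).fun_mul (h 1 2)).fun_mul (h 2 1))).fun_sub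
    (((h 0 1).fun_mul (h 1 0)).fun_mul (h 2 2))).fun_add
    (((h 0 1).fun_mul (h 1 2)).fun_mul (h 2 0))).fun_add
    (((h 0 2).fun_mul (h 1 0)).fun_mul (h 2 1))).fun_sub
    (((h 0 2).fun_mul (h 1 1)).fun_mul (h 2 0)) |>.congr_deriv ?_)
  rw [derivDet_eq]
  ring

section Covariance

variable {F y : Fin 3 → ℂ → ℂ} {c : ℂ → ℂ} {x : ℂ}

theorem iteratedDeriv_one_mul {a b : ℂ → ℂ} (ha : AnalyticAt ℂ a x) (hb : AnalyticAt ℂ b x) :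
    iteratedDeriv 1 (fun x => a x * b x) x =
      iteratedDeriv 1 a x * b x + a x * iteratedDeriv 1 b x := by
  rw [iteratedDeriv_fun_mul ha.contDiffAt hb.contDiffAt]
  simp [Finset.sum_range_succ]
  ring

theorem iteratedDeriv_two_mul {a b : ℂ → ℂ} (ha : AnalyticAt ℂ a x) (hb : AnalyticAt ℂ b x) :
    iteratedDeriv 2 (fun x => a x * b x) x =
      iteratedDeriv 2 a x * b x + 2 * (iteratedDeriv 1 a x * iteratedDeriv 1 b x) +
        a x * iteratedDeriv 2 b x := by
  rw [iteratedDeriv_fun_mul ha.contDiffAt hb.contDiffAt]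
  simp [Finset.sum_range_succ]
  ring

theorem iteratedDeriv_three_mul {a b : ℂ → ℂ} (ha : AnalyticAt ℂ a x) (hb : AnalyticAt ℂ b x) :
    iteratedDeriv 3 (fun x => a x * b x) x =
      iteratedDeriv 3 a x * b x + 3 * (iteratedDeriv 2 a x * iteratedDeriv 1 b x) +
        3 * (iteratedDeriv 1 a x * iteratedDeriv 2 b x) + a x * iteratedDeriv 3 b x := by
  rw [iteratedDeriv_fun_mul ha.contDiffAt hb.contDiffAt]
  simp [Finset.sum_range_succ, Nat.choose]
  ring

/-- This is where the formulas for `rawQ₂` and `rawQ₃` come from: substitute F = c y and W = c³ in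
the coefficients of the equation for y and eliminate c. The result involves only `F` and W, so it
does not depend on the branch. -/
theorem rawQ_eq (hy : ∀ j, AnalyticAt ℂ (y j) x) (hc : AnalyticAt ℂ c x) (hc0 : c x ≠ 0)
    (hF : ∀ᶠ z in 𝓝 x, ∀ j, F j z = c z * y j z) (hW : ∀ᶠ z in 𝓝 x, wronskian F z = c z ^ 3)
    (hWy : ∀ᶠ z in 𝓝 x, wronskian y z = 1) :
    rawQ₂ F x = derivDet y ![0, 2, 3] x ∧ rawQ₃ F x = -derivDet y ![1, 2, 3] x := by
  have hFj : ∀ k j, iteratedDeriv k (F j) x = iteratedDeriv k (fun z => c z * y j z) x := fun k j =>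
    Filter.EventuallyEq.iteratedDeriv_eq k (hF.mono fun z hz => hz j)
  have hWk : ∀ k, iteratedDeriv k (wronskian F) x =
      iteratedDeriv k (fun z => c z * (c z * c z)) x := fun k =>
    Filter.EventuallyEq.iteratedDeriv_eq k (hW.mono fun z hz => by rw [hz]; ring)
  have hcc : AnalyticAt ℂ (fun z => c z * c z) x := hc.mul hc
  have hW1 : iteratedDeriv 1 (wronskian F) x = 3 * c x ^ 2 * iteratedDeriv 1 c x := by
    rw [hWk, iteratedDeriv_one_mul hc hcc, iteratedDeriv_one_mul hc hc]
    ring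
  have hW2 : iteratedDeriv 2 (wronskian F) x =
      6 * c x * iteratedDeriv 1 c x ^ 2 + 3 * c x ^ 2 * iteratedDeriv 2 c x := by
    rw [hWk, iteratedDeriv_two_mul hc hcc, iteratedDeriv_two_mul hc hc, iteratedDeriv_one_mul hc hc]
    ring
  have hW3 : iteratedDeriv 3 (wronskian F) x = 6 * iteratedDeriv 1 c x ^ 3 +
      18 * c x * iteratedDeriv 1 c x * iteratedDeriv 2 c x + 3 * c x ^ 2 * iteratedDeriv 3 c x := by
    rw [hWk, iteratedDeriv_three_mul hc hcc, iteratedDeriv_three_mul hc hc,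
      iteratedDeriv_two_mul hc hc, iteratedDeriv_one_mul hc hc]
    ring
  have d012 : derivDet y ![0, 1, 2] x = 1 := by
    rw [derivDet_wronskian]
    exact hWy.self_of_nhds
  have d013 : derivDet y ![0, 1, 3] x = 0 := by
    rw [← deriv_wronskian hy, EventuallyEq.deriv_eq (f := fun _ => (1 : ℂ)) hWy, deriv_const]
  have hF0 : ∀ j, iteratedDeriv 0 (F j) x = c x * iteratedDeriv 0 (y j) x := fun j => by
    simp only [iteratedDeriv_zero]
    exact hF.self_of_nhds j
  have h023 : derivDet F ![0, 2, 3] x = 6 * c x * iteratedDeriv 1 c x ^ 2 -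
      3 * c x ^ 2 * iteratedDeriv 2 c x + c x ^ 3 * derivDet y ![0, 2, 3] x := by
    -- The determinant is first expanded by multilinearity in all determinants of y. Then W(y) = 1
    -- and W(y)' = 0 are inserted.
    have : derivDet F ![0, 2, 3] x = 6 * c x * iteratedDeriv 1 c x ^ 2 * derivDet y ![0, 1, 2] x +
        2 * c x ^ 2 * iteratedDeriv 1 c x * derivDet y ![0, 1, 3] x -
        3 * c x ^ 2 * iteratedDeriv 2 c x * derivDet y ![0, 1, 2] x +
        c x ^ 3 * derivDet y ![0, 2, 3] x := by
      simp only [derivDet_eq, hF0]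
      simp only [hFj, iteratedDeriv_two_mul hc (hy _), iteratedDeriv_three_mul hc (hy _),
        iteratedDeriv_zero]
      ring
    rw [this, d012, d013]
    ring
  have h123 : derivDet F ![1, 2, 3] x = 6 * iteratedDeriv 1 c x ^ 3 -
      6 * c x * iteratedDeriv 1 c x * iteratedDeriv 2 c x + c x ^ 2 * iteratedDeriv 3 c x +
      c x ^ 2 * iteratedDeriv 1 c x * derivDet y ![0, 2, 3] x +
      c x ^ 3 * derivDet y ![1, 2, 3] x := by
    have : derivDet F ![1, 2, 3] x = (6 * iteratedDeriv 1 c x ^ 3 -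
        6 * c x * iteratedDeriv 1 c x * iteratedDeriv 2 c x + c x ^ 2 * iteratedDeriv 3 c x) *
          derivDet y ![0, 1, 2] x +
        (2 * c x * iteratedDeriv 1 c x ^ 2 - c x ^ 2 * iteratedDeriv 2 c x) *
          derivDet y ![0, 1, 3] x +
      c x ^ 2 * iteratedDeriv 1 c x * derivDet y ![0, 2, 3] x +
      c x ^ 3 * derivDet y ![1, 2, 3] x := by
      simp only [derivDet_eq]
      simp only [hFj, iteratedDeriv_one_mul hc (hy _), iteratedDeriv_two_mul hc (hy _),
        iteratedDeriv_three_mul hc (hy _), iteratedDeriv_zero]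
      ring
    rw [this, d012, d013]
    ring
  rw [rawQ₂, rawQ₃, hW1, hW2, hW3, h023, h123, hW.self_of_nhds]
  constructor
  · field_simp
    ring
  · field_simp
    ring

/-- Expand the vanishing 4×4 determinant of the jets of y in which the row of `y j` occurs twice.
The leading coefficient is W = 1 and that of the second derivative is -W' = 0. -/
theorem ode_of_wronskian_eq_one (hy : ∀ j, AnalyticAt ℂ (y j) x)
    (hWy : ∀ᶠ z in 𝓝 x, wronskian y z = 1) (j : Fin 3) :
    iteratedDeriv 3 (y j) x + derivDet y ![0, 2, 3] x * deriv (y j) x +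
      -derivDet y ![1, 2, 3] x * y j x = 0 := by
  have d012 : derivDet y ![0, 1, 2] x = 1 := by
    rw [derivDet_wronskian]
    exact hWy.self_of_nhds
  have d013 : derivDet y ![0, 1, 3] x = 0 := by
    rw [← deriv_wronskian hy, EventuallyEq.deriv_eq (f := fun _ => (1 : ℂ)) hWy, deriv_const]
  have key : iteratedDeriv 3 (y j) x * derivDet y ![0, 1, 2] x -
      iteratedDeriv 2 (y j) x * derivDet y ![0, 1, 3] x + 
      derivDet y ![0, 2, 3] x * iteratedDeriv 1 (y j) x +
      -derivDet y ![1, 2, 3] x * iteratedDeriv 0 (y j) x = 0 := by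
    simp only [derivDet_eq]
    fin_cases j <;> simp only [Fin.zero_eta, Fin.mk_one, Fin.reduceFinMk] <;> ring
  rw [d012, d013, iteratedDeriv_zero, iteratedDeriv_one] at key
  linear_combination key

end Covariance

/-! ### Coefficients on the upper half plane; singular points and branches. -/

/-- The coefficient of `y'`, with removable singularities removed. -/
def eqQ₂ (F : Fin 3 → ℂ → ℂ) (z : ℂ) : ℂ := limUnder (𝓝[≠] z) (rawQ₂ F)

/-- The coefficient of `y`, with removable singularities removed. -/
def eqQ₃ (F : Fin 3 → ℂ → ℂ) (z : ℂ) : ℂ := limUnder (𝓝[≠] z) (rawQ₃ F)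

/-- At a zero of W the raw quotients take the default value of division by zero, even where their
singularity is removable. The punctured limit restores the correct value, needed because branches
also exist at some zeros of W. -/
theorem limUnder_eq_of_eventuallyEq {f g : ℂ → ℂ} {z : ℂ} (hg : AnalyticAt ℂ g z)
    (h : f =ᶠ[𝓝[≠] z] g) : limUnder (𝓝[≠] z) f = g z :=
  ((hg.continuousAt.tendsto.mono_left nhdsWithin_le_nhds).congr' h.symm).limUnder_eq

theorem limUnder_eventuallyEq {f : ℂ → ℂ} {z : ℂ} (h : MeromorphicAt f z) :
    (fun z => limUnder (𝓝[≠] z) f) =ᶠ[𝓝[≠] z] f := by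
  filter_upwards [h.eventually_analyticAt] with x hx
  exact limUnder_eq_of_eventuallyEq hx EventuallyEq.rfl

section Local

variable {F : Fin 3 → ℂ → ℂ} {z₀ : ℂ}

theorem analyticAt_rawQ (hF : ∀ j, AnalyticAt ℂ (F j) z₀) (hW : wronskian F z₀ ≠ 0) :
    AnalyticAt ℂ (rawQ₂ F) z₀ ∧ AnalyticAt ℂ (rawQ₃ F) z₀ := by
  have h0 := analyticAt_wronskian hF
  have hk := fun k => (analyticAt_iteratedDeriv h0 k).div h0 hW
  have hd := fun k => (analyticAt_derivDet hF k).div h0 hW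
  exact ⟨((hk 2).sub (analyticAt_const.mul ((hk 1).pow 2))).add (hd _),
    ((((analyticAt_const.mul (hk 3)).sub ((hk 1).mul (hk 2))).add
      (analyticAt_const.mul ((hk 1).pow 3))).add (analyticAt_const.mul ((hd _).mul (hk 1)))).sub
      (hd _)⟩

theorem meromorphicAt_rawQ (hF : ∀ j, AnalyticAt ℂ (F j) z₀) :
    MeromorphicAt (rawQ₂ F) z₀ ∧ MeromorphicAt (rawQ₃ F) z₀ := by
  have h0 := analyticAt_wronskian hF
  have hk := fun k => (analyticAt_iteratedDeriv h0 k).meromorphicAt.div h0.meromorphicAt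
  have hd := fun k => (analyticAt_derivDet hF k).meromorphicAt.div h0.meromorphicAt
  have hc : ∀ a : ℂ, MeromorphicAt (fun _ => a) z₀ := fun a => analyticAt_const.meromorphicAt
  exact ⟨((hk 2).sub ((hc _).mul ((hk 1).pow 2))).add (hd _),
    (((((hc _).mul (hk 3)).sub ((hk 1).mul (hk 2))).add
      ((hc _).mul ((hk 1).pow 3))).add ((hc _).mul ((hd _).mul (hk 1)))).sub
      (hd _)⟩

theorem eqQ_eventuallyEq (hF : ∀ j, AnalyticAt ℂ (F j) z₀) :
    eqQ₂ F =ᶠ[𝓝[≠] z₀] rawQ₂ F ∧ eqQ₃ F =ᶠ[𝓝[≠] z₀] rawQ₃ F :=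
  ⟨limUnder_eventuallyEq (meromorphicAt_rawQ hF).1, limUnder_eventuallyEq (meromorphicAt_rawQ hF).2⟩

theorem eqQ_eq (hF : ∀ j, AnalyticAt ℂ (F j) z₀) (hW : wronskian F z₀ ≠ 0) :
    eqQ₂ F z₀ = rawQ₂ F z₀ ∧ eqQ₃ F z₀ = rawQ₃ F z₀ :=
  ⟨limUnder_eq_of_eventuallyEq (analyticAt_rawQ hF hW).1 EventuallyEq.rfl,
    limUnder_eq_of_eventuallyEq (analyticAt_rawQ hF hW).2 EventuallyEq.rfl⟩

theorem meromorphicAt_eqQ (hF : ∀ j, AnalyticAt ℂ (F j) z₀) :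
    MeromorphicAt (eqQ₂ F) z₀ ∧ MeromorphicAt (eqQ₃ F) z₀ :=
  ⟨(meromorphicAt_rawQ hF).1.congr (eqQ_eventuallyEq hF).1.symm,
    (meromorphicAt_rawQ hF).2.congr (eqQ_eventuallyEq hF).2.symm⟩

theorem IsBranch.rawQ_eventuallyEq {y : Fin 3 → ℂ → ℂ} (h : IsBranch F z₀ y)
    (hW : ∀ᶠ z in 𝓝[≠] z₀, wronskian F z ≠ 0) :
    rawQ₂ F =ᶠ[𝓝[≠] z₀] derivDet y ![0, 2, 3] ∧
      rawQ₃ F =ᶠ[𝓝[≠] z₀] fun x => -derivDet y ![1, 2, 3] x := by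
  have hW1 := h.wronskian_eq_one hW
  have hy := eventually_all.2 fun j => (h.analyticAt j).eventually_analyticAt
  obtain ⟨c, hc, hq⟩ := h.quotient
  have key : ∀ᶠ x in 𝓝[≠] z₀, rawQ₂ F x = derivDet y ![0, 2, 3] x ∧
      rawQ₃ F x = -derivDet y ![1, 2, 3] x := by
    filter_upwards [hW, hW1.eventually_nhds.filter_mono nhdsWithin_le_nhds,
      hy.filter_mono nhdsWithin_le_nhds, hc.eventually_analyticAt.filter_mono nhdsWithin_le_nhds,
      hq.eventually_nhds.filter_mono nhdsWithin_le_nhds] with x a1 a2 a3 a4 a5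
    refine rawQ_eq a3 a4 ?_ (a5.mono fun z hz j => (hz.2 j).symm) (a5.mono fun z hz => hz.1.symm) a2
    intro h0
    exact a1 (by rw [← a5.self_of_nhds.1, h0]; simp)
  exact ⟨key.mono fun _ h => h.1, key.mono fun _ h => h.2⟩

theorem IsBranch.eqQ_eq {y : Fin 3 → ℂ → ℂ} (h : IsBranch F z₀ y)
    (hW : ∀ᶠ z in 𝓝[≠] z₀, wronskian F z ≠ 0) :
    eqQ₂ F z₀ = derivDet y ![0, 2, 3] z₀ ∧ eqQ₃ F z₀ = -derivDet y ![1, 2, 3] z₀ :=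
  ⟨limUnder_eq_of_eventuallyEq (analyticAt_derivDet h.analyticAt _) (h.rawQ_eventuallyEq hW).1,
    limUnder_eq_of_eventuallyEq (analyticAt_derivDet h.analyticAt _).neg
      (h.rawQ_eventuallyEq hW).2⟩

theorem IsBranch.solves {y : Fin 3 → ℂ → ℂ} (h : IsBranch F z₀ y)
    (hW : ∀ᶠ z in 𝓝[≠] z₀, wronskian F z ≠ 0) (j : Fin 3) :
    iteratedDeriv 3 (y j) z₀ + eqQ₂ F z₀ * deriv (y j) z₀ + eqQ₃ F z₀ * y j z₀ = 0 := by
  rw [(h.eqQ_eq hW).1, (h.eqQ_eq hW).2]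
  exact ode_of_wronskian_eq_one h.analyticAt (h.wronskian_eq_one hW) j

theorem IsBranch.not_isSingularPoint {y : Fin 3 → ℂ → ℂ} (h : IsBranch F z₀ y)
    (hF : ∀ j, AnalyticAt ℂ (F j) z₀)
    (hW : ∀ᶠ z in 𝓝[≠] z₀, wronskian F z ≠ 0) : ¬ IsSingularPoint (eqQ₂ F) (eqQ₃ F) z₀ := by
  have h2 := meromorphicOrderAt_congr ((eqQ_eventuallyEq hF).1.trans (h.rawQ_eventuallyEq hW).1)
  have h3 := meromorphicOrderAt_congr ((eqQ_eventuallyEq hF).2.trans (h.rawQ_eventuallyEq hW).2)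
  rw [IsSingularPoint, h2, h3, not_or, not_lt, not_lt]
  exact ⟨(analyticAt_derivDet h.analyticAt _).meromorphicOrderAt_nonneg,
    (analyticAt_derivDet h.analyticAt _).neg.meromorphicOrderAt_nonneg⟩

theorem HasOrders.hasLocalExponents {n : Fin 3 → ℕ} (h : HasOrders F z₀ n)
    (hF : ∀ j, AnalyticAt ℂ (F j) z₀) : HasLocalExponents (eqQ₂ F) (eqQ₃ F) z₀
      (exponents 1 ![n 1 - n 0 - 1, n 2 - n 1 - 1]) := by
  obtain ⟨A₂, A₃, h2, h3, hX⟩ := h.hasLocalExponents_raw hF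
  refine ⟨A₂, A₃, h2.congr' ?_, h3.congr' ?_, hX⟩
  · filter_upwards [(eqQ_eventuallyEq hF).1] with x hx
    rw [hx]
  · filter_upwards [(eqQ_eventuallyEq hF).2] with x hx
    rw [hx]

/-- Without poles A₂ = A₃ = 0, so the exponents are 0, 1, 2. The exponent -(2m¹ + m²)/3 ≤ 0 is one
of them, hence 0. -/
theorem eq_zero_of_not_isSingularPoint {Q₂ Q₃ : ℂ → ℂ} {m : Fin 2 → ℕ}
    (h2 : MeromorphicAt Q₂ z₀) (h3 : MeromorphicAt Q₃ z₀)
    (he : HasLocalExponents Q₂ Q₃ z₀ (exponents 1 m)) (hs : ¬ IsSingularPoint Q₂ Q₃ z₀) :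
    m 0 = 0 ∧ m 1 = 0 := by
  rw [IsSingularPoint, not_or, not_lt, not_lt] at hs
  obtain ⟨c2, hc2⟩ := tendsto_nhds_of_meromorphicOrderAt_nonneg h2 hs.1
  obtain ⟨c3, hc3⟩ := tendsto_nhds_of_meromorphicOrderAt_nonneg h3 hs.2
  obtain ⟨A₂, A₃, hA2, hA3, hX⟩ := he
  have ht := (tendsto_nhdsWithin_iff.1 (tendsto_sub_nhdsNE z₀)).1
  have e2 : A₂ = 0 := by
    have := (ht.pow 2).mul hc2
    rw [zero_pow two_ne_zero, zero_mul] at this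
    exact tendsto_nhds_unique hA2 this
  have e3 : A₃ = 0 := by
    have := (ht.pow 3).mul hc3
    rw [zero_pow three_ne_zero, zero_mul] at this
    exact tendsto_nhds_unique hA3 this
  have h := hX (-(2 * m 0 + m 1) / 3)
  rw [e2, e3] at h
  simp only [exponents, Fin.prod_univ_three, Matrix.cons_val_zero, sub_self, zero_mul,
    add_zero] at h
  have h' : (2 * m 0 + m 1) * (2 * m 0 + m 1 + 3) * (2 * m 0 + m 1 + 6) = 0 := by
    have : ((2 * m 0 + m 1 : ℕ) : ℂ) * ((2 * m 0 + m 1 + 3 : ℕ) : ℂ) *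
        ((2 * m 0 + m 1 + 6 : ℕ) : ℂ) = 0 := by
      push_cast
      linear_combination -27 * h
    exact_mod_cast this
  have h'' : 2 * m 0 + m 1 = 0 := by
    rcases Nat.mul_eq_zero.1 h' with h | h
    · rcases Nat.mul_eq_zero.1 h with h | h <;> omega
    · omega
  omega

/-- The principal power is applied to f/f(z₀), which is near 1 and so avoids the cut. -/
theorem exists_analytic_cube_root {f : ℂ → ℂ} (hf : AnalyticAt ℂ f z₀) (h0 : f z₀ ≠ 0) :
    ∃ κ : ℂ → ℂ, AnalyticAt ℂ κ z₀ ∧ κ z₀ ≠ 0 ∧ ∀ z, κ z ^ 3 = f z := by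
  have hr : ∀ a : ℂ, (a ^ (((3 : ℕ) : ℂ)⁻¹)) ^ 3 = a := fun a =>
    Complex.cpow_nat_inv_pow a three_ne_zero
  have hk : ∀ z, (f z₀ ^ (((3 : ℕ) : ℂ)⁻¹) * (f z / f z₀) ^ (((3 : ℕ) : ℂ)⁻¹)) ^ 3 = f z := by
    intro z
    rw [mul_pow, hr, hr, mul_div_cancel₀ _ h0]
  refine ⟨fun z => f z₀ ^ (((3 : ℕ) : ℂ)⁻¹) * (f z / f z₀) ^ (((3 : ℕ) : ℂ)⁻¹), ?_, ?_, hk⟩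
  · refine analyticAt_const.mul ((hf.div analyticAt_const h0).cpow analyticAt_const ?_)
    rw [Pi.div_apply, div_self h0]
    exact Complex.one_mem_slitPlane
  · intro h
    have := hk z₀
    simp only at h
    rw [h] at this
    exact h0 (by rw [← this]; simp)

/-- For consecutive orders W has order exactly 3·n₀. The factor (z - z₀)^(n₀) of `F` thus serves as
the vanishing part of ∛W, and what remains of W has an analytic cube root. -/
theorem HasOrders.exists_isBranch {n : Fin 3 → ℕ} (h : HasOrders F z₀ n)
    (hF : ∀ j, AnalyticAt ℂ (F j) z₀) (h1 : n 1 = n 0 + 1) (h2 : n 2 = n 0 + 2) :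
    ∃ y, IsBranch F z₀ y := by
  have hWord := h.analyticOrderAt_wronskian hF
  obtain ⟨M, hM, hn, hord⟩ := h
  have hG : ∀ j, AnalyticAt ℂ (fun z => ∑ i, M j i * F i z) z₀ := fun j =>
    Finset.analyticAt_fun_sum _ fun i _ => analyticAt_const.mul (hF i)
  have hdiv : ∀ j, ∃ g : ℂ → ℂ, AnalyticAt ℂ g z₀ ∧
      ∀ᶠ z in 𝓝 z₀, ∑ i, M j i * F i z = (z - z₀) ^ n 0 • g z := by
    intro j
    rw [← natCast_le_analyticOrderAt (hG j), hord j]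
    exact_mod_cast hn.monotone (Fin.zero_le j)
  choose g hga hge using hdiv
  let G : Fin 3 → ℂ → ℂ := fun i z => ∑ j, M⁻¹ i j * g j z
  have hGa : ∀ i, AnalyticAt ℂ (G i) z₀ := fun i =>
    Finset.analyticAt_fun_sum _ fun j _ => analyticAt_const.mul (hga j)
  have hFG : ∀ᶠ z in 𝓝 z₀, ∀ i, F i z = (z - z₀) ^ n 0 * G i z := by
    filter_upwards [eventually_all.2 hge] with z hz i
    rw [eq_sum_of_eq_sum hM (f := fun i => F i z) (fun j => rfl) i, Finset.mul_sum]
    refine Finset.sum_congr rfl fun j _ => ?_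
    rw [hz j, smul_eq_mul]
    ring
  have ht : AnalyticAt ℂ (fun z => (z - z₀) ^ n 0) z₀ :=
    (analyticAt_id.sub analyticAt_const).pow _
  have hWG : ∀ᶠ z in 𝓝 z₀, wronskian F z = ((z - z₀) ^ n 0) ^ 3 * wronskian G z := by
    filter_upwards [wronskian_eventuallyEq hFG, ht.eventually_analyticAt,
      eventually_all.2 fun j => (hGa j).eventually_analyticAt] with z a1 a2 a3
    rw [a1, wronskian_mul a2 a3]
  have hWGa := analyticAt_wronskian hGa
  have hW0 : wronskian G z₀ ≠ 0 := by
    rw [← hWGa.analyticOrderAt_eq_zero]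
    have hs : AnalyticAt ℂ (fun z => z - z₀) z₀ := analyticAt_id.sub analyticAt_const
    have hso : analyticOrderAt (fun z => z - z₀) z₀ = ((1 : ℕ) : ℕ∞) := by
      rw [hs.analyticOrderAt_eq_natCast]
      exact ⟨fun _ => 1, analyticAt_const, one_ne_zero, by simp⟩
    have e : wronskian F =ᶠ[𝓝 z₀] (fun z => z - z₀) ^ (n 0 * 3) * wronskian G := by
      filter_upwards [hWG] with z hz
      rw [hz, Pi.mul_apply, Pi.pow_apply, pow_mul]
    have h3 := analyticOrderAt_congr e
    rw [analyticOrderAt_mul (hs.pow _) hWGa, analyticOrderAt_pow hs, hso, hWord] at h3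
    have hnt : analyticOrderAt (wronskian G) z₀ ≠ ⊤ := by
      intro htop
      rw [htop, add_top] at h3
      exact ENat.natCast_ne_top _ h3
    obtain ⟨m, hm⟩ := ENat.ne_top_iff_exists.1 hnt
    rw [← hm, nsmul_eq_mul] at h3
    rw [← hm]
    norm_cast at h3 ⊢
    omega
  obtain ⟨κ, hκ, hκ0, hκ3⟩ := exists_analytic_cube_root hWGa hW0
  refine ⟨fun j z => G j z / κ z, fun j => (hGa j).div hκ hκ0,
    fun z => (z - z₀) ^ n 0 * κ z, ht.mul hκ, ?_⟩
  filter_upwards [hFG, hWG, hκ.continuousAt.eventually_ne hκ0] with z a1 a2 a3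
  refine ⟨by rw [mul_pow, hκ3, a2], fun j => ?_⟩
  rw [a1 j]
  field_simp

/-- A branch exists exactly at the nonsingular points. -/
theorem HasOrders.isSingularPoint_iff {n : Fin 3 → ℕ} (h : HasOrders F z₀ n)
    (hF : ∀ j, AnalyticAt ℂ (F j) z₀) :
    IsSingularPoint (eqQ₂ F) (eqQ₃ F) z₀ ↔ ¬ ∃ y, IsBranch F z₀ y := by
  constructor
  · rintro hs ⟨y, hy⟩
    exact hy.not_isSingularPoint hF (h.eventually_wronskian_ne_zero hF) hs
  · intro hb
    by_contra hs
    have h0 := eq_zero_of_not_isSingularPoint (meromorphicAt_eqQ hF).1 (meromorphicAt_eqQ hF).2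
      (h.hasLocalExponents hF) hs
    simp only [Matrix.cons_val_zero, Matrix.cons_val_one] at h0
    have h01 : n 0 < n 1 := h.strictMono (by decide)
    have h12 : n 1 < n 2 := h.strictMono (by decide)
    exact hb (h.exists_isBranch hF (by omega) (by omega))

theorem HasOrders.isSingularPoint_of_pos {n : Fin 3 → ℕ} (h : HasOrders F z₀ n)
    (hF : ∀ j, AnalyticAt ℂ (F j) z₀) (hn : 0 < n 1 - n 0 - 1 ∨ 0 < n 2 - n 1 - 1) :
    IsSingularPoint (eqQ₂ F) (eqQ₃ F) z₀ := by
  by_contra hs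
  have h0 := eq_zero_of_not_isSingularPoint (meromorphicAt_eqQ hF).1 (meromorphicAt_eqQ hF).2
    (h.hasLocalExponents hF) hs
  simp only [Matrix.cons_val_zero, Matrix.cons_val_one] at h0
  omega

/-- The behaviour of `u` near a point. -/
theorem HasOrders.exists_tendsto_u {n : Fin 3 → ℕ} (h : HasOrders F z₀ n)
    (hF : ∀ j, AnalyticAt ℂ (F j) z₀) {lam mu : ℝ} (hl : 0 < lam) (hm : 0 < mu) (l : Fin 2) :
    ∃ L : ℝ, Tendsto (fun x => u lam mu F l x + ![0, 2] l * Real.log ‖wronskian F x‖ -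
      2 * ((![n 1 - n 0 - 1, n 2 - n 1 - 1] : Fin 2 → ℕ) l : ℝ) * Real.log ‖x - z₀‖)
      (𝓝[≠] z₀) (𝓝 L) := by
  have hJ := h.jetExpansion hF
  have ht := tendsto_sub_nhdsNE z₀
  have ht0 : ∀ᶠ x in 𝓝[≠] z₀, x - z₀ ≠ 0 := (tendsto_nhdsWithin_iff.1 ht).2
  have hW := h.eventually_wronskian_ne_zero hF
  have hℓ : ∀ m, fall 0 m = 1 := fun m => by simp [fall]
  have hℓ1 : Function.Injective (fall 1) := fun a b hab => by
    simpa [fall] using hab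
  obtain ⟨β, hβ, h0⟩ := hJ.exists_tendsto_zero h.strictMono ht hℓ
  obtain ⟨β', hβ', h1⟩ := hJ.exists_tendsto_jetMinors h.strictMono ht hℓ hℓ1
  have t1 := tendsto_log_sum_norm_sq (weights₁_pos hl hm) hβ ht0 h0
  have t2 := tendsto_log_sum_norm_sq (weights₂_pos hl hm) hβ' ht0 h1
  obtain ⟨g, hg, hg0, hge⟩ := (analyticAt_wronskian hF).analyticOrderAt_eq_natCast.1
    (h.analyticOrderAt_wronskian hF)
  have t3 : Tendsto (fun x => Real.log ‖g x‖) (𝓝[≠] z₀) (𝓝 (Real.log ‖g z₀‖)) :=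
    ((hg.continuousAt.norm.log (norm_ne_zero_iff.2 hg0)).tendsto).mono_left nhdsWithin_le_nhds
  have h01 : n 0 < n 1 := h.strictMono (by decide)
  have h12 : n 1 < n 2 := h.strictMono (by decide)
  have c1 : ((n 1 - n 0 - 1 : ℕ) : ℝ) = n 1 - n 0 - 1 := by
    rw [Nat.sub_sub, Nat.cast_sub h01]
    push_cast
    ring
  have c2 : ((n 2 - n 1 - 1 : ℕ) : ℝ) = n 2 - n 1 - 1 := by
    rw [Nat.sub_sub, Nat.cast_sub h12]
    push_cast
    ring
  have c3 : ((n 0 + n 1 + n 2 - 3 : ℕ) : ℝ) = n 0 + n 1 + n 2 - 3 := by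
    rw [Nat.cast_sub (three_le_sum h.strictMono)]
    push_cast
    ring
  have key : ∀ᶠ x in 𝓝[≠] z₀,
      (∑ j, weights₁ lam mu j * ‖jetAt F z₀ j 0 x‖ ^ 2) = sqSum (weights₁ lam mu) F x ∧
      Real.log (∑ j, weights₂ lam mu j * ‖jetMinors (jetAt F z₀) j x‖ ^ 2) =
        2 * Real.log ‖x - z₀‖ + Real.log (sqSum (weights₂ lam mu) (minors F) x) ∧
      Real.log ‖wronskian F x‖ = (n 0 + n 1 + n 2 - 3) * Real.log ‖x - z₀‖ + Real.log ‖g x‖ := by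
    filter_upwards [ht0, hW, hge.filter_mono nhdsWithin_le_nhds] with x hx hWx hgx
    refine ⟨by simp [jetAt, sqSum], ?_, ?_⟩
    · exact log_sqSum_eq_of_eq_mul (G := fun j x => jetMinors (jetAt F z₀) j x) (z := x) (weights₂_pos hl hm) hx
        (exists_ne_of_wronskian_ne hWx).2 fun j => jetMinors_jetAt F z₀ j x
    · have hgx0 : g x ≠ 0 := fun h0 => hWx (by rw [hgx, h0, smul_zero])
      rw [hgx, norm_smul, norm_pow, Real.log_mul (pow_ne_zero _ (norm_ne_zero_iff.2 hx))
        (norm_ne_zero_iff.2 hgx0), Real.log_pow, c3]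
  -- e^{-U₁} and e^{-U₂}, formed from `F`, have orders 2n₀ and 2(n₀ + n₁ - 1), and W has order n₀ +
  -- n₁ + n₂ - 3. The combinations for u₁ and u₂ give 2(n₁ - n₀ - 1) and 2(n₂ - n₁ - 1).
  fin_cases l
  · refine ⟨_, (t2.sub (t1.const_mul 2)).congr' ?_⟩
    filter_upwards [key] with x ⟨e1, e2, e3⟩
    simp only [Fin.zero_eta, u_zero_eq, Matrix.cons_val_zero, c1]
    rw [e1, e2]
    push_cast
    ring
  · refine ⟨_, ((t1.sub (t2.const_mul 2)).add (t3.const_mul 2)).congr' ?_⟩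
    filter_upwards [key] with x ⟨e1, e2, e3⟩
    simp only [Fin.mk_one, u_one_eq, Matrix.cons_val_one, Matrix.cons_val_fin_one]
    rw [e1, e2, e3, c2]
    push_cast
    ring

end Local


/-! ### Exponents and asymptotics at the cusp. -/

/-- The constant `2πi`. -/
def twoPiI : ℂ := 2 * Real.pi * Complex.I

theorem twoPiI_ne_zero : twoPiI ≠ 0 := by
  simp [twoPiI, Real.pi_ne_zero]

theorem continuous_qpar : Continuous qpar :=
  continuous_iff_continuousAt.2 fun x => (hasDerivAt_qpar x).continuousAt

/-- Here d/dz = 2πi q d/dq multiplies a leading term q^N by 2πiN without lowering its order; powers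
replace the falling factorials of a finite point. -/
theorem exists_iteratedDeriv_comp_qpar_eq {G : ℂ → ℂ} (hG : AnalyticAt ℂ G 0) {N : ℕ}
    (hN : analyticOrderAt G 0 = N) : ∃ γ : ℂ, γ ≠ 0 ∧ ∀ k : ℕ, ∃ g : ℂ → ℂ, AnalyticAt ℂ g 0 ∧
      g 0 = (twoPiI * N) ^ k * γ ∧
      ∀ᶠ q in 𝓝 0, ∀ x, qpar x = q →
        iteratedDeriv k (fun x => G (qpar x)) x = q ^ N * g q := by
  obtain ⟨g₀, hg₀, hg₀0, hg₀e⟩ := hG.analyticOrderAt_eq_natCast.1 hN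
  refine ⟨g₀ 0, hg₀0, fun k => ?_⟩
  induction k with
  | zero =>
    refine ⟨g₀, hg₀, by simp, ?_⟩
    filter_upwards [hg₀e] with q hq x hx
    simp [hx, hq]
  | succ k ih =>
    obtain ⟨g, hg, hg0, hge⟩ := ih
    refine ⟨fun q => twoPiI * (N * g q + q * deriv g q), ?_, ?_, ?_⟩
    · exact analyticAt_const.mul ((analyticAt_const.mul hg).add (analyticAt_id.mul hg.deriv))
    · simp only [hg0, zero_mul, add_zero]
      ring
    · filter_upwards [hge.eventually_nhds, hg.eventually_analyticAt] with q hq hgq x hx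
      subst hx
      have e : iteratedDeriv k (fun x => G (qpar x)) =ᶠ[𝓝 x] fun x => qpar x ^ N * g (qpar x) := by
        filter_upwards [continuous_qpar.continuousAt.eventually hq] with x' hx' using hx' x' rfl
      rw [iteratedDeriv_succ, e.deriv_eq]
      have hm : (N : ℂ) * qpar x ^ (N - 1) * qpar x = N * qpar x ^ N := by
        cases N with
        | zero => simp
        | succ m => rw [Nat.add_sub_cancel, pow_succ]; ring
      have hd : HasDerivAt (fun q => q ^ N * g q)
          (N * qpar x ^ (N - 1) * g (qpar x) + qpar x ^ N * deriv g (qpar x)) (qpar x) :=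
        (hasDerivAt_pow N (qpar x)).fun_mul hgq.differentiableAt.hasDerivAt
      rw [deriv_comp_qpar (φ := fun q => q ^ N * g q) ((analyticAt_id.pow N).mul hgq), hd.deriv]
      change twoPiI * _ = _
      linear_combination twoPiI * g (qpar x) * hm

theorem deriv_derivDet {F : Fin 3 → ℂ → ℂ} {z : ℂ} (hF : ∀ j, AnalyticAt ℂ (F j) z) (a b c : ℕ) :
    deriv (derivDet F ![a, b, c]) z = derivDet F ![a + 1, b, c] z + derivDet F ![a, b + 1, c] z +
      derivDet F ![a, b, c + 1] z := by
  have e : derivDet F ![a, b, c] = fun x => _ := funext fun x => derivDet_eq F a b c x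
  have h := fun i k => hasDerivAt_iteratedDeriv (hF i) k
  rw [e]
  refine HasDerivAt.deriv ((((((((h 0 a).fun_mul (h 1 b)).fun_mul (h 2 c)).fun_sub
    (((h 0 a).fun_mul (h 1 c)).fun_mul (h 2 b))).fun_sub
    (((h 0 b).fun_mul (h 1 a)).fun_mul (h 2 c))).fun_add
    (((h 0 b).fun_mul (h 1 c)).fun_mul (h 2 a))).fun_add
    (((h 0 c).fun_mul (h 1 a)).fun_mul (h 2 b))).fun_sub
    (((h 0 c).fun_mul (h 1 b)).fun_mul (h 2 a)) |>.congr_deriv ?_)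
  simp only [derivDet_eq]
  ring

theorem derivDet_self_left (F : Fin 3 → ℂ → ℂ) (a b : ℕ) (z : ℂ) : derivDet F ![a, a, b] z = 0 := by
  rw [derivDet_eq]
  ring

theorem derivDet_self_right (F : Fin 3 → ℂ → ℂ) (a b : ℕ) (z : ℂ) :
    derivDet F ![a, b, b] z = 0 := by
  rw [derivDet_eq]
  ring

/-- With the derivatives of W written as jet determinants, every quotient in `rawQ₂` and `rawQ₃` has
its limit at the cusp given by `JetExpansion.exists_tendsto_jetDet`. -/
theorem iteratedDeriv_wronskian {F : Fin 3 → ℂ → ℂ} {z : ℂ} (hF : ∀ j, AnalyticAt ℂ (F j) z) :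
    iteratedDeriv 1 (wronskian F) z = derivDet F ![0, 1, 3] z ∧
    iteratedDeriv 2 (wronskian F) z = derivDet F ![0, 2, 3] z + derivDet F ![0, 1, 4] z ∧
    iteratedDeriv 3 (wronskian F) z = derivDet F ![1, 2, 3] z + 2 * derivDet F ![0, 2, 4] z +
      derivDet F ![0, 1, 5] z := by
  have h1 : ∀ {x}, (∀ j, AnalyticAt ℂ (F j) x) →
      iteratedDeriv 1 (wronskian F) x = derivDet F ![0, 1, 3] x := fun h => by
    rw [iteratedDeriv_one, deriv_wronskian h]
  have hFe : ∀ᶠ x in 𝓝 z, ∀ j, AnalyticAt ℂ (F j) x :=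
    eventually_all.2 fun j => (hF j).eventually_analyticAt
  have h2 : ∀ {x}, (∀ j, AnalyticAt ℂ (F j) x) →
      iteratedDeriv 2 (wronskian F) x = derivDet F ![0, 2, 3] x + derivDet F ![0, 1, 4] x := by
    intro x h
    have he : ∀ᶠ y in 𝓝 x, ∀ j, AnalyticAt ℂ (F j) y :=
      eventually_all.2 fun j => (h j).eventually_analyticAt
    rw [iteratedDeriv_succ, EventuallyEq.deriv_eq (he.mono fun y hy => h1 hy), deriv_derivDet h,
      derivDet_self_left]
    ring
  refine ⟨h1 hF, h2 hF, ?_⟩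
  rw [iteratedDeriv_succ, EventuallyEq.deriv_eq (hFe.mono fun y hy => h2 hy),
    deriv_fun_add (analyticAt_derivDet hF _).differentiableAt
      (analyticAt_derivDet hF _).differentiableAt, deriv_derivDet hF, deriv_derivDet hF,
    derivDet_self_left, derivDet_self_right]
  ring

section Cusp

variable {k : ℤ} {f : Fin 3 → ModularForm 𝒮ℒ k}

theorem sum_smul_apply (f : Fin 3 → ModularForm 𝒮ℒ k) (a : Fin 3 → ℂ) (z : ℍ) :
    (∑ i, a i • f i) z = ∑ i, a i * f i z := by
  rw [Fin.sum_univ_three, Fin.sum_univ_three]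
  rfl

theorem eq_zero_of_eventually_sum_cuspFun (hf : LinearIndependent ℂ f) (a : Fin 3 → ℂ)
    (h : ∀ᶠ q in 𝓝 (0 : ℂ), ∑ i, a i * cuspFun (f i) q = 0) : a = 0 := by
  have h1 : ∀ᶠ z : ℍ in atImInfty, (∑ i, a i • f i) z = 0 := by
    filter_upwards [(tendsto_qpar.mono_right nhdsWithin_le_nhds).eventually h] with z hz
    rw [← hz, sum_smul_apply]
    refine Finset.sum_congr rfl fun i _ => ?_
    rw [← ext_eq_cuspFun _ z.im_pos, ext_coe]
  have h2 : ∑ i, a i • f i = 0 := by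
    by_contra hne
    obtain ⟨Y, hY⟩ := (atImInfty_mem _).1 h1
    let z : ℍ := ⟨⟨0, |Y| + 1⟩, by positivity⟩
    have hz : Y < (z : ℂ).im := lt_of_le_of_lt (le_abs_self Y) (lt_add_one _)
    have e1 : ∀ᶠ x in 𝓝 (z : ℂ), Y < x.im ∧ 0 < x.im :=
      (Complex.continuous_im.continuousAt.eventually (lt_mem_nhds hz)).and (eventually_im_pos z)
    obtain ⟨x, hx1, hx2⟩ := ((eventually_modularForm_ne_zero hne z).and
      (e1.filter_mono nhdsWithin_le_nhds)).exists
    refine hx1 ?_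
    rw [ext_of_im_pos _ hx2.2]
    exact hY ⟨x, hx2.2⟩ hx2.1.le
  exact funext fun i => (Fintype.linearIndependent_iff.1 hf) a h2 i

theorem eq_zero_of_eventually_sum_ext (hf : LinearIndependent ℂ f) (z₀ : ℍ) (a : Fin 3 → ℂ)
    (h : ∀ᶠ z in 𝓝 (z₀ : ℂ), ∑ i, a i * ext (f i) z = 0) : a = 0 := by
  have h2 : ∑ i, a i • f i = 0 := by
    by_contra hne
    obtain ⟨x, hx1, hx2⟩ := ((eventually_modularForm_ne_zero hne z₀).and
      (h.filter_mono nhdsWithin_le_nhds)).exists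
    refine hx1 (Eq.trans ?_ hx2)
    rw [ext, sum_smul_apply]
    rfl
  exact funext fun i => (Fintype.linearIndependent_iff.1 hf) a h2 i

theorem exists_hasOrders (hf : LinearIndependent ℂ f) (z₀ : ℍ) :
    ∃ n, HasOrders (fun i => ext (f i)) z₀ n := by
  obtain ⟨M, n, h⟩ := exists_adapted_basis (fun j => analyticAt_ext (f j) z₀)
    (eq_zero_of_eventually_sum_ext hf z₀)
  exact ⟨n, M, h⟩

theorem exists_jetExpansion_cusp (hf : LinearIndependent ℂ f) : ∃ n : Fin 3 → ℕ, StrictMono n ∧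
    JetExpansion atImInfty (fun z : ℍ => qpar z) (fun k N => (twoPiI * N) ^ k) n
      (fun i k z => iteratedDeriv k (ext (f i)) z) := by
  have hc : ∀ i, AnalyticAt ℂ (cuspFun (f i)) 0 := fun i => analyticAt_cuspFun (f i) (by simp)
  obtain ⟨M, n, hM, hn, hord⟩ := exists_adapted_basis hc (eq_zero_of_eventually_sum_cuspFun hf)
  have hG : ∀ j, AnalyticAt ℂ (fun q => ∑ i, M j i * cuspFun (f i) q) 0 := fun j =>
    Finset.analyticAt_fun_sum _ fun i _ => analyticAt_const.mul (hc i)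
  choose γ hγ hg using fun j => exists_iteratedDeriv_comp_qpar_eq (hG j) (hord j)
  choose g hga hg0 hge using hg
  have hq := tendsto_qpar.mono_right (nhdsWithin_le_nhds (s := {(0 : ℂ)}ᶜ))
  let G : Fin 3 → ℂ → ℂ := fun j x => ∑ i, M j i * cuspFun (f i) (qpar x)
  refine ⟨n, hn, M⁻¹, γ, fun j k z => iteratedDeriv k (G j) z / qpar z ^ n j,
    det_inv_ne_zero hM, hγ, fun j k => ?_, ?_⟩
  · rw [← hg0]
    refine ((hga j k).continuousAt.tendsto.comp hq).congr' ?_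
    filter_upwards [hq.eventually (hge j k)] with z hz
    rw [Function.comp, hz z rfl, mul_div_cancel_left₀]
    exact pow_ne_zero _ (qpar_ne_zero _)
  · refine .of_forall fun z i k => ?_
    have hqa : AnalyticAt ℂ qpar z := by
      have : Differentiable ℂ qpar := fun x => (hasDerivAt_qpar x).differentiableAt
      exact this.analyticAt z
    have hGa : ∀ j, AnalyticAt ℂ (G j) z := fun j =>
      Finset.analyticAt_fun_sum _ fun i _ => analyticAt_const.mul
        ((analyticAt_cuspFun (f i) (norm_qpar_lt_one z.im_pos)).comp hqa)
    have e : ext (f i) =ᶠ[𝓝 (z : ℂ)] fun x => ∑ j, M⁻¹ i j * G j x := by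
      filter_upwards [eventually_im_pos z] with x hx
      rw [ext_eq_cuspFun _ hx]
      exact eq_sum_of_eq_sum hM (f := fun i => cuspFun (f i) (qpar x)) (fun j => rfl) i
    change iteratedDeriv k (ext (f i)) z =
      ∑ j, M⁻¹ i j * (qpar z ^ n j * (iteratedDeriv k (G j) z / qpar z ^ n j))
    rw [Filter.EventuallyEq.iteratedDeriv_eq k e,
      iteratedDeriv_fun_sum (f := fun j x => M⁻¹ i j * G j x)
        fun j _ => (analyticAt_const.mul (hGa j)).contDiffAt]
    simp only [iteratedDeriv_const_mul_field]
    refine Finset.sum_congr rfl fun j _ => ?_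
    have : qpar z ^ n j ≠ 0 := pow_ne_zero _ (qpar_ne_zero _)
    field_simp

theorem det_pow (n : Fin 3 → ℕ) (a b c : ℕ) :
    Matrix.det (Matrix.of fun j i : Fin 3 => (twoPiI * n j) ^ (![a, b, c] i)) =
      twoPiI ^ (a + b + c) * (
        (n 0 : ℂ) ^ a * n 1 ^ b * n 2 ^ c - n 0 ^ a * n 1 ^ c * n 2 ^ b -
        n 0 ^ b * n 1 ^ a * n 2 ^ c + n 0 ^ b * n 1 ^ c * n 2 ^ a +
        n 0 ^ c * n 1 ^ a * n 2 ^ b - n 0 ^ c * n 1 ^ b * n 2 ^ a) := by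
  rw [Matrix.det_fin_three]
  simp only [Matrix.of_apply, Matrix.cons_val_zero, Matrix.cons_val_one, Matrix.cons_val, mul_pow]
  ring

/-- The asymptotic behaviour at the cusp. -/
theorem exists_cusp_orders (hf : LinearIndependent ℂ f) : ∃ m : Fin 2 → ℕ, (∀ l, 1 ≤ m l) ∧
    (∀ᶠ z : ℍ in atImInfty, wronskian (fun i => ext (f i)) z ≠ 0) ∧
    HasLocalExponentsAtCusp (eqQ₂ fun i => ext (f i)) (eqQ₃ fun i => ext (f i)) (exponents 0 m) ∧
    ∀ lam mu : ℝ, 0 < lam → 0 < mu → ∀ l : Fin 2, ∃ L : ℝ,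
      Tendsto (fun z : ℍ => u lam mu (fun i => ext (f i)) l z +
        ![0, 2] l * Real.log ‖wronskian (fun i => ext (f i)) z‖ - 2 * m l * Real.log ‖qpar z‖)
        atImInfty (𝓝 L) := by
  obtain ⟨n, hn, hJ⟩ := exists_jetExpansion_cusp hf
  set F : Fin 3 → ℂ → ℂ := fun i => ext (f i)
  have hF : ∀ (z : ℍ) j, AnalyticAt ℂ (F j) z := fun z j => analyticAt_ext (f j) z
  have ht0 : ∀ z : ℍ, qpar z ≠ 0 := fun z => qpar_ne_zero _
  have h01 : n 0 < n 1 := hn (by decide)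
  have h12 : n 1 < n 2 := hn (by decide)
  have hV := vandermonde_ne_zero hn
  obtain ⟨C, hC, hD⟩ := hJ.exists_tendsto_jetDet (.of_forall ht0)
  have hτ := twoPiI_ne_zero
  have hD' : ∀ a b c : ℕ, Tendsto (fun z : ℍ => derivDet F ![a, b, c] z /
      qpar z ^ (n 0 + n 1 + n 2)) atImInfty (𝓝 (C * (twoPiI ^ (a + b + c) * (
        (n 0 : ℂ) ^ a * n 1 ^ b * n 2 ^ c - n 0 ^ a * n 1 ^ c * n 2 ^ b -
        n 0 ^ b * n 1 ^ a * n 2 ^ c + n 0 ^ b * n 1 ^ c * n 2 ^ a +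
        n 0 ^ c * n 1 ^ a * n 2 ^ b - n 0 ^ c * n 1 ^ b * n 2 ^ a)))) := fun a b c => by
    rw [← det_pow]
    exact hD ![a, b, c]
  set V : ℂ := ((n 1 : ℂ) - n 0) * ((n 2 : ℂ) - n 0) * ((n 2 : ℂ) - n 1) with hVdef
  have hW : Tendsto (fun z : ℍ => wronskian F z / qpar z ^ (n 0 + n 1 + n 2)) atImInfty
      (𝓝 (C * (twoPiI ^ 3 * V))) := by
    have := hD' 0 1 2
    simp only [derivDet_wronskian] at this
    convert! this using 4
    rw [hVdef]
    ring
  have hL : C * (twoPiI ^ 3 * V) ≠ 0 := mul_ne_zero hC (mul_ne_zero (pow_ne_zero _ hτ) hV)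
  have hWne : ∀ᶠ z : ℍ in atImInfty, wronskian F z ≠ 0 := by
    filter_upwards [hW.eventually_ne hL] with z hz h0
    exact hz (by rw [h0, zero_div])
  have ratio : ∀ (D : ℍ → ℂ) (r : ℂ), Tendsto (fun z : ℍ => D z / qpar z ^ (n 0 + n 1 + n 2))
      atImInfty (𝓝 (r * (C * (twoPiI ^ 3 * V)))) →
      Tendsto (fun z : ℍ => D z / wronskian F z) atImInfty (𝓝 r) := by
    intro D r h
    have := h.div hW hL
    rw [mul_div_cancel_right₀ _ hL] at this
    refine this.congr' ?_
    filter_upwards [hWne] with z hz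
    have := pow_ne_zero (n 0 + n 1 + n 2) (ht0 z)
    rw [Pi.div_apply]
    field_simp
  have p2 : Tendsto (fun z : ℍ => derivDet F ![0, 2, 3] z / wronskian F z) atImInfty
      (𝓝 (twoPiI ^ 2 * (n 0 * n 1 + n 1 * n 2 + n 2 * n 0))) := by
    refine ratio _ _ ?_
    convert! hD' 0 2 3 using 2
    rw [hVdef]
    ring
  have p3 : Tendsto (fun z : ℍ => derivDet F ![1, 2, 3] z / wronskian F z) atImInfty
      (𝓝 (twoPiI ^ 3 * (n 0 * n 1 * n 2))) := by
    refine ratio _ _ ?_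
    convert! hD' 1 2 3 using 2
    rw [hVdef]
    ring
  have r1 : Tendsto (fun z : ℍ => iteratedDeriv 1 (wronskian F) z / wronskian F z) atImInfty
      (𝓝 (twoPiI * (n 0 + n 1 + n 2))) := by
    simp only [(iteratedDeriv_wronskian (hF _)).1]
    refine ratio _ _ ?_
    convert! hD' 0 1 3 using 2
    rw [hVdef]
    ring
  have r2 : Tendsto (fun z : ℍ => iteratedDeriv 2 (wronskian F) z / wronskian F z) atImInfty
      (𝓝 ((twoPiI * (n 0 + n 1 + n 2)) ^ 2)) := by
    simp only [(iteratedDeriv_wronskian (hF _)).2.1]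
    refine ratio _ _ ?_
    convert! (hD' 0 2 3).add (hD' 0 1 4) using 2
    · rw [add_div]
    · rw [hVdef]
      ring
  have r3 : Tendsto (fun z : ℍ => iteratedDeriv 3 (wronskian F) z / wronskian F z) atImInfty
      (𝓝 ((twoPiI * (n 0 + n 1 + n 2)) ^ 3)) := by
    simp only [(iteratedDeriv_wronskian (hF _)).2.2]
    refine ratio _ _ ?_
    convert! ((hD' 1 2 3).add ((hD' 0 2 4).const_mul 2)).add (hD' 0 1 5) using 2
    · rw [add_div, add_div, mul_div_assoc]
    · rw [hVdef]
      ring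
  have c1 : ((n 1 - n 0 : ℕ) : ℂ) = n 1 - n 0 := Nat.cast_sub h01.le
  have c2 : ((n 2 - n 1 : ℕ) : ℂ) = n 2 - n 1 := Nat.cast_sub h12.le
  have d1 : ((n 1 - n 0 : ℕ) : ℝ) = n 1 - n 0 := Nat.cast_sub h01.le
  have d2 : ((n 2 - n 1 : ℕ) : ℝ) = n 2 - n 1 := Nat.cast_sub h12.le
  -- As derivatives do not lower orders in q, W has order n₀ + n₁ + n₂ with no -3, and the exponents
  -- are n_j - (n₀ + n₁ + n₂)/3. Hence the gaps occur without -1, and distinct orders make them at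
  -- least 1.
  refine ⟨![n 1 - n 0, n 2 - n 1], fun l => ?_, hWne, ?_, fun lam mu hl hm l => ?_⟩
  · fin_cases l
    · exact Nat.sub_pos_of_lt h01
    · exact Nat.sub_pos_of_lt h12
  · refine ⟨_, _, Tendsto.congr' ?_ ((r2.sub ((r1.pow 2).const_mul (4 / 3))).add p2),
      Tendsto.congr' ?_ (((((r3.const_mul (1 / 3)).sub (r1.mul r2)).add
      ((r1.pow 3).const_mul (16 / 27))).add ((p2.mul r1).const_mul (1 / 3))).sub p3), ?_⟩
    · filter_upwards [hWne] with z hz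
      rw [(eqQ_eq (hF z) hz).1, rawQ₂]
    · filter_upwards [hWne] with z hz
      rw [(eqQ_eq (hF z) hz).2, rawQ₃]
    · intro X
      change _ + _ / twoPiI ^ 2 * X + _ / twoPiI ^ 3 = _
      simp only [exponents, Fin.prod_univ_three, Matrix.cons_val_zero, Matrix.cons_val_one,
        Matrix.cons_val, c1, c2]
      push_cast
      field_simp
      ring
  · have ht := tendsto_qpar
    have hℓ1 : Function.Injective fun N : ℕ => (twoPiI * N) ^ 1 := fun a b hab => by
      simpa [hτ] using hab
    obtain ⟨β, hβ, h0⟩ := hJ.exists_tendsto_zero hn ht (fun m => pow_zero _)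
    obtain ⟨β', hβ', h1⟩ := hJ.exists_tendsto_jetMinors hn ht (fun m => pow_zero _) hℓ1
    have t1 := tendsto_log_sum_norm_sq (weights₁_pos hl hm) hβ (.of_forall ht0) h0
    have t2 := tendsto_log_sum_norm_sq (weights₂_pos hl hm) hβ' (.of_forall ht0) h1
    have t3 := (Real.continuousAt_log (norm_ne_zero_iff.2 hL)).tendsto.comp hW.norm
    have e1 : ∀ z : ℍ, (∑ j, weights₁ lam mu j * ‖iteratedDeriv 0 (ext (f j)) z‖ ^ 2) =
        sqSum (weights₁ lam mu) F z := fun z => by simp [sqSum, F]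
    have e2 : ∀ z : ℍ, (∑ j, weights₂ lam mu j *
        ‖jetMinors (fun i k (z : ℍ) => iteratedDeriv k (ext (f i)) z) j z‖ ^ 2) =
        sqSum (weights₂ lam mu) (minors F) z := fun z => by
      rw [sqSum]
      refine Finset.sum_congr rfl fun j _ => ?_
      fin_cases j <;> simp [jetMinors, minors, wronskian₂, F]
    simp only [e1] at t1
    simp only [e2] at t2
    have key : ∀ᶠ z : ℍ in atImInfty, Real.log ‖wronskian F z / qpar z ^ (n 0 + n 1 + n 2)‖ =
        Real.log ‖wronskian F z‖ - (n 0 + n 1 + n 2) * Real.log ‖qpar z‖ := by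
      filter_upwards [hWne] with z hz
      rw [norm_div, norm_pow, Real.log_div (norm_ne_zero_iff.2 hz)
        (pow_ne_zero _ (norm_ne_zero_iff.2 (ht0 z))), Real.log_pow]
      push_cast
      ring
    fin_cases l
    · refine ⟨_, (t2.sub (t1.const_mul 2)).congr' ?_⟩
      filter_upwards with z
      simp only [Fin.zero_eta, u_zero_eq, Matrix.cons_val_zero, d1]
      push_cast
      ring
    · refine ⟨_, ((t1.sub (t2.const_mul 2)).add (t3.const_mul 2)).congr' ?_⟩
      filter_upwards [key] with z e3
      simp only [Fin.mk_one, u_one_eq, Matrix.cons_val_one, Matrix.cons_val_fin_one, d2,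
        Function.comp]
      rw [e3]
      push_cast
      ring

end Cusp


/-! ### Modular covariance of branches; the elliptic points; finiteness of singularities. -/

/-- A triple of modular forms as functions of a complex variable. -/
abbrev extTriple {k : ℤ} (f : Fin 3 → ModularForm 𝒮ℒ k) : Fin 3 → ℂ → ℂ := fun i => ext (f i)

theorem exists_analytic_local_inverse {f : ℂ → ℂ} {z : ℂ} (hf : AnalyticAt ℂ f z)
    (h : deriv f z ≠ 0) : ∃ ζ : ℂ → ℂ, AnalyticAt ℂ ζ (f z) ∧ ζ (f z) = z ∧
      ∀ᶠ x in 𝓝 (f z), f (ζ x) = x := by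
  have hc : ContDiffAt ℂ ω f z := hf.contDiffAt
  have hs := hf.hasStrictDerivAt.hasStrictFDerivAt_equiv h
  have hw : (ω : WithTop ℕ∞) ≠ 0 := by simp
  refine ⟨hc.localInverse hs.hasFDerivAt hw, ?_, ?_, ?_⟩
  · exact (hc.to_localInverse hs.hasFDerivAt hw).analyticAt
  · exact hs.localInverse_apply_image
  · exact hs.eventually_right_inverse

section Transport

variable {k : ℤ} {f : Fin 3 → ModularForm 𝒮ℒ k}

theorem analyticAt_extTriple (f : Fin 3 → ModularForm 𝒮ℒ k) (z : ℍ) (j : Fin 3) :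
    AnalyticAt ℂ (extTriple f j) z := analyticAt_ext (f j) z

theorem eventually_wronskian_ne_zero (hf : LinearIndependent ℂ f) (z : ℍ) :
    ∀ᶠ x in 𝓝[≠] (z : ℂ), wronskian (extTriple f) x ≠ 0 := by
  obtain ⟨n, hn⟩ := exists_hasOrders hf z
  exact hn.eventually_wronskian_ne_zero (analyticAt_extTriple f z)

theorem analyticAt_denom (γ : SL(2, ℤ)) (x : ℂ) : AnalyticAt ℂ (denom (γ : GL (Fin 2) ℝ)) x := by
  have : denom (γ : GL (Fin 2) ℝ) = fun x => ((γ 1 0 : ℤ) : ℂ) * x + (γ 1 1 : ℤ) :=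
    funext (denom_eq γ)
  rw [this]
  exact (analyticAt_const.mul analyticAt_id).add analyticAt_const

theorem ext_mobius_eq (g : ModularForm 𝒮ℒ k) (γ : SL(2, ℤ)) {x : ℂ} (hx : 0 < x.im) :
    ext g (mobius γ x) = denom (γ : GL (Fin 2) ℝ) x ^ k * ext g x := by
  rw [ext_mobius _ _ hx, modularForm_smul, ext_of_im_pos _ hx]

/-- Branches are transported by the modular group. -/
theorem IsBranch.transport_mobius (hf : LinearIndependent ℂ f) {γ : SL(2, ℤ)} {z : ℍ}
    {y : Fin 3 → ℂ → ℂ} (h : IsBranch (extTriple f) (γ • z : ℍ) y) :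
    IsBranch (extTriple f) z (transport (mobius γ) y) := by
  have hW := h.wronskian_eq_one (eventually_wronskian_ne_zero hf _)
  obtain ⟨c, hc, hq⟩ := h.quotient
  have hy := h.analyticAt
  rw [← mobius_coe] at hW hc hq hy
  have hμ := analyticAt_mobius γ z
  have hd := analyticAt_denom γ z
  have hd0 := denom_smul_ne_zero γ z
  have hμ0 := deriv_mobius_ne_zero γ z
  -- From F(γx) = denom^k F(x), F = c y at γx, and y(γx) = γ'(x) · (transported y)(x).
  refine .of_wronskian_eq_one (c := fun x => denom (γ : GL (Fin 2) ℝ) x ^ (-k) *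
    (c (mobius γ x) * deriv (mobius γ) x)) (analyticAt_transport hμ hy hμ0)
    ((hd.zpow hd0).mul ((hc.comp hμ).mul hμ.deriv)) ?_ ?_
  · filter_upwards [hμ.continuousAt.eventually hq, eventually_im_pos z,
      hμ.deriv.continuousAt.eventually_ne hμ0] with x hx him hx0 j
    have hdx : denom (γ : GL (Fin 2) ℝ) x ≠ 0 := denom_smul_ne_zero γ ⟨x, him⟩
    have e1 : c (mobius γ x) * y j (mobius γ x) =
        denom (γ : GL (Fin 2) ℝ) x ^ k * extTriple f j x :=
      (hx.2 j).trans (ext_mobius_eq _ _ him)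
    rw [transport, zpow_neg]
    have := zpow_ne_zero k hdx
    field_simp
    linear_combination -e1
  · filter_upwards [hμ.continuousAt.eventually hW, eventually_im_pos z,
      hμ.continuousAt.eventually (eventually_all.2 fun j => (hy j).eventually_analyticAt)]
      with x hx him hyx
    rw [wronskian_transport (analyticAt_mobius γ ⟨x, him⟩) hyx (deriv_mobius_ne_zero γ ⟨x, him⟩), hx]

theorem exists_isBranch_smul_iff (hf : LinearIndependent ℂ f) (γ : SL(2, ℤ)) (z : ℍ) :
    (∃ y, IsBranch (extTriple f) (γ • z : ℍ) y) ↔ ∃ y, IsBranch (extTriple f) z y := by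
  constructor
  · rintro ⟨y, hy⟩
    exact ⟨_, hy.transport_mobius hf⟩
  · rintro ⟨y, hy⟩
    have hz : z = γ⁻¹ • (γ • z) := by simp
    rw [hz] at hy
    exact ⟨_, hy.transport_mobius hf⟩

theorem exists_isBranch_of_wronskian_ne_zero {z : ℍ} (hW : wronskian (extTriple f) z ≠ 0) :
    ∃ y, IsBranch (extTriple f) z y := by
  have hF := analyticAt_extTriple f z
  have hWa := analyticAt_wronskian hF
  obtain ⟨κ, hκ, hκ0, hκ3⟩ := exists_analytic_cube_root hWa hW
  refine ⟨fun j x => extTriple f j x / κ x, fun j => (hF j).div hκ hκ0, κ, hκ, ?_⟩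
  filter_upwards [hκ.continuousAt.eventually_ne hκ0] with x hx
  exact ⟨hκ3 x, fun j => mul_div_cancel₀ _ hx⟩

/-- The order of vanishing of a modular form at a fixed point of `γ`. -/
theorem pow_deriv_mobius_eq {g : ModularForm 𝒮ℒ k} {γ : SL(2, ℤ)} {z₀ : ℍ} (hγ : γ • z₀ = z₀)
    {n : ℕ} (hn : analyticOrderAt (ext g) z₀ = n) :
    deriv (mobius γ) z₀ ^ n = denom (γ : GL (Fin 2) ℝ) z₀ ^ k := by
  obtain ⟨G, hG, hG0, hGe⟩ := (analyticAt_ext g z₀).analyticOrderAt_eq_natCast.1 hn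
  have hμ := analyticAt_mobius γ z₀
  have hfix : mobius γ z₀ = z₀ := by rw [mobius_coe, hγ]
  have hμt : Tendsto (mobius γ) (𝓝 (z₀ : ℂ)) (𝓝 z₀) := by
    have := hμ.continuousAt.tendsto
    rwa [hfix] at this
  have t1 : Tendsto (fun x => denom (γ : GL (Fin 2) ℝ) x ^ k * G x) (𝓝[≠] (z₀ : ℂ))
      (𝓝 (denom (γ : GL (Fin 2) ℝ) z₀ ^ k * G z₀)) :=
    ((((analyticAt_denom γ z₀).zpow (denom_smul_ne_zero γ z₀)).continuousAt.tendsto).mul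
      hG.continuousAt.tendsto).mono_left nhdsWithin_le_nhds
  have hslope : Tendsto (fun x => (mobius γ x - z₀) / (x - z₀)) (𝓝[≠] (z₀ : ℂ))
      (𝓝 (deriv (mobius γ) z₀)) := by
    have := hasDerivAt_iff_tendsto_slope.1 hμ.differentiableAt.hasDerivAt
    refine this.congr fun x => ?_
    rw [slope_def_field, hfix]
  have t2 : Tendsto (fun x => ((mobius γ x - z₀) / (x - z₀)) ^ n * G (mobius γ x))
      (𝓝[≠] (z₀ : ℂ)) (𝓝 (deriv (mobius γ) z₀ ^ n * G z₀)) :=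
    (hslope.pow n).mul ((hG.continuousAt.tendsto.comp hμt).mono_left nhdsWithin_le_nhds)
  -- Both limits are leading coefficients at z₀ of the two sides of g(γx) = denom^k g(x).
  have key := tendsto_nhds_unique t1 (t2.congr' ?_)
  · exact (mul_right_cancel₀ hG0 key).symm
  · filter_upwards [hGe.filter_mono nhdsWithin_le_nhds,
      (hμt.eventually hGe).filter_mono nhdsWithin_le_nhds,
      (eventually_im_pos z₀).filter_mono nhdsWithin_le_nhds, self_mem_nhdsWithin] with x e1 e2 him hx
    have hx0 : (x - z₀) ^ n ≠ 0 := pow_ne_zero _ (sub_ne_zero.2 hx)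
    rw [ext_mobius_eq _ _ him, e1, smul_eq_mul, smul_eq_mul] at e2
    rw [div_pow]
    field_simp
    linear_combination -e2

theorem HasOrders.pow_deriv_mobius_eq {z₀ : ℍ} {n : Fin 3 → ℕ} (h : HasOrders (extTriple f) z₀ n)
    {γ : SL(2, ℤ)} (hγ : γ • z₀ = z₀) (j : Fin 3) :
    deriv (mobius γ) z₀ ^ n j = denom (γ : GL (Fin 2) ℝ) z₀ ^ k := by
  obtain ⟨M, -, -, hord⟩ := h
  refine TodaModular.pow_deriv_mobius_eq (g := ∑ i, M j i • f i) hγ ?_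
  rw [← hord j]
  congr 1

/-- The power γ'(z₀)^(n j) is the same for every j, so the gaps are multiples of the order of the
root of unity γ'(z₀). At i it is -1; at ρ it is a primitive cube root of unity. -/
theorem HasOrders.pow_sub_deriv_mobius_eq_one {z₀ : ℍ} {n : Fin 3 → ℕ}
    (h : HasOrders (extTriple f) z₀ n) {γ : SL(2, ℤ)} (hγ : γ • z₀ = z₀) {i j : Fin 3} (hij : i < j) :
    deriv (mobius γ) z₀ ^ (n j - n i) = 1 := by
  have hn := (h.strictMono hij).le
  have h1 := h.pow_deriv_mobius_eq hγ j
  rw [← h.pow_deriv_mobius_eq hγ i, ← Nat.sub_add_cancel hn, pow_add] at h1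
  exact mul_right_cancel₀ (pow_ne_zero _ (deriv_mobius_ne_zero γ z₀)) (by rw [h1, one_mul])

theorem deriv_mobius_S_I : deriv (mobius ModularGroup.S) I = -1 := by
  rw [deriv_mobius, denom_eq]
  simp [ModularGroup.S]

theorem HasOrders.two_le_I {n : Fin 3 → ℕ} (h : HasOrders (extTriple f) I n) {i j : Fin 3}
    (hij : i < j) : n i + 2 ≤ n j := by
  have hS : ModularGroup.S • I = I := ModularGroup.stabilizer_I.2 (by simp)
  have h1 := h.pow_sub_deriv_mobius_eq_one hS hij
  rw [deriv_mobius_S_I] at h1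
  have hn := h.strictMono hij
  by_contra! hlt
  have : n j - n i = 1 := by omega
  rw [this] at h1
  norm_num at h1

theorem HasOrders.three_le_rho {n : Fin 3 → ℕ} (h : HasOrders (extTriple f) rho n) {i j : Fin 3}
    (hij : i < j) : n i + 3 ≤ n j := by
  have h1 := h.pow_sub_deriv_mobius_eq_one elliptic₃_smul_rho hij
  rw [deriv_mobius, denom_elliptic₃, inv_pow, inv_eq_one, ← pow_mul] at h1
  have hn := h.strictMono hij
  have h2 := rho_sq
  by_contra! hlt
  have : n j - n i = 1 ∨ n j - n i = 2 := by omega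
  rcases this with h3 | h3
  · rw [h3] at h1
    have h4 : (rho : ℂ) = 1 := by linear_combination h1 - h2
    rw [h4] at h2
    norm_num at h2
  · rw [h3] at h1
    have h4 : (rho : ℂ) = -2 := by
      linear_combination ((rho : ℂ) ^ 2 + 3 * rho + 2) * h2 - h1
    rw [h4] at h2
    norm_num at h2

theorem isSingularPoint_iff (hf : LinearIndependent ℂ f) (z : ℍ) :
    IsSingularPoint (eqQ₂ (extTriple f)) (eqQ₃ (extTriple f)) z ↔
      ¬ ∃ y, IsBranch (extTriple f) z y := by
  obtain ⟨n, hn⟩ := exists_hasOrders hf z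
  exact hn.isSingularPoint_iff (analyticAt_extTriple f z)

theorem isSingularPoint_smul_iff (hf : LinearIndependent ℂ f) (γ : SL(2, ℤ)) (z : ℍ) :
    IsSingularPoint (eqQ₂ (extTriple f)) (eqQ₃ (extTriple f)) (γ • z : ℍ) ↔
      IsSingularPoint (eqQ₂ (extTriple f)) (eqQ₃ (extTriple f)) z := by
  rw [isSingularPoint_iff hf, isSingularPoint_iff hf, exists_isBranch_smul_iff hf]

theorem Equivalent.isSingularPoint_iff (hf : LinearIndependent ℂ f) {a b : ℍ}
    (h : Equivalent a b) : IsSingularPoint (eqQ₂ (extTriple f)) (eqQ₃ (extTriple f)) b ↔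
      IsSingularPoint (eqQ₂ (extTriple f)) (eqQ₃ (extTriple f)) a := by
  obtain ⟨γ, rfl⟩ := h
  exact isSingularPoint_smul_iff hf γ a

theorem isSingularPoint_I (hf : LinearIndependent ℂ f) :
    IsSingularPoint (eqQ₂ (extTriple f)) (eqQ₃ (extTriple f)) I := by
  obtain ⟨n, hn⟩ := exists_hasOrders hf I
  refine hn.isSingularPoint_of_pos (analyticAt_extTriple f I) (.inl ?_)
  have := hn.two_le_I (i := 0) (j := 1) (by decide)
  omega

theorem isSingularPoint_rho (hf : LinearIndependent ℂ f) :
    IsSingularPoint (eqQ₂ (extTriple f)) (eqQ₃ (extTriple f)) rho := by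
  obtain ⟨n, hn⟩ := exists_hasOrders hf rho
  refine hn.isSingularPoint_of_pos (analyticAt_extTriple f rho) (.inl ?_)
  have := hn.three_le_rho (i := 0) (j := 1) (by decide)
  omega

/-- The zeros of w' are equivalent to i or ρ, which are singular for every triple. So w is a local
coordinate at each non-singular point. -/
theorem deriv_wfun_ne_zero_of_not_isSingularPoint (hf : LinearIndependent ℂ f) {z : ℍ}
    (h : ¬ IsSingularPoint (eqQ₂ (extTriple f)) (eqQ₃ (extTriple f)) z) :
    deriv (ext wfun) z ≠ 0 := by
  apply wfun_order_one
  · rw [Ne, E₄_eq_zero_iff, ← wfun_rho, wfun_eq_wfun_iff]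
    exact fun he => h ((he.isSingularPoint_iff hf).2 (isSingularPoint_rho hf))
  · rw [Ne, E₆_eq_zero_iff, ← wfun_I, wfun_eq_wfun_iff]
    exact fun he => h ((he.isSingularPoint_iff hf).2 (isSingularPoint_I hf))

/-- W has no zeros high up, and singular points lie among the zeros of W. These are isolated, while
the truncated fundamental domain is compact. -/
theorem finite_singular (hf : LinearIndependent ℂ f) :
    {z : ℍ | z ∈ ModularGroup.fd ∧
      IsSingularPoint (eqQ₂ (extTriple f)) (eqQ₃ (extTriple f)) z}.Finite := by
  obtain ⟨m, -, hW, -⟩ := exists_cusp_orders hf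
  obtain ⟨Y, hY⟩ := (atImInfty_mem _).1 hW
  by_contra hinf
  have hinf : Set.Infinite _ := hinf
  have hsub : {z : ℍ | z ∈ ModularGroup.fd ∧
      IsSingularPoint (eqQ₂ (extTriple f)) (eqQ₃ (extTriple f)) z} ⊆
      ModularGroup.truncatedFundamentalDomain Y := by
    rintro z ⟨hz, hs⟩
    refine ⟨hz, ?_⟩
    by_contra! hlt
    exact (isSingularPoint_iff hf z).1 hs
      (exists_isBranch_of_wronskian_ne_zero (hY z hlt.le))
  obtain ⟨z, -, hz⟩ := hinf.exists_accPt_of_subset_isCompact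
    (ModularGroup.isCompact_truncatedFundamentalDomain Y) hsub
  rw [accPt_iff_frequently_nhdsNE] at hz
  have he : Tendsto ((↑) : ℍ → ℂ) (𝓝[≠] z) (𝓝[≠] (z : ℂ)) :=
    tendsto_nhdsWithin_iff.2 ⟨(continuous_coe.tendsto z).mono_left nhdsWithin_le_nhds, by
      filter_upwards [self_mem_nhdsWithin] with x hx
      exact fun h => hx (UpperHalfPlane.ext h)⟩
  refine hz ((he.eventually (eventually_wronskian_ne_zero hf z)).mono fun x hx hs => ?_)
  exact (isSingularPoint_iff hf x).1 hs.2 (exists_isBranch_of_wronskian_ne_zero hx)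

end Transport


/-! ### Descent to the plane and the singularities of v. -/

section Toda

variable {k : ℤ} {f : Fin 3 → ModularForm 𝒮ℒ k}

open Classical in
/-- The function `v` on the plane with `v (w z) = u z - 2 log |w' z|`. -/
def toda (f : Fin 3 → ModularForm 𝒮ℒ k) (lam mu : ℝ) (l : Fin 2) (x : ℂ) : ℝ :=
  if h : ∃ y, IsBranch (extTriple f) (wfun_surjective x).choose y then
    u lam mu h.choose l (wfun_surjective x).choose -
      2 * Real.log ‖deriv (ext wfun) (wfun_surjective x).choose‖
  -- A default at the images of singular points, a finite set on which no value of v is prescribed.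
  else 0

/-- `u - 2 log |w'|` is invariant under the modular group. -/
theorem IsBranch.u_sub_log_eq (hf : LinearIndependent ℂ f) {lam mu : ℝ} (hl : 0 < lam) (hm : 0 < mu)
    {a : ℍ} {γ : SL(2, ℤ)} {y y' : Fin 3 → ℂ → ℂ} (h : IsBranch (extTriple f) a y)
    (h' : IsBranch (extTriple f) (γ • a : ℍ) y') (l : Fin 2) :
    u lam mu y' l (γ • a : ℍ) - 2 * Real.log ‖deriv (ext wfun) (γ • a : ℍ)‖ =
      u lam mu y l a - 2 * Real.log ‖deriv (ext wfun) a‖ := by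
  have hw : deriv (ext wfun) a ≠ 0 := deriv_wfun_ne_zero_of_not_isSingularPoint hf fun hs =>
    (isSingularPoint_iff hf a).1 hs ⟨y, h⟩
  have hd := denom_smul_ne_zero γ a
  have e1 := h.u_eq_u hl hm (h'.transport_mobius hf) (eventually_wronskian_ne_zero hf a) l
  have hW := (h'.wronskian_eq_one (eventually_wronskian_ne_zero hf _)).self_of_nhds
  have hy := h'.analyticAt
  rw [← mobius_coe] at hW hy
  rw [u_transport hl hm (analyticAt_mobius γ a) hy (deriv_mobius_ne_zero γ a)
    (hW.trans_ne one_ne_zero), mobius_coe] at e1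
  -- With d the automorphy denominator, u at γa exceeds u at a by -2 log |γ'| = 4 log |d|. This is
  -- cancelled by w'(γa) = d² w'(a).
  rw [e1, deriv_wfun_smul, deriv_mobius, norm_mul, norm_inv, norm_pow, Real.log_mul, Real.log_inv]
  · ring
  · exact pow_ne_zero _ (norm_ne_zero_iff.2 hd)
  · exact norm_ne_zero_iff.2 hw

theorem toda_wfun (hf : LinearIndependent ℂ f) {lam mu : ℝ} (hl : 0 < lam) (hm : 0 < mu)
    {z : ℍ} {y : Fin 3 → ℂ → ℂ} (h : IsBranch (extTriple f) z y) (l : Fin 2) :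
    toda f lam mu l (wfun z) = u lam mu y l z - 2 * Real.log ‖deriv (ext wfun) z‖ := by
  have hs := (wfun_surjective (wfun z)).choose_spec
  obtain ⟨γ, hγ⟩ := wfun_eq_wfun_iff.1 hs
  have he : ∃ y, IsBranch (extTriple f) (wfun_surjective (wfun z)).choose y := by
    rw [hγ, exists_isBranch_smul_iff hf]
    exact ⟨y, h⟩
  rw [toda, dif_pos he]
  have hb := he.choose_spec
  generalize he.choose = y' at *
  rw [hγ] at hb ⊢
  exact h.u_sub_log_eq hf hl hm hb l

/-- Near the image of a non-singular point, `v` is the function `u` of a triple of holomorphic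
functions with Wronskian one. -/
theorem exists_toda_eq_u (hf : LinearIndependent ℂ f) {z : ℍ} {y : Fin 3 → ℂ → ℂ}
    (h : IsBranch (extTriple f) z y) : ∃ Y : Fin 3 → ℂ → ℂ, (∀ j, AnalyticAt ℂ (Y j) (wfun z)) ∧
      (∀ᶠ x in 𝓝 (wfun z), wronskian Y x = 1) ∧
      ∀ lam mu : ℝ, 0 < lam → 0 < mu → ∀ l, toda f lam mu l =ᶠ[𝓝 (wfun z)] u lam mu Y l := by
  have hw0 : deriv (ext wfun) z ≠ 0 := deriv_wfun_ne_zero_of_not_isSingularPoint hf fun hs =>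
    (isSingularPoint_iff hf z).1 hs ⟨y, h⟩
  have hwa := analyticAt_wfun z
  obtain ⟨ζ, hζ, hζz, hζr⟩ := exists_analytic_local_inverse hwa hw0
  rw [ext_coe] at hζ hζz hζr
  have hζt : Tendsto ζ (𝓝 (wfun z)) (𝓝 (z : ℂ)) := by
    have := hζ.continuousAt.tendsto
    rwa [hζz] at this
  have hW := h.wronskian_eq_one (eventually_wronskian_ne_zero hf z)
  have hloc : ∀ᶠ x in 𝓝 (wfun z), AnalyticAt ℂ ζ x ∧ (∀ j, AnalyticAt ℂ (y j) (ζ x)) ∧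
      wronskian y (ζ x) = 1 ∧ IsBranch (extTriple f) (ζ x) y ∧ 0 < (ζ x).im ∧
      ext wfun (ζ x) = x ∧ deriv ζ x * deriv (ext wfun) (ζ x) = 1 := by
    filter_upwards [hζ.eventually_analyticAt, hζt.eventually (eventually_all.2 fun j =>
      (h.analyticAt j).eventually_analyticAt), hζt.eventually hW, hζt.eventually h.eventually,
      hζt.eventually (eventually_im_pos z), hζr.eventually_nhds,
      hζt.eventually hwa.eventually_analyticAt] with x h1 h2 h3 h4 h5 h6 h7
    refine ⟨h1, h2, h3, h4, h5, h6.self_of_nhds, ?_⟩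
    have e : deriv (fun x => ext wfun (ζ x)) x = 1 := by
      have h6' : (fun x => ext wfun (ζ x)) =ᶠ[𝓝 x] id := h6
      rw [h6'.deriv_eq, deriv_id]
    rw [← e]
    exact ((h7.differentiableAt.hasDerivAt.comp x h1.differentiableAt.hasDerivAt).deriv.trans
      (mul_comm _ _)).symm
  have hself := hloc.self_of_nhds
  -- Transport along the local inverse ζ of w: the term 2 log |ζ'| of `u_transport` is -2 log |w'|.
  refine ⟨transport ζ y, analyticAt_transport hself.1 hself.2.1
    (left_ne_zero_of_mul_eq_one hself.2.2.2.2.2.2), ?_, ?_⟩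
  · filter_upwards [hloc] with x ⟨h1, h2, h3, h4, h5, h6, h7⟩
    rw [wronskian_transport h1 h2 (left_ne_zero_of_mul_eq_one h7), h3]
  · intro lam mu hl hm l
    filter_upwards [hloc] with x ⟨h1, h2, h3, h4, h5, h6, h7⟩
    rw [u_transport hl hm h1 h2 (left_ne_zero_of_mul_eq_one h7) (h3.trans_ne one_ne_zero)]
    have e := toda_wfun hf hl hm (z := ⟨ζ x, h5⟩) (y := y) h4 l
    rw [ext_of_im_pos _ h5] at h6
    rw [h6] at e
    rw [e, eq_inv_of_mul_eq_one_left h7, norm_inv, Real.log_inv]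
    change u lam mu y l (ζ x) - 2 * Real.log ‖deriv (ext wfun) (ζ x)‖ = _
    ring

/-- Limits at w(z₀) can thus be computed upstairs at z₀ even where w is ramified and has no local
inverse. -/
theorem nhdsNE_le_map_ext_wfun (z : ℍ) : 𝓝[≠] wfun z ≤ map (ext wfun) (𝓝[≠] (z : ℂ)) := by
  intro s hs
  rw [mem_map, mem_nhdsWithin_iff_eventually] at hs
  rw [mem_nhdsWithin_iff_eventually]
  refine nhds_le_map_ext_wfun z (mem_map.2 ?_)
  filter_upwards [hs] with x hx hne
  refine hx fun he => hne ?_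
  rw [Set.mem_singleton_iff.1 he, ext_coe]
  rfl

/-- The logarithmic singularity of `v` at the image of `z₀`. -/
theorem HasOrders.exists_tendsto_toda (hf : LinearIndependent ℂ f) {lam mu : ℝ} (hl : 0 < lam)
    (hm : 0 < mu) {z₀ : ℍ} {n : Fin 3 → ℕ} (h : HasOrders (extTriple f) z₀ n) {e : ℕ} (he : 0 < e)
    (hord : analyticOrderAt (fun x => ext wfun x - wfun z₀) z₀ = e) (l : Fin 2) :
    ∃ L : ℝ, Tendsto (fun x => toda f lam mu l x -
      (2 * ((![n 1 - n 0 - 1, n 2 - n 1 - 1] : Fin 2 → ℕ) l : ℝ) - 2 * (e - 1)) / e *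
        Real.log ‖x - wfun z₀‖) (𝓝[≠] wfun z₀) (𝓝 L) := by
  obtain ⟨L, hL⟩ := h.exists_tendsto_u (analyticAt_extTriple f z₀) hl hm l
  set m : ℝ := ((![n 1 - n 0 - 1, n 2 - n 1 - 1] : Fin 2 → ℕ) l : ℝ)
  have hwa := analyticAt_wfun z₀
  have hsub : AnalyticAt ℂ (fun x => ext wfun x - wfun z₀) z₀ := hwa.sub analyticAt_const
  obtain ⟨G, hG, hG0, hGe⟩ := hsub.analyticOrderAt_eq_natCast.1 hord
  have hdord : analyticOrderAt (deriv (ext wfun)) z₀ = (e - 1 : ℕ) := by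
    have h1 := hwa.analyticOrderAt_deriv_add_one
    rw [ext_coe, hord] at h1
    have h2 : (e : ℕ∞) = ((e - 1 : ℕ) : ℕ∞) + 1 := by
      exact_mod_cast (Nat.sub_add_cancel he).symm
    rw [h2] at h1
    exact (ENat.add_left_injective_of_ne_top (by simp)) h1
  obtain ⟨H, hH, hH0, hHe⟩ := hwa.deriv.analyticOrderAt_eq_natCast.1 hdord
  have he0 : (e : ℝ) ≠ 0 := by positivity
  -- Write w - w(z₀) = (z - z₀)^e G and w' = (z - z₀)^(e - 1) H. Trading log |z - z₀| for log |w -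
  -- w(z₀)| divides the coefficient by e and leaves only the convergent terms in G and H.
  have lim : Tendsto (fun x => (u lam mu (extTriple f) l x +
      ![0, 2] l * Real.log ‖wronskian (extTriple f) x‖ - 2 * m * Real.log ‖x - z₀‖) -
      2 * Real.log ‖H x‖ - (2 * m - 2 * (e - 1)) / e * Real.log ‖G x‖) (𝓝[≠] (z₀ : ℂ))
      (𝓝 (L - 2 * Real.log ‖H z₀‖ - (2 * m - 2 * (e - 1)) / e * Real.log ‖G z₀‖)) := by
    have hc : ∀ {K : ℂ → ℂ}, AnalyticAt ℂ K z₀ → K z₀ ≠ 0 →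
        Tendsto (fun x => Real.log ‖K x‖) (𝓝[≠] (z₀ : ℂ)) (𝓝 (Real.log ‖K z₀‖)) := fun hK hK0 =>
      ((hK.continuousAt.norm.log (norm_ne_zero_iff.2 hK0)).tendsto).mono_left nhdsWithin_le_nhds
    exact (hL.sub ((hc hH hH0).const_mul 2)).sub ((hc hG hG0).const_mul _)
  refine ⟨_, Tendsto.mono_left (tendsto_map'_iff.2 (lim.congr' ?_)) (nhdsNE_le_map_ext_wfun z₀)⟩
  filter_upwards [hGe.filter_mono nhdsWithin_le_nhds, hHe.filter_mono nhdsWithin_le_nhds,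
    (eventually_im_pos z₀).filter_mono nhdsWithin_le_nhds, TodaModular.eventually_wronskian_ne_zero hf z₀,
    self_mem_nhdsWithin, (hG.continuousAt.eventually_ne hG0).filter_mono nhdsWithin_le_nhds,
    (hH.continuousAt.eventually_ne hH0).filter_mono nhdsWithin_le_nhds]
    with x g1 g2 him hW hx hGx hHx
  have hx0 : ‖x - z₀‖ ≠ 0 := norm_ne_zero_iff.2 (sub_ne_zero.2 hx)
  obtain ⟨y, hy⟩ := exists_isBranch_of_wronskian_ne_zero (z := ⟨x, him⟩) hW
  have e1 := toda_wfun hf hl hm hy l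
  rw [hy.u_eq hl hm hW] at e1
  have e2 : ext wfun x = wfun ⟨x, him⟩ := ext_of_im_pos _ him
  rw [Function.comp_apply, g1, e2, e1]
  change _ = u lam mu (extTriple f) l x + _ * Real.log ‖wronskian (extTriple f) x‖ -
    2 * Real.log ‖deriv (ext wfun) x‖ - _
  rw [g2, smul_eq_mul, smul_eq_mul, norm_mul, norm_mul, norm_pow, norm_pow,
    Real.log_mul (pow_ne_zero _ hx0) (norm_ne_zero_iff.2 hGx),
    Real.log_mul (pow_ne_zero _ hx0) (norm_ne_zero_iff.2 hHx), Real.log_pow, Real.log_pow,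
    Nat.cast_sub he, Nat.cast_one]
  field_simp
  ring

/-- Δw' and Δw = E₄³/1728 both have nonzero limits at the cusp, so w'/w has one too. -/
theorem tendsto_log_norm_deriv_wfun : ∃ L : ℝ,
    Tendsto (fun z : ℍ => Real.log ‖deriv (ext wfun) z‖ - Real.log ‖wfun z‖) atImInfty (𝓝 L) := by
  obtain ⟨A, hA, hlim⟩ := tendsto_disc_mul_deriv_wfun
  have h4 := tendsto_modularForm ModularForm.E₄
  rw [cuspFun_E₄_zero] at h4
  have h1 := (hlim.norm.log (norm_ne_zero_iff.2 hA)).sub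
    ((h4.norm.log (by simp)).const_mul 3)
  refine ⟨_, (h1.add_const (Real.log 1728)).congr' ?_⟩
  filter_upwards [E₄_ne, hlim.eventually_ne hA] with z hz hz'
  have hd := discForm_ne_zero z
  rw [wfun_eq, norm_mul, norm_div, norm_mul, norm_pow,
    Real.log_mul (norm_ne_zero_iff.2 hd) (norm_ne_zero_iff.2 (right_ne_zero_of_mul hz')),
    Real.log_div (pow_ne_zero _ (norm_ne_zero_iff.2 hz)) (mul_ne_zero (by norm_num)
      (norm_ne_zero_iff.2 hd)), Real.log_mul (by norm_num) (norm_ne_zero_iff.2 hd), Real.log_pow]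
  norm_num
  ring

theorem tendsto_log_norm_wfun_add : ∃ L : ℝ,
    Tendsto (fun z : ℍ => Real.log ‖wfun z‖ + Real.log ‖qpar z‖) atImInfty (𝓝 L) := by
  obtain ⟨κ, hκ, hκ0, h⟩ := exists_wfun_eq_div_qpar
  have hq := tendsto_qpar.mono_right nhdsWithin_le_nhds
  refine ⟨_, (((hκ.continuousAt.tendsto.comp hq).norm.log (norm_ne_zero_iff.2 hκ0))).congr' ?_⟩
  filter_upwards [hq.eventually h, hq.eventually (hκ.continuousAt.eventually_ne hκ0)] with z hz hz0
  have e := hz z z.im_pos rfl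
  rw [ext_coe] at e
  rw [e, norm_div, Real.log_div (norm_ne_zero_iff.2 hz0) (norm_ne_zero_iff.2 (qpar_ne_zero _))]
  simp

/-- A property of points near the cusp, seen on the values of `w`. -/
theorem eventually_cobounded_of_atImInfty {p : ℂ → Prop}
    (h : ∀ᶠ z : ℍ in atImInfty, p (wfun z)) : ∀ᶠ x in Bornology.cobounded ℂ, p x := by
  obtain ⟨Y, hY⟩ := (atImInfty_mem _).1 h
  obtain ⟨R, hR⟩ := exists_lt_im_of_lt_norm_wfun Y
  filter_upwards [tendsto_norm_cobounded_atTop.eventually_gt_atTop R] with x hx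
  obtain ⟨z, rfl⟩ := wfun_surjective x
  obtain ⟨γ, hγ, he⟩ := exists_fd_wfun_eq z
  rw [← he] at hx ⊢
  exact hY _ (hR _ hγ hx).le

/-- Up to bounded terms, u = 2m log |q| with log |q| = -log |w|, and -2 log |w'| = -2 log |w|.
Together this is -2(m + 1) log |w|. -/
theorem toda_isBigO {m : ℕ} (hf : LinearIndependent ℂ f) {lam mu : ℝ} (hl : 0 < lam) (hm : 0 < mu)
    (l : Fin 2) (hW : ∀ᶠ z : ℍ in atImInfty, wronskian (extTriple f) z ≠ 0) {L : ℝ}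
    (hL : Tendsto (fun z : ℍ => u lam mu (extTriple f) l z +
      ![0, 2] l * Real.log ‖wronskian (extTriple f) z‖ - 2 * m * Real.log ‖qpar z‖)
      atImInfty (𝓝 L)) :
    (fun x => toda f lam mu l x + 2 * ((m : ℝ) + 1) * Real.log ‖x‖) =O[Bornology.cobounded ℂ]
      (fun _ => (1 : ℝ)) := by
  obtain ⟨L₁, h1⟩ := tendsto_log_norm_deriv_wfun
  obtain ⟨L₂, h2⟩ := tendsto_log_norm_wfun_add
  have key := (hL.sub (h1.const_mul 2)).add (h2.const_mul (2 * (m : ℝ)))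
  refine isBigO_iff.2 ⟨|L - 2 * L₁ + 2 * m * L₂| + 1, eventually_cobounded_of_atImInfty ?_⟩
  filter_upwards [hW, key.norm.eventually_lt_const (lt_add_one _)] with z hz hlt
  obtain ⟨y, hy⟩ := exists_isBranch_of_wronskian_ne_zero hz
  rw [toda_wfun hf hl hm hy, hy.u_eq hl hm hz, norm_one, mul_one]
  refine le_trans (le_of_eq ?_) hlt.le
  congr 1
  ring

end Toda


/-! ### The singular system and the global Toda solution. -/

section Solution

variable {k : ℤ} {f : Fin 3 → ModularForm 𝒮ℒ k}

/-- Orbits correspond to values of w, so the z_j are one preimage for each singular value other than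
w(ρ) = 0 and w(i) = 1. -/
theorem exists_isSingularSystem (hf : LinearIndependent ℂ f) : ∃ (n : ℕ) (z : Fin n → ℍ),
    IsSingularSystem (eqQ₂ (extTriple f)) (eqQ₃ (extTriple f)) z := by
  classical
  set T : Set ℂ := (wfun '' {z : ℍ | z ∈ ModularGroup.fd ∧
    IsSingularPoint (eqQ₂ (extTriple f)) (eqQ₃ (extTriple f)) z}) \ {0, 1} with hT
  have hfin : T.Finite := ((finite_singular hf).image _).sdiff
  have : Fintype T := hfin.fintype
  let e := Fintype.equivFin T
  choose r hr using wfun_surjective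
  have hz : ∀ j, wfun (r (e.symm j)) = e.symm j := fun j => hr _
  have hne : ∀ (γ : SL(2, ℤ)) (j) (b : ℍ), wfun b ∈ ({0, 1} : Set ℂ) → γ • r (e.symm j) ≠ b := by
    rintro γ j b hb rfl
    rw [wfun_smul, hz] at hb
    exact (e.symm j).2.2 hb
  refine ⟨Fintype.card T, fun j => r (e.symm j), fun a => ⟨fun ha => ?_, ?_⟩,
    fun γ j => hne γ j I (by simp [wfun_I]), fun γ j => hne γ j rho (by simp [wfun_rho]), ?_⟩
  · by_cases h1 : wfun a = 1
    · obtain ⟨γ, hγ⟩ := wfun_eq_wfun_iff.1 (h1.trans wfun_I.symm)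
      exact ⟨γ, .inl hγ⟩
    by_cases h0 : wfun a = 0
    · obtain ⟨γ, hγ⟩ := wfun_eq_wfun_iff.1 (h0.trans wfun_rho.symm)
      exact ⟨γ, .inr (.inl hγ)⟩
    obtain ⟨γ, hγ, hw⟩ := exists_fd_wfun_eq a
    have hmem : wfun a ∈ T := ⟨⟨γ • a, ⟨hγ, (isSingularPoint_smul_iff hf γ a).2 ha⟩, hw⟩, by
      simp [h0, h1]⟩
    obtain ⟨γ', hγ'⟩ := wfun_eq_wfun_iff.1 (((hz (e ⟨_, hmem⟩)).trans (by rw [e.symm_apply_apply])).symm)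
    exact ⟨γ', .inr (.inr ⟨_, hγ'⟩)⟩
  · rintro ⟨γ, rfl | rfl | ⟨j, rfl⟩⟩
    · exact (isSingularPoint_smul_iff hf _ _).2 (isSingularPoint_I hf)
    · exact (isSingularPoint_smul_iff hf _ _).2 (isSingularPoint_rho hf)
    · obtain ⟨b, ⟨-, hb⟩, hbw⟩ := (e.symm j).2.1
      rw [isSingularPoint_smul_iff hf]
      exact ((wfun_eq_wfun_iff.1 ((hz j).trans hbw.symm)).isSingularPoint_iff hf).2 hb
  · intro γ j l h
    have := congrArg wfun h
    rw [wfun_smul, hz, hz] at this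
    exact e.symm.injective (Subtype.ext this)

variable {n : ℕ} {z : Fin n → ℍ}

theorem IsSingularSystem.wfun_ne_zero {Q₂ Q₃ : ℂ → ℂ} (hz : IsSingularSystem Q₂ Q₃ z) (j : Fin n) :
    wfun (z j) ≠ 0 := by
  rw [← wfun_rho]
  intro h
  obtain ⟨γ, hγ⟩ := wfun_eq_wfun_iff.1 h.symm
  exact hz.ne_rho γ j hγ.symm

theorem IsSingularSystem.wfun_ne_one {Q₂ Q₃ : ℂ → ℂ} (hz : IsSingularSystem Q₂ Q₃ z) (j : Fin n) :
    wfun (z j) ≠ 1 := by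
  rw [← wfun_I]
  intro h
  obtain ⟨γ, hγ⟩ := wfun_eq_wfun_iff.1 h.symm
  exact hz.ne_I γ j hγ.symm

theorem IsSingularSystem.injective {Q₂ Q₃ : ℂ → ℂ} (hz : IsSingularSystem Q₂ Q₃ z) :
    Function.Injective fun j => wfun (z j) := by
  intro i j h
  obtain ⟨γ, hγ⟩ := wfun_eq_wfun_iff.1 h.symm
  exact hz.inequivalent γ i j hγ.symm

theorem IsSingularSystem.exists_isBranch (hf : LinearIndependent ℂ f)
    (hz : IsSingularSystem (eqQ₂ (extTriple f)) (eqQ₃ (extTriple f)) z) {a : ℍ}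
    (ha : wfun a ∉ sources fun j => wfun (z j)) : ∃ y, IsBranch (extTriple f) a y := by
  by_contra hne
  obtain ⟨γ, rfl | rfl | ⟨j, rfl⟩⟩ := (hz.singular_iff a).1 ((isSingularPoint_iff hf a).2 hne)
  · exact ha (by rw [wfun_smul, wfun_I]; simp [sources])
  · exact ha (by rw [wfun_smul, wfun_rho]; simp [sources])
  · exact ha (by rw [wfun_smul]; simp [sources])

theorem IsSingularSystem.exists_toda_eq_u (hf : LinearIndependent ℂ f)
    (hz : IsSingularSystem (eqQ₂ (extTriple f)) (eqQ₃ (extTriple f)) z) {x : ℂ}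
    (hx : x ∉ sources fun j => wfun (z j)) :
    ∃ Y : Fin 3 → ℂ → ℂ, (∀ j, AnalyticAt ℂ (Y j) x) ∧ (∀ᶠ x in 𝓝 x, wronskian Y x = 1) ∧
      ∀ lam mu : ℝ, 0 < lam → 0 < mu → ∀ l, toda f lam mu l =ᶠ[𝓝 x] u lam mu Y l := by
  obtain ⟨a, rfl⟩ := wfun_surjective x
  obtain ⟨y, hy⟩ := hz.exists_isBranch hf hx
  exact TodaModular.exists_toda_eq_u hf hy

/-- The numbers `m¹ = n₁ - n₀ - 1` and `m² = n₂ - n₁ - 1` attached to orders `n₀ < n₁ < n₂`. -/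
abbrev gaps (n : Fin 3 → ℕ) : Fin 2 → ℕ := ![n 1 - n 0 - 1, n 2 - n 1 - 1]

theorem one_le_gaps_I {n : Fin 3 → ℕ} (h : HasOrders (extTriple f) I n) (l : Fin 2) :
    1 ≤ gaps n l := by
  have h1 := h.two_le_I (i := 0) (j := 1) (by decide)
  have h2 := h.two_le_I (i := 1) (j := 2) (by decide)
  fin_cases l
  · change 1 ≤ n 1 - n 0 - 1
    omega
  · change 1 ≤ n 2 - n 1 - 1
    omega

theorem two_le_gaps_rho {n : Fin 3 → ℕ} (h : HasOrders (extTriple f) rho n) (l : Fin 2) :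
    2 ≤ gaps n l := by
  have h1 := h.three_le_rho (i := 0) (j := 1) (by decide)
  have h2 := h.three_le_rho (i := 1) (j := 2) (by decide)
  fin_cases l
  · change 2 ≤ n 1 - n 0 - 1
    omega
  · change 2 ≤ n 2 - n 1 - 1
    omega

theorem analyticOrderAt_wfun_of_ne {a : ℍ} (h0 : wfun a ≠ 0) (h1 : wfun a ≠ 1) :
    analyticOrderAt (fun x => ext wfun x - wfun a) a = (1 : ℕ) := by
  have hd := wfun_order_one (mt (E₄_eq_zero_iff a).1 h0) (mt (E₆_eq_zero_iff a).1 h1)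
  have := (analyticAt_wfun a).analyticOrderAt_deriv_add_one
  rw [ext_coe, (analyticAt_wfun a).deriv.analyticOrderAt_eq_zero.2 hd] at this
  simpa using this.symm

theorem abs_le_of_tendsto_sub_log {v : ℂ → ℝ} {a L : ℝ} {s : ℂ}
    (h : Tendsto (fun x => v x - a * Real.log ‖x - s‖) (𝓝[≠] s) (𝓝 L)) :
    ∃ C, ∀ᶠ x in 𝓝[≠] s, |v x| ≤ C * (|Real.log ‖x - s‖| + 1) := by
  refine ⟨|a| + (|L| + 1), ?_⟩
  filter_upwards [h.norm.eventually_lt_const (lt_add_one _)] with x hx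
  rw [Real.norm_eq_abs, Real.norm_eq_abs] at hx
  have h1 : |v x| ≤ |v x - a * Real.log ‖x - s‖| + |a| * |Real.log ‖x - s‖| := by
    rw [← abs_mul]
    simpa using abs_add_le (v x - a * Real.log ‖x - s‖) (a * Real.log ‖x - s‖)
  have := abs_nonneg (Real.log ‖x - s‖)
  have := abs_nonneg a
  have := abs_nonneg L
  nlinarith

/-- A nonnegative coefficient makes v bounded above near s. At the images of i and ρ this rests on
`one_le_gaps_I` and `two_le_gaps_rho`. -/
theorem exp_le_of_tendsto_sub_log {v : ℂ → ℝ} {a L : ℝ} {s : ℂ} (ha : 0 ≤ a)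
    (h : Tendsto (fun x => v x - a * Real.log ‖x - s‖) (𝓝[≠] s) (𝓝 L)) :
    ∃ C, ∀ᶠ x in 𝓝[≠] s, |Real.exp (v x)| ≤ C * (|Real.log ‖x - s‖| + 1) := by
  refine ⟨Real.exp (L + 1), ?_⟩
  have hball : ∀ᶠ x in 𝓝[≠] s, x ∈ Metric.ball s 1 :=
    mem_nhdsWithin_of_mem_nhds (Metric.ball_mem_nhds s one_pos)
  filter_upwards [h.eventually_lt_const (lt_add_one L), hball] with x hx hb
  rw [mem_ball_iff_norm] at hb
  have h1 : Real.log ‖x - s‖ ≤ 0 := Real.log_nonpos (norm_nonneg _) hb.le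
  have h2 : v x ≤ L + 1 := by nlinarith
  rw [Real.abs_exp]
  have := abs_nonneg (Real.log ‖x - s‖)
  have h3 := Real.exp_le_exp.2 h2
  nlinarith [Real.exp_pos (L + 1)]

theorem isTodaSolution (hf : LinearIndependent ℂ f)
    (hz : IsSingularSystem (eqQ₂ (extTriple f)) (eqQ₃ (extTriple f)) z) {ni nρ : Fin 3 → ℕ}
    {nz : Fin n → Fin 3 → ℕ} (hi : HasOrders (extTriple f) I ni)
    (hρ : HasOrders (extTriple f) rho nρ) (hnz : ∀ j, HasOrders (extTriple f) (z j) (nz j))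
    {m : Fin 2 → ℕ} {lam mu : ℝ} (hl : 0 < lam) (hm : 0 < mu)
    (hW : ∀ᶠ z : ℍ in atImInfty, wronskian (extTriple f) z ≠ 0)
    (hinf : ∀ l, ∃ L, Tendsto (fun z : ℍ => u lam mu (extTriple f) l z +
      ![0, 2] l * Real.log ‖wronskian (extTriple f) z‖ - 2 * m l * Real.log ‖qpar z‖)
      atImInfty (𝓝 L)) :
    IsTodaSolution (fun j => wfun (z j)) (fun l => ((gaps ni l : ℝ) - 1) / 2)
      (fun l => ((gaps nρ l : ℝ) - 2) / 3) (fun j l => (gaps (nz j) l : ℝ))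
      (fun l => 2 * ((m l : ℝ) + 1)) (toda f lam mu) := by
  classical
  set p : Fin n → ℂ := fun j => wfun (z j) with hp
  set S : Finset ℂ := insert 0 (insert 1 (Finset.univ.image p)) with hS
  have hSs : ∀ x, x ∈ S ↔ x ∈ sources p := fun x => by
    simp [hS, sources, or_assoc]
  -- `α` is twice each coefficient in the Toda system, because α log |x - s| contributes the mass
  -- 2πα and the right-hand side carries 4π. The sum over j has a single term at each `p j`, as
  -- these are distinct.
  set α : Fin 2 → ℂ → ℝ := fun l s => if s = 0 then 2 * (((gaps nρ l : ℝ) - 2) / 3) else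
    if s = 1 then 2 * (((gaps ni l : ℝ) - 1) / 2) else
      ∑ j, if p j = s then 2 * (gaps (nz j) l : ℝ) else 0 with hα
  have hα0 : ∀ l, α l 0 = 2 * (((gaps nρ l : ℝ) - 2) / 3) := fun l => if_pos rfl
  have hα1 : ∀ l, α l 1 = 2 * (((gaps ni l : ℝ) - 1) / 2) := fun l => by simp [hα]
  have hαj : ∀ l j, α l (p j) = 2 * (gaps (nz j) l : ℝ) := fun l j => by
    simp only [hα, if_neg (hz.wfun_ne_zero j), if_neg (hz.wfun_ne_one j), hp]
    rw [Finset.sum_eq_single j (fun i _ hij => if_neg fun h => hij (hz.injective h)) (by simp),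
      if_pos rfl]
  have hlim : ∀ l, ∀ s ∈ S, 0 ≤ α l s ∧
      ∃ L, Tendsto (fun x => toda f lam mu l x - α l s * Real.log ‖x - s‖) (𝓝[≠] s) (𝓝 L) := by
    intro l s hs
    simp only [hS, Finset.mem_insert, Finset.mem_image, Finset.mem_univ, true_and] at hs
    rcases hs with rfl | rfl | ⟨j, rfl⟩
    · rw [hα0]
      have h2 : (2 : ℝ) ≤ gaps nρ l := by exact_mod_cast two_le_gaps_rho hρ l
      refine ⟨by linarith, ?_⟩
      obtain ⟨L, hL⟩ := hρ.exists_tendsto_toda hf hl hm (by norm_num)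
        (analyticOrderAt_wfun_of_E₄_eq_zero E₄_rho) l
      rw [wfun_rho] at hL
      refine ⟨L, hL.congr fun x => ?_⟩
      push_cast
      ring
    · rw [hα1]
      have h2 : (1 : ℝ) ≤ gaps ni l := by exact_mod_cast one_le_gaps_I hi l
      refine ⟨by linarith, ?_⟩
      obtain ⟨L, hL⟩ := hi.exists_tendsto_toda hf hl hm (by norm_num)
        (analyticOrderAt_wfun_of_E₆_eq_zero E₆_I) l
      rw [wfun_I] at hL
      refine ⟨L, hL.congr fun x => ?_⟩
      push_cast
      ring
    · rw [hαj]
      refine ⟨by positivity, ?_⟩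
      obtain ⟨L, hL⟩ := (hnz j).exists_tendsto_toda hf hl hm one_pos
        (analyticOrderAt_wfun_of_ne (hz.wfun_ne_zero j) (hz.wfun_ne_one j)) l
      refine ⟨L, hL.congr fun x => ?_⟩
      push_cast
      ring
  have hreg : ∀ l, ∀ x ∉ S, ContDiffAt ℝ ∞ (toda f lam mu l) x ∧ Δ (toda f lam mu l) x =
      -(2 * Real.exp (toda f lam mu l x) - Real.exp (toda f lam mu l.rev x)) := by
    intro l x hx
    obtain ⟨Y, hY, hWY, hu⟩ := hz.exists_toda_eq_u hf (mt (hSs x).2 hx)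
    have hne := exists_ne_of_wronskian_ne (hWY.self_of_nhds.trans_ne one_ne_zero)
    refine ⟨(contDiffAt_u hl hm hY hne.1 hne.2 l).congr_of_eventuallyEq (hu lam mu hl hm l), ?_⟩
    rw [(InnerProductSpace.laplacian_congr_nhds (hu lam mu hl hm l)).self_of_nhds,
      laplacian_u hl hm hY hWY.self_of_nhds, (hu lam mu hl hm l).self_of_nhds,
      (hu lam mu hl hm l.rev).self_of_nhds]
  have hI : ∀ l, LocallyIntegrable (toda f lam mu l) := fun l =>
    locallyIntegrable_of_log_bound S.finite_toSet (fun x hx => (hreg l x hx).1.continuousAt)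
      fun s hs => abs_le_of_tendsto_sub_log (hlim l s hs).2.choose_spec
  have hIe : ∀ l, LocallyIntegrable fun x => Real.exp (toda f lam mu l x) := fun l =>
    locallyIntegrable_of_log_bound S.finite_toSet
      (fun x hx => (hreg l x hx).1.continuousAt.rexp)
      fun s hs => exp_le_of_tendsto_sub_log (hlim l s hs).1 (hlim l s hs).2.choose_spec
  refine ⟨fun l x hx => (hreg l x (mt (hSs x).1 hx)).1.contDiffWithinAt, hI, hIe, ?_, ?_⟩
  · intro l φ hφ hφc
    have key := pairing_eq_sum_of_log_singularities (S := S) (α := α l)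
      (v := toda f lam mu l)
      (f := fun x => 2 * Real.exp (toda f lam mu l x) - Real.exp (toda f lam mu l.rev x))
      (fun x hx => (hreg l x hx).1.of_le (WithTop.coe_le_coe.2 le_top)) (fun x hx => (hreg l x hx).2)
      (fun s hs => (hlim l s hs).2) (hI l) (((hIe l).smul (2 : ℝ)).sub (hIe l.rev)) hφ hφc
    rw [pairing] at key
    rw [key, hS, Finset.sum_insert, Finset.sum_insert, Finset.sum_image hz.injective.injOn, hα0, hα1]
    · simp only [Finset.mul_sum, mul_add]
      rw [← add_assoc, add_comm (2 * Real.pi * _ * φ 0)]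
      congr 1
      · ring
      · exact Finset.sum_congr rfl fun j _ => by
          rw [show α l (wfun (z j)) = _ from hαj l j]
          ring
    · simpa using fun j => hz.wfun_ne_one j
    · simpa using fun j => hz.wfun_ne_zero j
  · intro l
    obtain ⟨L, hL⟩ := hinf l
    exact toda_isBigO hf hl hm l hW hL

end Solution

/-! ### Distinct parameters give distinct solutions. -/

section Separation

/-- Apply ∂_z = (∂_x - i ∂_y)/2 to the identity: the antiholomorphic factors behave as constants.
The two directional derivatives come from restriction to real lines. -/
theorem sum_deriv_mul_star_eq_zero {d : Fin 3 → ℂ} {A B : Fin 3 → ℂ → ℂ} {x : ℂ}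
    (hA : ∀ j, AnalyticAt ℂ (A j) x) (hB : ∀ j, AnalyticAt ℂ (B j) x)
    (h : ∀ᶠ t in 𝓝 x, ∑ j, d j * (A j t * star (B j t)) = 0) :
    ∑ j, d j * (deriv (A j) x * star (B j x)) = 0 := by
  have key : ∀ c : ℂ, ∑ j, d j * (c * deriv (A j) x * star (B j x) +
      A j x * star (c * deriv (B j) x)) = 0 := by
    intro c
    have hline : HasDerivAt (fun t : ℝ => x + t * c) c 0 := by
      simpa using ((hasDerivAt_id (0 : ℝ)).ofReal_comp.mul_const c).const_add x
    have hx : x + ((0 : ℝ) : ℂ) * c = x := by simp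
    have hd : HasDerivAt (fun t : ℝ => ∑ j, d j * (A j (x + t * c) * star (B j (x + t * c))))
        (∑ j, d j * (c * deriv (A j) x * star (B j x) + A j x * star (c * deriv (B j) x))) 0 := by
      refine HasDerivAt.fun_sum fun j _ => HasDerivAt.const_mul _ ?_
      have hA' : HasDerivAt (fun t : ℝ => A j (x + t * c)) (c * deriv (A j) x) 0 :=
        HasDerivAt.scomp (g₁ := A j) (h := fun t : ℝ => x + t * c) 0
          (by rw [hx]; exact (hA j).differentiableAt.hasDerivAt) hline
      have hB' : HasDerivAt (fun t : ℝ => B j (x + t * c)) (c * deriv (B j) x) 0 :=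
        HasDerivAt.scomp (g₁ := B j) (h := fun t : ℝ => x + t * c) 0
          (by rw [hx]; exact (hB j).differentiableAt.hasDerivAt) hline
      have := hA'.mul hB'.star
      rwa [hx] at this
    have ht : Tendsto (fun t : ℝ => x + t * c) (𝓝 0) (𝓝 x) := by
      have := hline.continuousAt.tendsto
      rwa [hx] at this
    have h0 : (fun t : ℝ => ∑ j, d j * (A j (x + t * c) * star (B j (x + t * c)))) =ᶠ[𝓝 0]
        fun _ => 0 := ht.eventually h
    rw [← hd.deriv, h0.deriv_eq, deriv_const]
  have h1 := key 1
  have h2 := key Complex.I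
  simp only [Fin.sum_univ_three, star_mul', one_mul, RCLike.star_def,
    Complex.conj_I] at h1 h2 ⊢
  linear_combination (1 / 2) * h1 - (Complex.I / 2) * h2 + (1 / 2) * (d 0 * (deriv (A 0) x *
    (starRingEnd ℂ) (B 0 x) - A 0 x * (starRingEnd ℂ) (deriv (B 0) x)) + d 1 * (deriv (A 1) x *
    (starRingEnd ℂ) (B 1 x) - A 1 x * (starRingEnd ℂ) (deriv (B 1) x)) + d 2 * (deriv (A 2) x *
    (starRingEnd ℂ) (B 2 x) - A 2 x * (starRingEnd ℂ) (deriv (B 2) x))) * Complex.I_sq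

/-- Squared absolute values of functions with non-vanishing Wronskian are linearly independent. -/
theorem eq_zero_of_sum_mul_norm_sq {Y : Fin 3 → ℂ → ℂ} {x : ℂ} (hY : ∀ j, AnalyticAt ℂ (Y j) x)
    (hW : ∀ᶠ t in 𝓝 x, wronskian Y t ≠ 0) {d : Fin 3 → ℝ}
    (h : ∀ᶠ t in 𝓝 x, ∑ j, d j * ‖Y j t‖ ^ 2 = 0) : d = 0 := by
  have hYe := eventually_all.2 fun j => (hY j).eventually_analyticAt
  have h0 : ∀ᶠ t in 𝓝 x, ∑ j, (d j : ℂ) * (Y j t * star (Y j t)) = 0 := by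
    filter_upwards [h] with t ht
    have : ((∑ j, d j * ‖Y j t‖ ^ 2 : ℝ) : ℂ) = 0 := by rw [ht, Complex.ofReal_zero]
    rw [← this]
    push_cast
    exact Finset.sum_congr rfl fun j _ => by rw [RCLike.star_def, Complex.mul_conj']
  have h1 : ∀ᶠ t in 𝓝 x, ∑ j, (d j : ℂ) * (deriv (Y j) t * star (Y j t)) = 0 := by
    filter_upwards [h0.eventually_nhds, hYe] with t ht hYt
    exact sum_deriv_mul_star_eq_zero hYt hYt ht
  have h2 : ∀ᶠ t in 𝓝 x, ∑ j, (d j : ℂ) * (deriv (deriv (Y j)) t * star (Y j t)) = 0 := by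
    filter_upwards [h1.eventually_nhds, hYe] with t ht hYt
    exact sum_deriv_mul_star_eq_zero (A := fun j => deriv (Y j)) (fun j => (hYt j).deriv) hYt ht
  have hz : ∀ᶠ t in 𝓝 x, ∀ j, (d j : ℂ) * star (Y j t) = 0 := by
    filter_upwards [h0, h1, h2, hW] with t e0 e1 e2 hWt
    -- The three identities say that the row vector with entries d_j conj(Y_j) is annihilated by the
    -- invertible Wronskian matrix.
    refine congrFun (Matrix.eq_zero_of_vecMul_eq_zero hWt (v := fun j => (d j : ℂ) * star (Y j t)) ?_)
    funext i
    fin_cases i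
    · simpa [Matrix.vecMul, dotProduct, mul_comm, mul_left_comm, mul_assoc] using e0
    · simpa [Matrix.vecMul, dotProduct, mul_comm, mul_left_comm, mul_assoc] using e1
    · simpa [Matrix.vecMul, dotProduct, mul_comm, mul_left_comm, mul_assoc, iteratedDeriv_succ,
        iteratedDeriv_zero] using e2
  funext j
  by_contra hd
  have hYz : Y j =ᶠ[𝓝 x] fun _ => 0 := hz.mono fun t ht => by
    have hd' : (d j : ℂ) ≠ 0 := Complex.ofReal_ne_zero.2 hd
    simpa [hd'] using ht j
  refine hW.self_of_nhds (Matrix.det_eq_zero_of_row_eq_zero j fun i => ?_)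
  rw [Matrix.of_apply, hYz.iteratedDeriv_eq]
  simp

/-- Quotients of the weights by the third one are λ³ and μ³. -/
theorem eq_of_weights₁_eq {lam mu lam' mu' : ℝ} (hl : 0 < lam) (hm : 0 < mu) (hl' : 0 < lam')
    (hm' : 0 < mu') (h : weights₁ lam mu = weights₁ lam' mu') : lam = lam' ∧ mu = mu' := by
  have e0 : 1 / 4 * lam ^ 2 * mu⁻¹ = 1 / 4 * lam' ^ 2 * mu'⁻¹ := congrFun h 0
  have e1 : 1 / 4 * mu ^ 2 * lam⁻¹ = 1 / 4 * mu' ^ 2 * lam'⁻¹ := congrFun h 1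
  have e2 : 1 / 4 * lam⁻¹ * mu⁻¹ = 1 / 4 * lam'⁻¹ * mu'⁻¹ := congrFun h 2
  have a0 : lam ^ 3 = lam' ^ 3 := by
    have : lam ^ 3 = (1 / 4 * lam ^ 2 * mu⁻¹) / (1 / 4 * lam⁻¹ * mu⁻¹) := by field_simp
    rw [this, e0, e2]
    field_simp
  have a1 : mu ^ 3 = mu' ^ 3 := by
    have : mu ^ 3 = (1 / 4 * mu ^ 2 * lam⁻¹) / (1 / 4 * lam⁻¹ * mu⁻¹) := by field_simp
    rw [this, e1, e2]
    field_simp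
  exact ⟨(pow_left_inj₀ hl.le hl'.le three_ne_zero).1 a0,
    (pow_left_inj₀ hm.le hm'.le three_ne_zero).1 a1⟩

/-- Near one point outside the sources, both functions v are given by one and the same triple `Y` of
Wronskian 1. As 2u₁ + u₂ = 3U₁, equality of v forces equality of e^{-U₁}, and independence of the
|Y_j|² forces equality of the weights. -/
theorem eq_of_toda_eq {k : ℤ} {f : Fin 3 → ModularForm 𝒮ℒ k} {n : ℕ} {z : Fin n → ℍ}
    (hf : LinearIndependent ℂ f)
    (hz : IsSingularSystem (eqQ₂ (extTriple f)) (eqQ₃ (extTriple f)) z) {lam mu lam' mu' : ℝ}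
    (hl : 0 < lam) (hm : 0 < mu) (hl' : 0 < lam') (hm' : 0 < mu')
    (h : ∀ l, ∀ x ∉ sources (fun j => wfun (z j)), toda f lam mu l x = toda f lam' mu' l x) :
    lam = lam' ∧ mu = mu' := by
  have hfin : (sources fun j => wfun (z j)).Finite :=
    ((Set.finite_singleton _).insert _).union (Set.finite_range _)
  obtain ⟨x, hx⟩ := hfin.exists_notMem
  obtain ⟨Y, hY, hW, hu⟩ := hz.exists_toda_eq_u hf hx
  refine eq_of_weights₁_eq hl hm hl' hm' (sub_eq_zero.1 ?_)
  refine eq_zero_of_sum_mul_norm_sq hY (hW.mono fun t ht => ht.trans_ne one_ne_zero) ?_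
  filter_upwards [hW, hfin.isClosed.isOpen_compl.mem_nhds hx, eventually_all.2 (hu lam mu hl hm),
    eventually_all.2 (hu lam' mu' hl' hm')] with t ht hts h1 h2
  have e : ∀ l, u lam mu Y l t = u lam' mu' Y l t := fun l => by rw [← h1, ← h2, h l t hts]
  have e0 := e 0
  have e1 := e 1
  rw [u_zero_eq, u_zero_eq] at e0
  rw [u_one_eq, u_one_eq] at e1
  have hne := (exists_ne_of_wronskian_ne (ht.trans_ne one_ne_zero)).1
  have hlog : Real.log (sqSum (weights₁ lam mu) Y t) = Real.log (sqSum (weights₁ lam' mu') Y t) := by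
    linarith
  have := Real.log_injOn_pos (sqSum_pos (weights₁_pos hl hm) hne)
    (sqSum_pos (weights₁_pos hl' hm') hne) hlog
  simp only [Pi.sub_apply, sub_mul, Finset.sum_sub_distrib]
  exact sub_eq_zero.2 this

end Separation

end TodaModular

end

open TodaModular in
theorem mainTheorem6 (k : ℤ) (f g h : ModularForm 𝒮ℒ k)
    (hlin : LinearIndependent ℂ ![f, g, h]) :
    ∃ Q₂ Q₃ : ℂ → ℂ, TodaModular.IsEquationOf (TodaModular.triple f g h) Q₂ Q₃ ∧
    ∃ (n : ℕ) (z : Fin n → ℍ), TodaModular.IsSingularSystem Q₂ Q₃ z ∧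
      (∀ z₀ : ℍ, ¬ TodaModular.IsSingularPoint Q₂ Q₃ z₀ →
        ∃ y, TodaModular.IsBranch (TodaModular.triple f g h) z₀ y) ∧
    ∃ (mi mρ mInf : Fin 2 → ℕ) (mz : Fin n → Fin 2 → ℕ),
      TodaModular.HasLocalExponents Q₂ Q₃ I (TodaModular.exponents 1 mi) ∧
      TodaModular.HasLocalExponents Q₂ Q₃ TodaModular.rho (TodaModular.exponents 1 mρ) ∧
      (∀ j, TodaModular.HasLocalExponents Q₂ Q₃ (z j) (TodaModular.exponents 1 (mz j))) ∧
      TodaModular.HasLocalExponentsAtCusp Q₂ Q₃ (TodaModular.exponents 0 mInf) ∧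
      (∀ l, 1 ≤ mInf l) ∧
    ∃ v : ℝ → ℝ → Fin 2 → ℂ → ℝ,
      (∀ lam mu : ℝ, 0 < lam → 0 < mu →
        (∀ (z₀ : ℍ) (y : Fin 3 → ℂ → ℂ),
          TodaModular.IsBranch (TodaModular.triple f g h) z₀ y → ∀ l,
            v lam mu l (TodaModular.wfun z₀) = TodaModular.u lam mu y l z₀ -
              2 * Real.log ‖deriv (TodaModular.ext TodaModular.wfun) z₀‖) ∧
        TodaModular.IsTodaSolution (fun j => TodaModular.wfun (z j))
          (fun l => ((mi l : ℝ) - 1) / 2) (fun l => ((mρ l : ℝ) - 2) / 3)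
          (fun j l => (mz j l : ℝ)) (fun l => 2 * ((mInf l : ℝ) + 1)) (v lam mu)) ∧
      (∀ lam mu lam' mu' : ℝ, 0 < lam → 0 < mu → 0 < lam' → 0 < mu' →
        (∀ l, ∀ w ∉ TodaModular.sources (fun j => TodaModular.wfun (z j)),
          v lam mu l w = v lam' mu' l w) → lam = lam' ∧ mu = mu') := by
  have ht : triple f g h = extTriple ![f, g, h] := by
    funext j
    fin_cases j <;> rfl
  rw [ht]
  set F := ![f, g, h]
  have hF := analyticAt_extTriple F
  obtain ⟨n, z, hz⟩ := exists_isSingularSystem hlin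
  choose ord hord using exists_hasOrders hlin
  obtain ⟨m, hm1, hW, hexp, hinf⟩ := exists_cusp_orders hlin
  exact ⟨eqQ₂ (extTriple F), eqQ₃ (extTriple F),
    ⟨fun z₀ => (meromorphicAt_eqQ (hF z₀)).1, fun z₀ => (meromorphicAt_eqQ (hF z₀)).2,
      fun z₀ y hy => hy.solves (eventually_wronskian_ne_zero hlin z₀)⟩,
    n, z, hz, fun z₀ hz₀ => not_not.1 (mt (isSingularPoint_iff hlin z₀).2 hz₀),
    gaps (ord I), gaps (ord rho), m, fun j => gaps (ord (z j)),
    (hord I).hasLocalExponents (hF I), (hord rho).hasLocalExponents (hF rho),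
    fun j => (hord (z j)).hasLocalExponents (hF (z j)), hexp, hm1, toda F,
    fun lam mu hl hm => ⟨fun z₀ y hy l => toda_wfun hlin hl hm hy l,
      isTodaSolution hlin hz (hord I) (hord rho) (fun j => hord (z j)) hl hm hW
        (hinf lam mu hl hm)⟩,
    fun lam mu lam' mu' hl hm hl' hm' => eq_of_toda_eq hlin hz hl hm hl' hm'⟩
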